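/- Let $\mathbb H$ be the quaternions and $\mathbb S=\{J\in\mathbb H: J^2=-1\}$. For an open set $D\subseteq\mathbb C^2$ invariant under complex conjugation in each variable put $\Omega_D=\{(a_1+b_1J_1,\,a_2+b_2J_2): (a_1+ib_1,a_2+ib_2)\in D,\ J_1,J_2\in\mathbb S\}$; such sets are called circular. A function $g:\Omega_D\to\mathbb H$ is slice regular if $$g(a_1+b_1J_1,a_2+b_2J_2)=F_0+J_1F_1+J_2F_2+J_1J_2F_{12}\quad\text{at }(a_1+ib_1,a_2+ib_2),$$ where $F=F_0+e_1F_1+e_2F_2+e_1e_2F_{12}:D\to\mathbb H\otimes\mathbb R_2$ is $C^1$ ($\mathbb R_2$ being the Clifford algebra with $e_1^2=e_2^2=-1$, $e_1e_2=-e_2e_1$), $F_0,F_1,F_2,F_{12}$ are respectively even-even, odd-even, even-odd, odd-odd in $(b_1,b_2)$, and $\partial F/\partial a_1+e_1\,\partial F/\partial b_1=0$, $\partial F/\partial a_2+(\partial F/\partial b_2)\,e_2=0$. A map from an open subset of $\mathbb H^2$ to $\mathbb H^2$ is slice regular if near every point its two components are restrictions of slice regular functions on circular open sets containing that point. A slice-quaternionic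 atlas on a Hausdorff second countable space consists of charts onto circular open subsets of $\mathbb H^2$, covering the space, with smooth and slice regular changes of charts; maps are slice-quaternionic if they are slice regular in the charts. An affine atlas is one whose changes of charts are locally of the form $x\mapsto xA+b$ with $A\in GL(2,\mathbb H)$, $b\in\mathbb H^2$ (row vectors). A slice-quaternionic Hopf surface is a space with a slice-quaternionic atlas whose universal covering is $\mathbb H^2\setminus\{(0,0)\}$, by a slice-quaternionic covering map, and whose fundamental group is $\mathbb Z$. Theorem. Let $p\ge1$ be an integer and let $\alpha,\beta,\lambda\in\mathbb H$ satisfy $0<|\alpha|\le|\beta|<1$ and $(\alpha-\beta^p)\lambda=0$. Put $f(z,w)=(z\alpha+w^p\lambda,\;w\beta)$, a bijection of $\mathbb H^2\setminus\{(0,0)\}$, and $\Gamma=\{f^{\circ k}:k\in\mathbb Z\}$. Assume that one of the following holds. - Case A: (A.1) $\lambda=0$ and $\alpha=\beta$; or (A.2) $\lambda=0$ and $\alpha\ne\beta$; or (A.3) $\lambda\ne0$, $p=1$ and $\alpha=\beta$. - Case B: $\lambda\neq0$, $p>1$, $\beta\in\mathbb R$ and $\alpha=\beta^p$. Then every element of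 $\Gamma$ is a slice regular automorphism of $\mathbb H^2\setminus\{(0,0)\}$, and $X=(\mathbb H^2\setminus\{(0,0)\})/\Gamma$, with the atlas $\mathcal A$ of all local inverses, defined on images of circular open sets, of the projection $\pi:\mathbb H^2\setminus\{(0,0)\}\to X$, is a slice-quaternionic Hopf surface with universal covering $\pi$. The slice-quaternionic structure of $X$ admits an affine structure, i.e. there is an affine atlas $\mathcal B$ on $X$ such that $\mathcal A\cup\mathcal B$ is a slice-quaternionic atlas, if and only if case A holds. The same equivalence holds if one only asks that $X$ have an affine atlas whose coordinate maps are slice regular in the charts of $\mathcal A$. -/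

import Mathlib

open scoped Quaternion ContDiff Topology

noncomputable section

/-- The quaternionic plane `ℍ²`. -/
abbrev H2 : Type := ℍ[ℝ] × ℍ[ℝ]

/-! ### Slice regular functions of two quaternionic variables -/

/-- The sphere of imaginary units `{J : J² = -1}` of `ℍ`. -/
def imagUnits : Set ℍ[ℝ] := {J | J * J = -1}

/-- The point `a + b J` of `ℍ` attached to `a + i b ∈ ℂ` and `J`. -/
def sliceEmb (J : ℍ[ℝ]) (z : ℂ) : ℍ[ℝ] := (z.re : ℍ[ℝ]) + z.im • J

/-- Invariance under complex conjugation in each of the two variables. -/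
def ConjInvariant (D : Set (ℂ × ℂ)) : Prop :=
  ∀ z ∈ D, (star z.1, z.2) ∈ D ∧ (z.1, star z.2) ∈ D

/-- The circular subset `Ω_D` of `ℍ²` associated with `D ⊆ ℂ²`. -/
def circularization (D : Set (ℂ × ℂ)) : Set H2 :=
  {x | ∃ z ∈ D, ∃ J₁ ∈ imagUnits, ∃ J₂ ∈ imagUnits, x = (sliceEmb J₁ z.1, sliceEmb J₂ z.2)}

/-- Circular subsets of `ℍ²`. -/
def IsCircular (Ω : Set H2) : Prop :=
  ∃ D : Set (ℂ × ℂ), ConjInvariant D ∧ Ω = circularization D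

/-- The real vector space `ℍ ⊗ ℝ₂`, where `ℝ₂` is the Clifford algebra with `e₁² = e₂² = -1`,
`e₁ e₂ = - e₂ e₁`; the quadruple `(a, b, c, d)` stands for `a + e₁ b + e₂ c + e₁ e₂ d`. -/
abbrev StemSpace : Type := ℍ[ℝ] × ℍ[ℝ] × ℍ[ℝ] × ℍ[ℝ]

/-- Multiplication by `e₁` on the left:
`e₁ (a + e₁ b + e₂ c + e₁₂ d) = -b + e₁ a - e₂ d + e₁₂ c`. -/
def e1Left (v : StemSpace) : StemSpace := (-v.2.1, v.1, -v.2.2.2, v.2.2.1)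

/-- Multiplication by `e₂` on the right:
`(a + e₁ b + e₂ c + e₁₂ d) e₂ = -c - e₁ d + e₂ a + e₁₂ b`. -/
def e2Right (v : StemSpace) : StemSpace := (-v.2.2.1, -v.2.2.2, v.1, v.2.1)

/-- Stem functions of class `C¹` on the open conjugation invariant set `D` that are
holomorphic, i.e. `∂F/∂α₁ + e₁ ∂F/∂β₁ = 0` and `∂F/∂α₂ + (∂F/∂β₂) e₂ = 0`, where
`z_h = α_h + i β_h`. The conditions `parity₁`, `parity₂` say that `F₀, F₁, F₂, F₁₂` are
even-even, odd-even, even-odd, odd-odd in `(β₁, β₂)`. -/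
structure IsHolomorphicStem (D : Set (ℂ × ℂ)) (F : ℂ × ℂ → StemSpace) : Prop where
  isOpen : IsOpen D
  conjInvariant : ConjInvariant D
  parity₁ : ∀ z ∈ D, F (star z.1, z.2) =
    ((F z).1, -(F z).2.1, (F z).2.2.1, -(F z).2.2.2)
  parity₂ : ∀ z ∈ D, F (z.1, star z.2) =
    ((F z).1, (F z).2.1, -(F z).2.2.1, -(F z).2.2.2)
  contDiffOn : ContDiffOn ℝ 1 F D
  dbar₁ : ∀ z ∈ D, fderiv ℝ F z (1, 0) + e1Left (fderiv ℝ F z (Complex.I, 0)) = 0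
  dbar₂ : ∀ z ∈ D, fderiv ℝ F z (0, 1) + e2Right (fderiv ℝ F z (0, Complex.I)) = 0

/-- `g` is (left) slice regular on the circular open set `Ω`: it is there the slice function
`F₀ + J₁ F₁ + J₂ F₂ + J₁ J₂ F₁₂` induced by a holomorphic stem function. -/
def SliceRegularOnCircular (g : H2 → ℍ[ℝ]) (Ω : Set H2) : Prop :=
  ∃ (D : Set (ℂ × ℂ)) (F : ℂ × ℂ → StemSpace), IsHolomorphicStem D F ∧ Ω = circularization D ∧
    ∀ z ∈ D, ∀ J₁ ∈ imagUnits, ∀ J₂ ∈ imagUnits,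
      g (sliceEmb J₁ z.1, sliceEmb J₂ z.2) =
        (F z).1 + J₁ * (F z).2.1 + J₂ * (F z).2.2.1 + J₁ * J₂ * (F z).2.2.2

/-- A map `g` between open parts of `ℍ²` is slice regular at `x` if near `x` each of its two
components is the restriction of a slice regular function defined on a circular open set
containing `x`. -/
def SliceRegularAt (g : H2 → H2) (x : H2) : Prop :=
  ∃ (Ω : Set H2) (G : H2 → H2), x ∈ Ω ∧
    SliceRegularOnCircular (fun y => (G y).1) Ω ∧ SliceRegularOnCircular (fun y => (G y).2) Ω ∧
    g =ᶠ[𝓝 x] G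

/-- Slice regular maps on an open, not necessarily circular, subset of `ℍ²`. -/
def SliceRegularMapOn (g : H2 → H2) (V : Set H2) : Prop := ∀ x ∈ V, SliceRegularAt g x

/-! ### Slice-quaternionic and affine structures on surfaces -/

section Structures

variable {X : Type*} [TopologicalSpace X]

/-- A slice-quaternionic atlas: charts onto circular open subsets of `ℍ²`, covering `X`, with
smooth and slice regular changes of charts. -/
structure IsSliceQuaternionicAtlas (𝒜 : Set (OpenPartialHomeomorph X H2)) : Prop where
  covers : ∀ x : X, ∃ e ∈ 𝒜, x ∈ e.source
  circular : ∀ e ∈ 𝒜, IsCircular e.target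
  smooth : ∀ e ∈ 𝒜, ∀ e' ∈ 𝒜, ContDiffOn ℝ ∞ (e.symm.trans e') (e.symm.trans e').source
  sliceRegular : ∀ e ∈ 𝒜, ∀ e' ∈ 𝒜, SliceRegularMapOn (e.symm.trans e') (e.symm.trans e').source

/-- The map `x ↦ x A + b` of `ℍ²` (row vectors, coefficients on the right). -/
def affineH2 (A : Matrix (Fin 2) (Fin 2) ℍ[ℝ]) (b : H2) (x : H2) : H2 :=
  (x.1 * A 0 0 + x.2 * A 1 0 + b.1, x.1 * A 0 1 + x.2 * A 1 1 + b.2)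

/-- A (quaternionic) affine atlas: charts with values in `ℍ²`, covering `X`, whose changes of
charts are locally of the form `x ↦ x A + b` with `A ∈ GL(2, ℍ)`, `b ∈ ℍ²`. -/
structure IsAffineAtlas (𝒜 : Set (OpenPartialHomeomorph X H2)) : Prop where
  covers : ∀ x : X, ∃ e ∈ 𝒜, x ∈ e.source
  affine : ∀ e ∈ 𝒜, ∀ e' ∈ 𝒜, ∀ y ∈ (e.symm.trans e').source,
    ∃ (A : (Matrix (Fin 2) (Fin 2) ℍ[ℝ])ˣ) (b : H2), ⇑(e.symm.trans e') =ᶠ[𝓝 y] affineH2 A b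

/-- The slice-quaternionic structure given by the atlas `𝒜` admits an affine structure: some
affine atlas forms, together with `𝒜`, a slice-quaternionic atlas. -/
def AdmitsAffineStructure (𝒜 : Set (OpenPartialHomeomorph X H2)) : Prop :=
  ∃ ℬ : Set (OpenPartialHomeomorph X H2), IsAffineAtlas ℬ ∧ IsSliceQuaternionicAtlas (𝒜 ∪ ℬ)

/-- A weaker property: there is an affine atlas whose coordinate maps, read in the charts of
`𝒜`, are slice regular. -/
def AdmitsSliceRegularAffineCharts (𝒜 : Set (OpenPartialHomeomorph X H2)) : Prop :=
  ∃ ℬ : Set (OpenPartialHomeomorph X H2), IsAffineAtlas ℬ ∧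
    ∀ e ∈ 𝒜, ∀ e' ∈ ℬ, SliceRegularMapOn (e.symm.trans e') (e.symm.trans e').source

end Structures

/-! ### The punctured plane and the quotients -/

/-- `ℍ² ∖ {(0,0)}`. -/
abbrev PuncturedH2 : Type := {x : H2 // x ≠ 0}

/-- Slice regularity of a map defined on an open subset `U` of `ℍ² ∖ {(0,0)}`. -/
def SliceRegularOnPunctured (g : PuncturedH2 → H2) (U : Set PuncturedH2) : Prop :=
  ∃ G : H2 → H2, ∀ y ∈ U, G y = g y ∧ SliceRegularAt G y

/-- `X` with the atlas `𝒜` is a slice-quaternionic (primary) Hopf surface with universal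
covering `q : ℍ² ∖ {(0,0)} → X`: it is a (Hausdorff, second countable) slice-quaternionic
manifold, `q` is a covering map and a slice-quaternionic map, its total space is simply
connected, and the fundamental group of `X` is infinite cyclic. -/
structure IsHopfSurface {X : Type*} [TopologicalSpace X]
    (𝒜 : Set (OpenPartialHomeomorph X H2)) (q : PuncturedH2 → X) : Prop where
  t2 : T2Space X
  secondCountable : SecondCountableTopology X
  atlas : IsSliceQuaternionicAtlas 𝒜
  covering : IsCoveringMap q
  surjective : Function.Surjective q
  simplyConnected : SimplyConnectedSpace PuncturedH2
  sliceQuaternionic : ∀ e ∈ 𝒜, SliceRegularOnPunctured (fun y => e (q y)) (q ⁻¹' e.source)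
  fundamentalGroup : ∀ x : X, Nonempty (FundamentalGroup X x ≃* Multiplicative ℤ)

/-- `f(z,w) = (z α + w^p λ, w β)`. -/
def hopfMap (p : ℕ) (α β l : ℍ[ℝ]) (x : H2) : H2 := (x.1 * α + x.2 ^ p * l, x.2 * β)

/-- `f` as a bijection of `ℍ² ∖ {(0,0)}` onto itself. -/
def hopfPerm (p : ℕ) (α β l : ℍ[ℝ]) (hp : p ≠ 0) (hα : 0 < ‖α‖) (hβ : 0 < ‖β‖) :
    Equiv.Perm PuncturedH2 where
  toFun x := ⟨hopfMap p α β l x.1, by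
    have hα' : α ≠ 0 := norm_pos_iff.mp hα
    have hβ' : β ≠ 0 := norm_pos_iff.mp hβ
    obtain ⟨⟨z, w⟩, hx⟩ := x
    intro h
    simp only [hopfMap, Prod.mk_eq_zero, mul_eq_zero, hβ', or_false] at h
    obtain ⟨h1, rfl⟩ := h
    simp only [ne_eq, hp, not_false_eq_true, zero_pow, zero_mul, add_zero, mul_eq_zero, hα',
      or_false] at h1
    exact hx (by simp [h1])⟩
  invFun x := ⟨((x.1.1 - (x.1.2 * β⁻¹) ^ p * l) * α⁻¹, x.1.2 * β⁻¹), by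
    have hα' : α ≠ 0 := norm_pos_iff.mp hα
    have hβ' : β ≠ 0 := norm_pos_iff.mp hβ
    obtain ⟨⟨z, w⟩, hx⟩ := x
    intro h
    simp only [Prod.mk_eq_zero, mul_eq_zero, inv_eq_zero, hα', hβ', or_false] at h
    obtain ⟨h1, rfl⟩ := h
    simp only [zero_mul, ne_eq, hp, not_false_eq_true, zero_pow, sub_zero] at h1
    exact hx (by simp [h1])⟩
  left_inv x := by
    have hα' : α ≠ 0 := norm_pos_iff.mp hα
    have hβ' : β ≠ 0 := norm_pos_iff.mp hβ
    ext1
    simp [hopfMap, hα', hβ']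
  right_inv x := by
    have hα' : α ≠ 0 := norm_pos_iff.mp hα
    have hβ' : β ≠ 0 := norm_pos_iff.mp hβ
    ext1
    simp [hopfMap, hα', hβ']

/-- The group `Γ = {f^k : k ∈ ℤ}` of bijections of `ℍ² ∖ {(0,0)}`. -/
abbrev hopfGroup (p : ℕ) (α β l : ℍ[ℝ]) (hp : p ≠ 0) (hα : 0 < ‖α‖) (hβ : 0 < ‖β‖) :
    Subgroup (Equiv.Perm PuncturedH2) :=
  Subgroup.zpowers (hopfPerm p α β l hp hα hβ)

/-- The quotient space `(ℍ² ∖ {(0,0)}) / Γ`. -/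
abbrev HopfQuotient (p : ℕ) (α β l : ℍ[ℝ]) (hp : p ≠ 0) (hα : 0 < ‖α‖) (hβ : 0 < ‖β‖) : Type :=
  Quotient (MulAction.orbitRel (hopfGroup p α β l hp hα hβ) PuncturedH2)

/-- The projection `ℍ² ∖ {(0,0)} → (ℍ² ∖ {(0,0)}) / Γ`. -/
def hopfProj (p : ℕ) (α β l : ℍ[ℝ]) (hp : p ≠ 0) (hα : 0 < ‖α‖) (hβ : 0 < ‖β‖)
    (x : PuncturedH2) : HopfQuotient p α β l hp hα hβ :=
  Quotient.mk (MulAction.orbitRel (hopfGroup p α β l hp hα hβ) PuncturedH2) x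

/-- The atlas of the quotient structure: its charts are the local inverses of the projection,
defined on the images of circular open subsets of `ℍ² ∖ {(0,0)}`. -/
def hopfAtlas (p : ℕ) (α β l : ℍ[ℝ]) (hp : p ≠ 0) (hα : 0 < ‖α‖) (hβ : 0 < ‖β‖) :
    Set (OpenPartialHomeomorph (HopfQuotient p α β l hp hα hβ) H2) :=
  {e | IsCircular e.target ∧
    ∀ y ∈ e.target, ∃ hy : y ≠ 0, e.symm y = hopfProj p α β l hp hα hβ ⟨y, hy⟩}

/-! ### The cases -/

/-- Case A: (A.1) `λ = 0`, `α = β`; (A.2) `λ = 0`, `α ≠ β`; (A.3) `λ ≠ 0`, `p = 1`, `α = β`. -/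
def HopfCaseA (p : ℕ) (α β l : ℍ[ℝ]) : Prop :=
  (l = 0 ∧ α = β) ∨ (l = 0 ∧ α ≠ β) ∨ (l ≠ 0 ∧ p = 1 ∧ α = β)

/-- Case B: `λ ≠ 0`, `p > 1`, `β` real, `α = β^p`. -/
def HopfCaseB (p : ℕ) (α β l : ℍ[ℝ]) : Prop :=
  l ≠ 0 ∧ 1 < p ∧ (∃ r : ℝ, β = (r : ℍ[ℝ])) ∧ α = β ^ p

end

open scoped Quaternion ContDiff Topology

noncomputable section

/-! ### Slices and circular sets -/

/-! The iterates of `f` keep the triangular shape `(z α^k + w^p c, w β^k)`: in case A because `λ =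
0` or `p = 1`, in case B because `β` is real. So they are slice regular, and `‖α‖ ≤ ‖β‖ < 1` makes
the positive iterates shrink bounded sets uniformly to the origin. Hence `Γ` acts freely and
properly discontinuously, the projection is a covering, and since `ℍ² ∖ {0}` is simply connected the
fundamental group is `Γ ≅ ℤ`. In case A the iterates are linear and the quotient atlas is already
affine. The real content is that case B excludes even the weaker kind of affine structure.

Suppose one exists in case B, with `β = r`. Its charts glue on the simply connected covering to a
slice regular, locally injective map `dev` with `dev ∘ f = dev · A + b`
(`exists_hopf_developingMap`). Choose `J` with `λ ∈ ℂ_J = ℝ + ℝJ` and restrict to `ℂ_J²`. With the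
same unit in both variables, both Cauchy–Riemann equations express complex linearity for left
multiplication by `J`, which commutes with right multiplication by `A`. So `dev` becomes a
holomorphic map `h : ℂ² ∖ {0} → ℂ⁴` that intertwines `(u, v) ↦ (r^p u + ℓ v^p, r v)` with an affine
map of linear part `L`.

This transformation commutes with the action `t · (u, v) = (t^p u, t v)`, so the components `h_d` of
`h` of weight `d ≠ 0` are equivariant separately. One has `h_d(u, v) = v^d q_d(u / v^p)` for `v ≠
0`, with `q_d` polynomial and `q_d(s + μ) = r^{-d} L q_d(s)`, `μ = ℓ / r^p ≠ 0`. A nonconstant `q_d`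
gives `r^{-d} L` a Jordan block for the eigenvalue `1`. As `L` comes from an `ℍ`-linear endomorphism
of the two-dimensional space `ℍ²`, that block fills everything, so `(r^{-d} L - 1)² = 0`
(`unipotent_of_jordanBlock`) and `q_d` has degree one (`eq_affine_of_equivariant`). Local
injectivity along `v = 0` provides `d ≠ 0` with `h_d(1, 0) ≠ 0`; continuity at `v = 0` then forces
`d = p` and degree one, and no eigenvalue of `L` is left for the other nonzero weights. Therefore `h
= u c + v^p a + c₀` (`eq_affine_pow_of_equivariant`).

The identity theorem for slice regular maps extends `dev = z c + w^p a + c₀` to all of `ℍ² ∖ {0}`.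
Since `p > 1`, the power `w^p` is constant on a whole sphere of `p`-th roots of `-1`, and `dev` is
not locally injective there: a contradiction. -/

theorem imagUnits_re {J : ℍ[ℝ]} (hJ : J ∈ imagUnits) : J.re = 0 := by
  have h : J * J = -1 := hJ
  have h0 := congrArg QuaternionAlgebra.re h
  have h1 := congrArg QuaternionAlgebra.imI h
  have h2 := congrArg QuaternionAlgebra.imJ h
  have h3 := congrArg QuaternionAlgebra.imK h
  simp only [Quaternion.re_mul, Quaternion.imI_mul, Quaternion.imJ_mul, Quaternion.imK_mul,
    Quaternion.re_neg, Quaternion.imI_neg, Quaternion.imJ_neg, Quaternion.imK_neg,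
    Quaternion.re_one, Quaternion.imI_one, Quaternion.imJ_one, Quaternion.imK_one] at h0 h1 h2 h3
  -- The imaginary part of `J²` is twice `re J` times that of `J`; if `re J ≠ 0` then `J` is real,
  -- with a negative square.
  by_contra hne
  have e1 : J.imI = 0 := by
    have : J.re * J.imI = 0 := by linarith
    simpa [hne] using this
  have e2 : J.imJ = 0 := by
    have : J.re * J.imJ = 0 := by linarith
    simpa [hne] using this
  have e3 : J.imK = 0 := by
    have : J.re * J.imK = 0 := by linarith
    simpa [hne] using this
  rw [e1, e2, e3] at h0
  nlinarith [sq_nonneg J.re]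

theorem imagUnits_norm {J : ℍ[ℝ]} (hJ : J ∈ imagUnits) : ‖J‖ = 1 := by
  have h : J * J = -1 := hJ
  have h1 : ‖J‖ * ‖J‖ = 1 := by rw [← norm_mul, h]; simp
  nlinarith [norm_nonneg J]

/-- The imaginary unit `i` of `ℍ`. -/
def unitI : ℍ[ℝ] := ⟨0, 1, 0, 0⟩

/-- The imaginary unit `j` of `ℍ`. -/
def unitJ : ℍ[ℝ] := ⟨0, 0, 1, 0⟩

theorem unitI_mem : unitI ∈ imagUnits := by
  change unitI * unitI = -1
  ext <;>
    simp only [Quaternion.re_mul, Quaternion.imI_mul, Quaternion.imJ_mul, Quaternion.imK_mul] <;>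
    simp [unitI]

/-- `sliceEmb J` as a homomorphism of real algebras. -/
def sliceHom {J : ℍ[ℝ]} (hJ : J ∈ imagUnits) : ℂ →ₐ[ℝ] ℍ[ℝ] := Complex.lift ⟨J, hJ⟩

theorem sliceHom_apply {J : ℍ[ℝ]} (hJ : J ∈ imagUnits) (z : ℂ) : sliceHom hJ z = sliceEmb J z := by
  simp [sliceHom, sliceEmb, Complex.lift, Complex.liftAux_apply]

theorem sliceEmb_mul {J : ℍ[ℝ]} (hJ : J ∈ imagUnits) (z w : ℂ) :
    sliceEmb J (z * w) = sliceEmb J z * sliceEmb J w := by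
  simp only [← sliceHom_apply hJ, map_mul]

theorem sliceEmb_pow {J : ℍ[ℝ]} (hJ : J ∈ imagUnits) (z : ℂ) (n : ℕ) :
    sliceEmb J (z ^ n) = sliceEmb J z ^ n := by
  simp only [← sliceHom_apply hJ, map_pow]

theorem sliceEmb_add (J : ℍ[ℝ]) (z w : ℂ) :
    sliceEmb J (z + w) = sliceEmb J z + sliceEmb J w := by
  simp only [sliceEmb, Complex.add_re, Complex.add_im, Quaternion.coe_add, add_smul]
  abel

@[simp] theorem sliceEmb_ofReal (J : ℍ[ℝ]) (x : ℝ) : sliceEmb J (x : ℂ) = (x : ℍ[ℝ]) := by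
  simp [sliceEmb]

@[simp] theorem sliceEmb_zero (J : ℍ[ℝ]) : sliceEmb J 0 = 0 := by
  simp [sliceEmb]

theorem sliceEmb_re {J : ℍ[ℝ]} (hJ : J ∈ imagUnits) (z : ℂ) : (sliceEmb J z).re = z.re := by
  simp [sliceEmb, imagUnits_re hJ]

theorem sliceEmb_im {J : ℍ[ℝ]} (hJ : J ∈ imagUnits) (z : ℂ) : (sliceEmb J z).im = z.im • J := by
  ext <;> simp [sliceEmb, imagUnits_re hJ]

theorem norm_sliceEmb {J : ℍ[ℝ]} (hJ : J ∈ imagUnits) (z : ℂ) : ‖sliceEmb J z‖ = ‖z‖ := by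
  have h1 : J * J = -1 := hJ
  have h2 := imagUnits_re hJ
  have h3 := congrArg QuaternionAlgebra.re h1
  simp only [Quaternion.re_mul, Quaternion.re_neg, Quaternion.re_one, h2] at h3
  rw [← sq_eq_sq₀ (norm_nonneg _) (norm_nonneg _), ← Complex.normSq_eq_norm_sq, pow_two,
    ← Quaternion.normSq_eq_norm_mul_self, Quaternion.normSq_def', Complex.normSq_apply]
  simp only [sliceEmb, Quaternion.re_add, Quaternion.imI_add, Quaternion.imJ_add,
    Quaternion.imK_add, Quaternion.re_coe, Quaternion.imI_coe, Quaternion.imJ_coe,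
    Quaternion.imK_coe, Quaternion.re_smul, Quaternion.imI_smul, Quaternion.imJ_smul,
    Quaternion.imK_smul, h2, smul_eq_mul]
  linear_combination (-z.im ^ 2) * h3

theorem sliceEmb_injective {J : ℍ[ℝ]} (hJ : J ∈ imagUnits) : Function.Injective (sliceEmb J) := by
  intro z w h
  rw [← sub_eq_zero, ← norm_eq_zero, ← norm_sliceEmb hJ]
  simp only [← sliceHom_apply hJ] at h ⊢
  rw [map_sub, h, sub_self, norm_zero]

theorem continuous_sliceEmb : Continuous fun x : ℍ[ℝ] × ℂ => sliceEmb x.1 x.2 := by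
  unfold sliceEmb
  exact (Quaternion.continuous_coe.comp (Complex.continuous_re.comp continuous_snd)).add
    ((Complex.continuous_im.comp continuous_snd).smul continuous_fst)

/-- The representative in the closed upper half plane of the sphere through `q`. -/
def sliceCoord (q : ℍ[ℝ]) : ℂ := ⟨q.re, ‖q.im‖⟩

theorem continuous_sliceCoord : Continuous sliceCoord := by
  have : sliceCoord = fun q : ℍ[ℝ] => (q.re : ℂ) + (‖q.im‖ : ℂ) * Complex.I := by
    funext q; apply Complex.ext <;> simp [sliceCoord]
  rw [this]
  have h1 := Quaternion.continuous_re
  have h2 := Quaternion.continuous_im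
  fun_prop

theorem exists_sliceEmb_sliceCoord (q : ℍ[ℝ]) :
    ∃ J ∈ imagUnits, q = sliceEmb J (sliceCoord q) := by
  by_cases h : q.im = 0
  · refine ⟨unitI, unitI_mem, ?_⟩
    have := Quaternion.re_add_im q
    rw [h] at this
    simp [sliceEmb, sliceCoord, h]
    simpa using this.symm
  · have hn : ‖q.im‖ ≠ 0 := norm_ne_zero_iff.mpr h
    refine ⟨‖q.im‖⁻¹ • q.im, ?_, ?_⟩
    · have h1 : q.im * q.im = -((‖q.im‖ ^ 2 : ℝ) : ℍ[ℝ]) := by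
        rw [← pow_two, Quaternion.sq_eq_neg_normSq.mpr (by simp), Quaternion.normSq_eq_norm_mul_self,
          pow_two]
      change _ * _ = _
      rw [smul_mul_smul_comm, h1, smul_neg, ← Quaternion.coe_mul_eq_smul, ← Quaternion.coe_mul]
      congr 1
      norm_cast
      field_simp
      norm_cast
    · simp [sliceEmb, sliceCoord, smul_smul, hn]

theorem exists_sliceEmb (q : ℍ[ℝ]) : ∃ J ∈ imagUnits, ∃ z : ℂ, q = sliceEmb J z := by
  obtain ⟨J, hJ, h⟩ := exists_sliceEmb_sliceCoord q
  exact ⟨J, hJ, _, h⟩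

theorem sliceCoord_sliceEmb {J : ℍ[ℝ]} (hJ : J ∈ imagUnits) (z : ℂ) :
    sliceCoord (sliceEmb J z) = ⟨z.re, |z.im|⟩ := by
  rw [sliceCoord, sliceEmb_re hJ, sliceEmb_im hJ, norm_smul, imagUnits_norm hJ]
  simp

theorem abs_im_eq (z : ℂ) : (⟨z.re, |z.im|⟩ : ℂ) = z ∨ (⟨z.re, |z.im|⟩ : ℂ) = star z := by
  rcases abs_choice z.im with h | h
  · left; rw [h]
  · right; rw [h]; rfl

theorem ConjInvariant.abs_mem_iff {D : Set (ℂ × ℂ)} (hD : ConjInvariant D) (z : ℂ × ℂ) :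
    ((⟨z.1.re, |z.1.im|⟩, ⟨z.2.re, |z.2.im|⟩) : ℂ × ℂ) ∈ D ↔ z ∈ D := by
  have c1 : ∀ z : ℂ × ℂ, (star z.1, z.2) ∈ D ↔ z ∈ D := fun z =>
    ⟨fun h => by simpa using (hD _ h).1, fun h => (hD _ h).1⟩
  have c2 : ∀ z : ℂ × ℂ, (z.1, star z.2) ∈ D ↔ z ∈ D := fun z =>
    ⟨fun h => by simpa using (hD _ h).2, fun h => (hD _ h).2⟩
  rcases abs_im_eq z.1 with h1 | h1 <;> rcases abs_im_eq z.2 with h2 | h2 <;> rw [h1, h2]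
  · exact c2 z
  · exact c1 z
  · exact (c2 (star z.1, z.2)).trans (c1 z)

/-- Two representations of one quaternion as `a + bJ` differ, as far as `a + ib` is concerned, by at
most a conjugation, and `D` does not see conjugations. -/
theorem sliceEmb_mem_circularization {D : Set (ℂ × ℂ)} (hD : ConjInvariant D) {J₁ J₂ : ℍ[ℝ]}
    (h₁ : J₁ ∈ imagUnits) (h₂ : J₂ ∈ imagUnits) (z : ℂ × ℂ) :
    (sliceEmb J₁ z.1, sliceEmb J₂ z.2) ∈ circularization D ↔ z ∈ D := by
  constructor
  · rintro ⟨u, hu, K₁, k₁, K₂, k₂, h⟩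
    have e1 := congrArg (fun x => sliceCoord x.1) h
    have e2 := congrArg (fun x => sliceCoord x.2) h
    simp only [sliceCoord_sliceEmb h₁, sliceCoord_sliceEmb h₂, sliceCoord_sliceEmb k₁,
      sliceCoord_sliceEmb k₂] at e1 e2
    rw [← hD.abs_mem_iff, e1, e2, hD.abs_mem_iff]
    exact hu
  · intro h
    exact ⟨z, h, J₁, h₁, J₂, h₂, rfl⟩

theorem mem_circularization_iff {D : Set (ℂ × ℂ)} (hD : ConjInvariant D) (x : H2) :
    x ∈ circularization D ↔ (sliceCoord x.1, sliceCoord x.2) ∈ D := by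
  obtain ⟨J₁, h₁, e₁⟩ := exists_sliceEmb_sliceCoord x.1
  obtain ⟨J₂, h₂, e₂⟩ := exists_sliceEmb_sliceCoord x.2
  rw [← sliceEmb_mem_circularization hD h₁ h₂]
  dsimp only
  rw [← e₁, ← e₂]

/-- Two stems inducing functions on the same circular set thus share their domain, which is what
lets them be added. -/
theorem circularization_injective {D D' : Set (ℂ × ℂ)} (hD : ConjInvariant D)
    (hD' : ConjInvariant D') (h : circularization D = circularization D') : D = D' := by
  ext z
  rw [← sliceEmb_mem_circularization hD unitI_mem unitI_mem, h,
    sliceEmb_mem_circularization hD' unitI_mem unitI_mem]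

theorem norm_sliceCoord (q : ℍ[ℝ]) : ‖sliceCoord q‖ = ‖q‖ := by
  obtain ⟨J, h, e⟩ := exists_sliceEmb_sliceCoord q
  rw [← norm_sliceEmb h, ← e]

/-- The norm of `a + bJ` is `|a + ib|` whatever `J` is. This supplies the annuli used as chart
domains. -/
theorem isCircular_of_norm (P : ℝ → ℝ → Prop) : IsCircular {x : H2 | P ‖x.1‖ ‖x.2‖} := by
  have hD : ConjInvariant {z : ℂ × ℂ | P ‖z.1‖ ‖z.2‖} := fun z hz => by
    constructor <;> simpa using hz
  refine ⟨_, hD, ?_⟩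
  ext x
  rw [mem_circularization_iff hD]
  simp [norm_sliceCoord]

theorem conjInvariant_univ : ConjInvariant Set.univ := fun _ _ => ⟨trivial, trivial⟩

theorem circularization_univ : circularization Set.univ = Set.univ := by
  ext x; simp [mem_circularization_iff conjInvariant_univ]

/-! ### Algebra of holomorphic stem functions -/

theorem IsHolomorphicStem.differentiableAt {D : Set (ℂ × ℂ)} {F : ℂ × ℂ → StemSpace}
    (h : IsHolomorphicStem D F) {z : ℂ × ℂ} (hz : z ∈ D) : DifferentiableAt ℝ F z :=
  (h.contDiffOn.differentiableOn one_ne_zero).differentiableAt (h.isOpen.mem_nhds hz)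

theorem e1Left_add (v w : StemSpace) : e1Left (v + w) = e1Left v + e1Left w := by
  simp [e1Left, add_comm]

theorem e2Right_add (v w : StemSpace) : e2Right (v + w) = e2Right v + e2Right w := by
  simp [e2Right, add_comm]

theorem IsHolomorphicStem.add {D : Set (ℂ × ℂ)} {F G : ℂ × ℂ → StemSpace}
    (hF : IsHolomorphicStem D F) (hG : IsHolomorphicStem D G) :
    IsHolomorphicStem D (fun z => F z + G z) where
  isOpen := hF.isOpen
  conjInvariant := hF.conjInvariant
  parity₁ z hz := by
    rw [hF.parity₁ z hz, hG.parity₁ z hz]; simp [add_comm]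
  parity₂ z hz := by
    rw [hF.parity₂ z hz, hG.parity₂ z hz]; simp [add_comm]
  contDiffOn := hF.contDiffOn.add hG.contDiffOn
  dbar₁ z hz := by
    rw [fderiv_fun_add (hF.differentiableAt hz) (hG.differentiableAt hz)]
    simp only [add_apply, e1Left_add]
    rw [add_add_add_comm, hF.dbar₁ z hz, hG.dbar₁ z hz, add_zero]
  dbar₂ z hz := by
    rw [fderiv_fun_add (hF.differentiableAt hz) (hG.differentiableAt hz)]
    simp only [add_apply, e2Right_add]
    rw [add_add_add_comm, hF.dbar₂ z hz, hG.dbar₂ z hz, add_zero]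

/-- Multiplication of the four components of a stem by a quaternion on the right. -/
def stemMulRight (c : ℍ[ℝ]) : StemSpace →L[ℝ] StemSpace :=
  let m := (ContinuousLinearMap.mul ℝ ℍ[ℝ]).flip c
  m.prodMap (m.prodMap (m.prodMap m))

theorem stemMulRight_apply (c : ℍ[ℝ]) (v : StemSpace) :
    stemMulRight c v = (v.1 * c, v.2.1 * c, v.2.2.1 * c, v.2.2.2 * c) := rfl

theorem IsHolomorphicStem.mulRight {D : Set (ℂ × ℂ)} {F : ℂ × ℂ → StemSpace}
    (hF : IsHolomorphicStem D F) (c : ℍ[ℝ]) :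
    IsHolomorphicStem D (fun z => stemMulRight c (F z)) where
  isOpen := hF.isOpen
  conjInvariant := hF.conjInvariant
  parity₁ z hz := by
    rw [hF.parity₁ z hz]; simp [stemMulRight_apply]
  parity₂ z hz := by
    rw [hF.parity₂ z hz]; simp [stemMulRight_apply]
  contDiffOn := (stemMulRight c).contDiff.comp_contDiffOn hF.contDiffOn
  dbar₁ z hz := by
    have h := ((stemMulRight c).hasFDerivAt.comp z (hF.differentiableAt hz).hasFDerivAt).fderiv
    rw [Function.comp_def] at h
    rw [h]
    have := congrArg (stemMulRight c) (hF.dbar₁ z hz)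
    rw [map_add, map_zero] at this
    rw [← this]
    simp [stemMulRight_apply, e1Left]
  dbar₂ z hz := by
    have h := ((stemMulRight c).hasFDerivAt.comp z (hF.differentiableAt hz).hasFDerivAt).fderiv
    rw [Function.comp_def] at h
    rw [h]
    have := congrArg (stemMulRight c) (hF.dbar₂ z hz)
    rw [map_add, map_zero] at this
    rw [← this]
    simp [stemMulRight_apply, e2Right]

theorem isHolomorphicStem_const {D : Set (ℂ × ℂ)} (ho : IsOpen D) (hD : ConjInvariant D)
    (c : ℍ[ℝ]) : IsHolomorphicStem D (fun _ => (c, 0, 0, 0)) where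
  isOpen := ho
  conjInvariant := hD
  parity₁ z hz := by simp
  parity₂ z hz := by simp
  contDiffOn := contDiffOn_const
  dbar₁ z hz := by simp [e1Left]
  dbar₂ z hz := by simp [e2Right]

/-- The real linear map `z ↦ (re z, im z, 0, 0)`. -/
def stemIncl₁ : ℂ →L[ℝ] StemSpace :=
  ((algebraMapCLM ℝ ℍ[ℝ]).comp Complex.reCLM).prod (((algebraMapCLM ℝ ℍ[ℝ]).comp Complex.imCLM).prod 0)

/-- The real linear map `z ↦ (re z, 0, im z, 0)`. -/
def stemIncl₂ : ℂ →L[ℝ] StemSpace :=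
  ((algebraMapCLM ℝ ℍ[ℝ]).comp Complex.reCLM).prod
    ((0 : ℂ →L[ℝ] ℍ[ℝ]).prod (((algebraMapCLM ℝ ℍ[ℝ]).comp Complex.imCLM).prod 0))

theorem stemIncl₁_apply (z : ℂ) : stemIncl₁ z = ((z.re : ℍ[ℝ]), (z.im : ℍ[ℝ]), 0, 0) := rfl

theorem stemIncl₂_apply (z : ℂ) : stemIncl₂ z = ((z.re : ℍ[ℝ]), 0, (z.im : ℍ[ℝ]), 0) := rfl

theorem isHolomorphicStem_fst : IsHolomorphicStem Set.univ (fun z => stemIncl₁ z.1) where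
  isOpen := isOpen_univ
  conjInvariant := conjInvariant_univ
  parity₁ z hz := by simp [stemIncl₁_apply]
  parity₂ z hz := by simp [stemIncl₁_apply]
  contDiffOn := (stemIncl₁.contDiff.comp contDiff_fst).contDiffOn
  dbar₁ z hz := by
    have h : HasFDerivAt (fun z : ℂ × ℂ => stemIncl₁ z.1)
      (stemIncl₁.comp (ContinuousLinearMap.fst ℝ ℂ ℂ)) z :=
      (stemIncl₁.comp (ContinuousLinearMap.fst ℝ ℂ ℂ)).hasFDerivAt
    rw [h.fderiv]
    simp [e1Left, stemIncl₁_apply]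
  dbar₂ z hz := by
    have h : HasFDerivAt (fun z : ℂ × ℂ => stemIncl₁ z.1)
      (stemIncl₁.comp (ContinuousLinearMap.fst ℝ ℂ ℂ)) z :=
      (stemIncl₁.comp (ContinuousLinearMap.fst ℝ ℂ ℂ)).hasFDerivAt
    rw [h.fderiv]
    simp [e2Right]

theorem hasFDerivAt_stemIncl₂_pow (p : ℕ) (z : ℂ × ℂ) :
    HasFDerivAt (fun z : ℂ × ℂ => stemIncl₂ (z.2 ^ p))
      (stemIncl₂.comp (((ContinuousLinearMap.mul ℝ ℂ) (p * z.2 ^ (p - 1))).comp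
        (ContinuousLinearMap.snd ℝ ℂ ℂ))) z := by
  refine stemIncl₂.hasFDerivAt.comp z ?_
  have h1 : HasFDerivAt (fun w : ℂ => w ^ p)
      ((ContinuousLinearMap.mul ℝ ℂ) (p * z.2 ^ (p - 1))) z.2 := by
    have := (hasDerivAt_pow p z.2).hasFDerivAt.restrictScalars ℝ
    exact this.congr_fderiv (by ext; simp [mul_comm])
  exact h1.comp z (ContinuousLinearMap.snd ℝ ℂ ℂ).hasFDerivAt

theorem isHolomorphicStem_snd_pow (p : ℕ) :
    IsHolomorphicStem Set.univ (fun z => stemIncl₂ (z.2 ^ p)) where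
  isOpen := isOpen_univ
  conjInvariant := conjInvariant_univ
  parity₁ z hz := by simp [stemIncl₂_apply]
  parity₂ z hz := by
    dsimp only
    rw [← star_pow]
    simp only [stemIncl₂_apply, Complex.star_def, Complex.conj_re, Complex.conj_im,
      Quaternion.coe_neg, neg_zero]
  contDiffOn := (stemIncl₂.contDiff.comp (contDiff_snd.pow p)).contDiffOn
  dbar₁ z hz := by
    rw [(hasFDerivAt_stemIncl₂_pow p z).fderiv]
    simp [e1Left]
  dbar₂ z hz := by
    rw [(hasFDerivAt_stemIncl₂_pow p z).fderiv]
    simp [e2Right, stemIncl₂_apply]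

/-! ### Algebra of slice regular functions -/

theorem SliceRegularOnCircular.add {g h : H2 → ℍ[ℝ]} {Ω : Set H2}
    (hg : SliceRegularOnCircular g Ω) (hh : SliceRegularOnCircular h Ω) :
    SliceRegularOnCircular (fun x => g x + h x) Ω := by
  obtain ⟨D, F, hF, rfl, e⟩ := hg
  obtain ⟨D', F', hF', hD, e'⟩ := hh
  obtain rfl := circularization_injective hF.conjInvariant hF'.conjInvariant hD
  refine ⟨D, _, hF.add hF', rfl, fun z hz J₁ h₁ J₂ h₂ => ?_⟩
  dsimp only
  rw [e z hz J₁ h₁ J₂ h₂, e' z hz J₁ h₁ J₂ h₂]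
  simp only [Prod.fst_add, Prod.snd_add, mul_add]
  abel

theorem SliceRegularOnCircular.mul_right {g : H2 → ℍ[ℝ]} {Ω : Set H2}
    (hg : SliceRegularOnCircular g Ω) (c : ℍ[ℝ]) :
    SliceRegularOnCircular (fun x => g x * c) Ω := by
  obtain ⟨D, F, hF, rfl, e⟩ := hg
  refine ⟨D, _, hF.mulRight c, rfl, fun z hz J₁ h₁ J₂ h₂ => ?_⟩
  dsimp only
  rw [e z hz J₁ h₁ J₂ h₂]
  simp only [stemMulRight_apply, add_mul, mul_assoc]

theorem SliceRegularOnCircular.add_const {g : H2 → ℍ[ℝ]} {Ω : Set H2}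
    (hg : SliceRegularOnCircular g Ω) (c : ℍ[ℝ]) :
    SliceRegularOnCircular (fun x => g x + c) Ω := by
  refine hg.add ?_
  obtain ⟨D, F, hF, rfl, e⟩ := hg
  exact ⟨D, _, isHolomorphicStem_const hF.isOpen hF.conjInvariant c, rfl,
    fun z hz J₁ h₁ J₂ h₂ => by simp⟩

theorem sliceRegularOnCircular_fst : SliceRegularOnCircular (fun x => x.1) Set.univ :=
  ⟨Set.univ, _, isHolomorphicStem_fst, circularization_univ.symm, fun z _ J₁ h₁ J₂ h₂ => by
    simp [stemIncl₁_apply, sliceEmb, Quaternion.mul_coe_eq_smul]⟩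

theorem sliceRegularOnCircular_snd_pow (p : ℕ) :
    SliceRegularOnCircular (fun x => x.2 ^ p) Set.univ :=
  ⟨Set.univ, _, isHolomorphicStem_snd_pow p, circularization_univ.symm, fun z _ J₁ h₁ J₂ h₂ => by
    dsimp only
    rw [← sliceEmb_pow h₂]
    simp [stemIncl₂_apply, sliceEmb, Quaternion.mul_coe_eq_smul]⟩

theorem sliceRegularOnCircular_affine_pow (p : ℕ) (a b c : ℍ[ℝ]) :
    SliceRegularOnCircular (fun x => x.1 * a + x.2 ^ p * b + c) Set.univ :=
  ((sliceRegularOnCircular_fst.mul_right a).add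
    ((sliceRegularOnCircular_snd_pow p).mul_right b)).add_const c

theorem SliceRegularAt.congr {g g' : H2 → H2} {x : H2} (h : SliceRegularAt g x)
    (e : g' =ᶠ[𝓝 x] g) : SliceRegularAt g' x := by
  obtain ⟨Ω, G, hx, h1, h2, h3⟩ := h
  exact ⟨Ω, G, hx, h1, h2, e.trans h3⟩

/-- Slice regular functions form a right `ℍ`-module containing the constants, and affine maps have
their coefficients on the right. -/
theorem SliceRegularAt.affine {g : H2 → H2} {x : H2} (h : SliceRegularAt g x)
    (A : Matrix (Fin 2) (Fin 2) ℍ[ℝ]) (b : H2) :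
    SliceRegularAt (fun y => affineH2 A b (g y)) x := by
  obtain ⟨Ω, G, hx, h1, h2, h3⟩ := h
  refine ⟨Ω, fun y => affineH2 A b (G y), hx, ?_, ?_, h3.mono fun y hy => ?_⟩
  rotate_left 2
  · exact congrArg (affineH2 A b) hy
  · exact ((h1.mul_right (A 0 0)).add (h2.mul_right (A 1 0))).add_const b.1
  · exact ((h1.mul_right (A 0 1)).add (h2.mul_right (A 1 1))).add_const b.2

theorem sliceRegularAt_triangular (p : ℕ) (a b d : ℍ[ℝ]) (x : H2) :
    SliceRegularAt (fun x => (x.1 * a + x.2 ^ p * b, x.2 * d)) x :=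
  ⟨Set.univ, _, Set.mem_univ _,
    (sliceRegularOnCircular_fst.mul_right a).add ((sliceRegularOnCircular_snd_pow p).mul_right b),
    by simpa using (sliceRegularOnCircular_snd_pow 1).mul_right d, Filter.EventuallyEq.rfl⟩

/-! ### Iterates of the Hopf map -/

section Iterates

variable {p : ℕ} {α β l : ℍ[ℝ]} {hp : p ≠ 0} {hα : 0 < ‖α‖} {hβ : 0 < ‖β‖}

/-- The commutation that keeps iterates triangular. Here the case hypothesis enters: `λ = 0`, or `p
= 1` leaves nothing to commute, or `β` is central. -/
theorem mul_pow_mul_of_hopfCase (hcase : HopfCaseA p α β l ∨ HopfCaseB p α β l) (k : ℤ)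
    (w : ℍ[ℝ]) : (w * β ^ k) ^ p * l = w ^ p * ((β ^ k) ^ p * l) := by
  rcases hcase with (⟨rfl, -⟩ | ⟨rfl, -⟩ | ⟨-, rfl, -⟩) | ⟨-, -, ⟨r, rfl⟩, -⟩
  · simp
  · simp
  · simp [mul_assoc]
  · have h : Commute w ((r : ℍ[ℝ]) ^ k) := by
      have : Commute w (r : ℍ[ℝ]) := (Quaternion.coe_commutes r w).symm
      exact this.zpow_right₀ k
    rw [h.mul_pow, mul_assoc]

theorem hopfPerm_zpow_apply (hcase : HopfCaseA p α β l ∨ HopfCaseB p α β l) (k : ℤ) :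
    ∃ c : ℍ[ℝ], (l = 0 → c = 0) ∧ ∀ x : PuncturedH2,
      ((hopfPerm p α β l hp hα hβ ^ k) x : H2) =
        (x.1.1 * α ^ k + x.1.2 ^ p * c, x.1.2 * β ^ k) := by
  have hα' : α ≠ 0 := norm_pos_iff.mp hα
  have hβ' : β ≠ 0 := norm_pos_iff.mp hβ
  induction k using Int.induction_on with
  | zero => exact ⟨0, by simp⟩
  | succ n ih =>
    obtain ⟨c, hc, h⟩ := ih
    refine ⟨c * α + (β ^ (n : ℤ)) ^ p * l, fun hl => by simp [hc hl, hl], fun x => ?_⟩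
    rw [add_comm, zpow_add, zpow_one, Equiv.Perm.mul_apply]
    change hopfMap p α β l _ = _
    rw [h x, hopfMap]
    dsimp only
    rw [mul_pow_mul_of_hopfCase hcase, add_comm 1, zpow_add_one₀ hα', zpow_add_one₀ hβ']
    simp only [add_mul, mul_add, mul_assoc, add_assoc]
  | pred n ih =>
    obtain ⟨c, hc, h⟩ := ih
    refine ⟨c * α⁻¹ - (β ^ (-(n : ℤ) - 1)) ^ p * l * α⁻¹, fun hl => by simp [hc hl, hl],
      fun x => ?_⟩
    rw [sub_eq_add_neg, add_comm, zpow_add, zpow_neg_one, Equiv.Perm.mul_apply]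
    change ((_ - (_ * β⁻¹) ^ p * l) * α⁻¹, _ * β⁻¹) = _
    rw [h x]
    dsimp only
    have e : x.1.2 * β ^ (-(n : ℤ)) * β⁻¹ = x.1.2 * β ^ (-(n : ℤ) - 1) := by
      rw [zpow_sub_one₀ hβ', mul_assoc]
    rw [e, mul_pow_mul_of_hopfCase hcase, add_comm (-1), ← sub_eq_add_neg, zpow_sub_one₀ hα']
    simp only [add_mul, sub_mul, mul_sub, mul_assoc, add_sub_assoc]

/-- The coefficient of `w ^ p` in the first component of the `n`-th iterate of `f`. -/
def hopfCoeff (p : ℕ) (α β l : ℍ[ℝ]) : ℕ → ℍ[ℝ]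
  | 0 => 0
  | n + 1 => hopfCoeff p α β l n * α + (β ^ n) ^ p * l

theorem hopfPerm_pow_apply (hcase : HopfCaseA p α β l ∨ HopfCaseB p α β l) (n : ℕ)
    (x : PuncturedH2) : ((hopfPerm p α β l hp hα hβ ^ n) x : H2) =
      (x.1.1 * α ^ n + x.1.2 ^ p * hopfCoeff p α β l n, x.1.2 * β ^ n) := by
  induction n with
  | zero => simp [hopfCoeff]
  | succ n ih =>
    rw [pow_succ', Equiv.Perm.mul_apply]
    change hopfMap p α β l _ = _
    rw [ih, hopfMap]
    dsimp only
    have := mul_pow_mul_of_hopfCase hcase n x.1.2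
    rw [zpow_natCast] at this
    rw [this, pow_succ, pow_succ, hopfCoeff]
    simp only [add_mul, mul_add, mul_assoc, add_assoc]

/-- The recursion has the resonant growth `n ‖β‖^(n-1)`; multiplying by `‖β‖` avoids the exponent `n
- 1` at `n = 0`. -/
theorem norm_hopfCoeff_mul_le (hp : p ≠ 0) (hαβ : ‖α‖ ≤ ‖β‖) (hβ : ‖β‖ < 1) (n : ℕ) :
    ‖hopfCoeff p α β l n‖ * ‖β‖ ≤ n * ‖β‖ ^ n * ‖l‖ := by
  induction n with
  | zero => simp [hopfCoeff]
  | succ n ih =>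
    have h1 : ‖hopfCoeff p α β l (n + 1)‖ ≤
        ‖hopfCoeff p α β l n‖ * ‖β‖ + ‖β‖ ^ n * ‖l‖ := by
      rw [hopfCoeff]
      refine (norm_add_le _ _).trans (add_le_add ?_ ?_)
      · rw [norm_mul]; gcongr
      · rw [norm_mul, norm_pow, norm_pow]
        gcongr
        exact pow_le_of_le_one (by positivity) (pow_le_one₀ (norm_nonneg _) hβ.le) hp
    calc _ ≤ (n * ‖β‖ ^ n * ‖l‖ + ‖β‖ ^ n * ‖l‖) * ‖β‖ := by gcongr; linarith
      _ = _ := by push_cast; ring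

theorem tendsto_norm_hopfCoeff (hp : p ≠ 0) (hβ0 : 0 < ‖β‖) (hαβ : ‖α‖ ≤ ‖β‖) (hβ : ‖β‖ < 1) :
    Filter.Tendsto (fun n => ‖hopfCoeff p α β l n‖) Filter.atTop (𝓝 0) := by
  have h1 := tendsto_self_mul_const_pow_of_lt_one (norm_nonneg β) hβ
  have h2 : Filter.Tendsto (fun n : ℕ => n * ‖β‖ ^ n * ‖l‖ / ‖β‖) Filter.atTop (𝓝 0) := by
    simpa using (h1.mul_const ‖l‖).div_const ‖β‖
  refine squeeze_zero (fun _ => norm_nonneg _) (fun n => ?_) h2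
  rw [le_div_iff₀ hβ0]
  exact norm_hopfCoeff_mul_le hp hαβ hβ n

/-- Uniform contraction on bounded sets, the source of both freeness and proper discontinuity of the
action. -/
theorem exists_norm_hopfPerm_pow_lt (hcase : HopfCaseA p α β l ∨ HopfCaseB p α β l)
    (hαβ : ‖α‖ ≤ ‖β‖) (hβ1 : ‖β‖ < 1) (R : ℝ) {ε : ℝ} (hε : 0 < ε) :
    ∃ N : ℕ, ∀ n ≥ N, ∀ x : PuncturedH2, ‖(x : H2)‖ ≤ R →
      ‖((hopfPerm p α β l hp hα hβ ^ n) x : H2)‖ < ε := by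
  have h1 := tendsto_pow_atTop_nhds_zero_of_lt_one (norm_nonneg β) hβ1
  have h2 := tendsto_norm_hopfCoeff (l := l) hp hβ hαβ hβ1
  have h3 : Filter.Tendsto (fun n => R * ‖β‖ ^ n + R ^ p * ‖hopfCoeff p α β l n‖) Filter.atTop
      (𝓝 0) := by
    simpa using (h1.const_mul R).add (h2.const_mul (R ^ p))
  obtain ⟨N, hN⟩ := Filter.eventually_atTop.mp (h3.eventually (gt_mem_nhds hε))
  refine ⟨N, fun n hn x hx => lt_of_le_of_lt ?_ (hN n hn)⟩
  have hx1 : ‖x.1.1‖ ≤ R := (norm_fst_le _).trans hx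
  have hx2 : ‖x.1.2‖ ≤ R := (norm_snd_le _).trans hx
  have hR : 0 ≤ R := (norm_nonneg _).trans hx
  rw [hopfPerm_pow_apply hcase, Prod.norm_mk]
  refine max_le ?_ ?_
  · refine (norm_add_le _ _).trans ?_
    rw [norm_mul, norm_mul, norm_pow, norm_pow]
    gcongr
  · rw [norm_mul, norm_pow]
    refine le_trans ?_ (le_add_of_nonneg_right (by positivity))
    gcongr

theorem exists_affineH2_eq_hopfPerm_zpow (hA : HopfCaseA p α β l) (k : ℤ) :
    ∃ A : (Matrix (Fin 2) (Fin 2) ℍ[ℝ])ˣ, ∀ x : PuncturedH2,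
      ((hopfPerm p α β l hp hα hβ ^ k) x : H2) = affineH2 A 0 x := by
  have hα' : α ^ k ≠ 0 := zpow_ne_zero _ (norm_pos_iff.mp hα)
  have hβ' : β ^ k ≠ 0 := zpow_ne_zero _ (norm_pos_iff.mp hβ)
  obtain ⟨c, hc, h⟩ := hopfPerm_zpow_apply (hp := hp) (hα := hα) (hβ := hβ) (Or.inl hA) k
  refine ⟨⟨!![α ^ k, 0; c, β ^ k],
    !![(α ^ k)⁻¹, 0; -((β ^ k)⁻¹ * c * (α ^ k)⁻¹), (β ^ k)⁻¹], ?_, ?_⟩, fun x => ?_⟩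
  · refine Matrix.ext fun i j => ?_
    fin_cases i <;> fin_cases j <;>
      simp [Matrix.mul_apply, hα', hβ', ← mul_assoc]
  · refine Matrix.ext fun i j => ?_
    fin_cases i <;> fin_cases j <;>
      simp [Matrix.mul_apply, hα', hβ', mul_assoc]
  · rw [h x, affineH2]
    rcases hA with ⟨hl, -⟩ | ⟨hl, -⟩ | ⟨-, h1, -⟩
    · simp [hc hl]
    · simp [hc hl]
    · simp [h1]

theorem hopfGroup_sliceRegular (hcase : HopfCaseA p α β l ∨ HopfCaseB p α β l)
    (γ : Equiv.Perm PuncturedH2) (hγ : γ ∈ hopfGroup p α β l hp hα hβ) :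
    ∃ G : H2 → H2, ContDiff ℝ ∞ G ∧ (∀ y, SliceRegularAt G y) ∧
      ∀ y : PuncturedH2, G y = γ y := by
  obtain ⟨k, rfl⟩ := Subgroup.mem_zpowers_iff.mp hγ
  obtain ⟨c, -, h⟩ := hopfPerm_zpow_apply (hp := hp) (hα := hα) (hβ := hβ) hcase k
  refine ⟨_, ?_, fun y => sliceRegularAt_triangular p (α ^ k) c (β ^ k) y, fun y => (h y).symm⟩
  fun_prop

end Iterates

/-! ### The action of the group and the quotient -/

section Action

variable {p : ℕ} {α β l : ℍ[ℝ]} {hp : p ≠ 0} {hα : 0 < ‖α‖} {hβ : 0 < ‖β‖}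

theorem hopfGroup_continuousConstSMul (hcase : HopfCaseA p α β l ∨ HopfCaseB p α β l) :
    ContinuousConstSMul (hopfGroup p α β l hp hα hβ) PuncturedH2 := by
  refine ⟨fun γ => ?_⟩
  obtain ⟨G, h1, -, h2⟩ := hopfGroup_sliceRegular hcase γ.1 γ.2
  refine Continuous.subtype_mk (h1.continuous.comp continuous_subtype_val) (fun x => ?_) |>.congr ?_
  · simp only [Function.comp, h2]; exact (γ.1 x).2
  · intro x
    exact Subtype.ext (h2 x)

/-- A periodic point would be fixed by arbitrarily high iterates, which bring its norm below its own
value. -/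
theorem hopfPerm_pow_ne (hcase : HopfCaseA p α β l ∨ HopfCaseB p α β l)
    (hαβ : ‖α‖ ≤ ‖β‖) (hβ1 : ‖β‖ < 1) {n : ℕ} (hn : n ≠ 0) (x : PuncturedH2) :
    (hopfPerm p α β l hp hα hβ ^ n) x ≠ x := by
  intro h
  have hx : 0 < ‖(x : H2)‖ := norm_pos_iff.mpr x.2
  obtain ⟨N, hN⟩ := exists_norm_hopfPerm_pow_lt (hp := hp) (hα := hα) (hβ := hβ) hcase hαβ hβ1
    ‖(x : H2)‖ hx
  have h2 : ((hopfPerm p α β l hp hα hβ ^ n) ^ N) x = x := by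
    rw [Equiv.Perm.coe_pow]
    exact Function.iterate_fixed h N
  have h1 := hN (n * N) (Nat.le_mul_of_pos_left N (Nat.pos_of_ne_zero hn)) x le_rfl
  rw [pow_mul, h2] at h1
  exact lt_irrefl _ h1

theorem hopfPerm_zpow_fixed (hcase : HopfCaseA p α β l ∨ HopfCaseB p α β l)
    (hαβ : ‖α‖ ≤ ‖β‖) (hβ1 : ‖β‖ < 1) {k : ℤ} {x : PuncturedH2}
    (h : (hopfPerm p α β l hp hα hβ ^ k) x = x) : k = 0 := by
  by_contra hk
  refine hopfPerm_pow_ne (hp := hp) (hα := hα) (hβ := hβ) hcase hαβ hβ1 (n := k.natAbs)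
    (by simpa using hk) x ?_
  rw [← zpow_natCast]
  rcases Int.natAbs_eq k with e | e
  · rw [← e]; exact h
  · have e' : (k.natAbs : ℤ) = -k := by omega
    rw [e', zpow_neg, Equiv.Perm.inv_eq_iff_eq]
    exact h.symm

theorem hopfGroup_isCancelSMul (hcase : HopfCaseA p α β l ∨ HopfCaseB p α β l)
    (hαβ : ‖α‖ ≤ ‖β‖) (hβ1 : ‖β‖ < 1) :
    IsCancelSMul (hopfGroup p α β l hp hα hβ) PuncturedH2 := by
  rw [isCancelSMul_iff_eq_one_of_smul_eq]
  rintro ⟨γ, hγ⟩ x h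
  obtain ⟨k, rfl⟩ := Subgroup.mem_zpowers_iff.mp hγ
  have hk := hopfPerm_zpow_fixed hcase hαβ hβ1 (show (hopfPerm p α β l hp hα hβ ^ k) x = x from h)
  subst hk
  rfl

theorem exists_norm_bounds_of_isCompact {K : Set PuncturedH2} (hK : IsCompact K) :
    ∃ R ε : ℝ, 0 < ε ∧ ∀ x ∈ K, ε ≤ ‖(x : H2)‖ ∧ ‖(x : H2)‖ ≤ R := by
  have hc : ContinuousOn (fun x : PuncturedH2 => ‖(x : H2)‖) K :=
    (continuous_norm.comp continuous_subtype_val).continuousOn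
  rcases K.eq_empty_or_nonempty with rfl | hne
  · exact ⟨0, 1, one_pos, by simp⟩
  · obtain ⟨a, -, ha⟩ := hK.exists_isMinOn hne hc
    obtain ⟨b, -, hb⟩ := hK.exists_isMaxOn hne hc
    exact ⟨‖(b : H2)‖, ‖(a : H2)‖, norm_pos_iff.mpr a.2, fun x hx => ⟨ha hx, hb hx⟩⟩

theorem hopfGroup_properlyDiscontinuousSMul (hcase : HopfCaseA p α β l ∨ HopfCaseB p α β l)
    (hαβ : ‖α‖ ≤ ‖β‖) (hβ1 : ‖β‖ < 1) :
    ProperlyDiscontinuousSMul (hopfGroup p α β l hp hα hβ) PuncturedH2 := by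
  refine ⟨fun {K L} hK hL => ?_⟩
  obtain ⟨R, ε, hε, hb⟩ := exists_norm_bounds_of_isCompact (hK.union hL)
  obtain ⟨N, hN⟩ := exists_norm_hopfPerm_pow_lt (hp := hp) (hα := hα) (hβ := hβ) hcase hαβ hβ1 R hε
  -- From iterate `N` on, points of norm at most `R` fall below `ε`, hence leave `K ∪ L`. Working
  -- with the union treats negative powers by exchanging the two points.
  have key : ∀ n : ℕ, ∀ x ∈ K ∪ L, (hopfPerm p α β l hp hα hβ ^ n) x ∈ K ∪ L → n < N := by
    intro n x hx hy
    by_contra! hn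
    exact absurd (hb _ hy).1 (not_le.mpr (hN n hn x (hb x hx).2))
  refine ((Set.finite_Icc (-(N : ℤ)) N).image
    fun k => (⟨hopfPerm p α β l hp hα hβ ^ k, k, rfl⟩ : hopfGroup p α β l hp hα hβ)).subset ?_
  rintro ⟨γ, hγ⟩ ⟨y, ⟨x, hx, hxy⟩, hy⟩
  obtain ⟨k, rfl⟩ := Subgroup.mem_zpowers_iff.mp hγ
  replace hxy : (hopfPerm p α β l hp hα hβ ^ k) x = y := hxy
  refine ⟨k, ?_, rfl⟩
  have : k.natAbs < N := by
    rcases Int.natAbs_eq k with e | e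
    · refine key _ x (.inl hx) ?_
      rw [← zpow_natCast, ← e, hxy]
      exact .inr hy
    · refine key _ y (.inr hy) ?_
      have e' : (k.natAbs : ℤ) = -k := by omega
      rw [← zpow_natCast, e', zpow_neg, ← hxy, Equiv.Perm.inv_def, Equiv.symm_apply_apply]
      exact .inl hx
  rw [Set.mem_Icc]
  omega

/-- The group is infinite cyclic. -/
def hopfGroupEquivInt (hcase : HopfCaseA p α β l ∨ HopfCaseB p α β l)
    (hαβ : ‖α‖ ≤ ‖β‖) (hβ1 : ‖β‖ < 1) : Multiplicative ℤ ≃* hopfGroup p α β l hp hα hβ :=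
  (MonoidHom.ofInjective (f := zpowersHom _ (hopfPerm p α β l hp hα hβ)) (by
    rw [injective_iff_map_eq_one]
    intro k hk
    have hx : ((1, 1) : H2) ≠ 0 := by simp
    exact hopfPerm_zpow_fixed (x := ⟨_, hx⟩) hcase hαβ hβ1 (by
      rw [zpowersHom_apply] at hk
      exact congrArg (fun γ : Equiv.Perm PuncturedH2 => γ ⟨_, hx⟩) hk))).trans
    (MulEquiv.subgroupCongr (by
      ext γ
      simp [Subgroup.mem_zpowers_iff, MonoidHom.mem_range]))

instance : LocallyCompactSpace PuncturedH2 :=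
  (isOpen_ne (x := (0 : H2))).locallyCompactSpace

theorem isQuotientCoveringMap_hopfProj (hcase : HopfCaseA p α β l ∨ HopfCaseB p α β l)
    (hαβ : ‖α‖ ≤ ‖β‖) (hβ1 : ‖β‖ < 1) :
    IsQuotientCoveringMap (hopfProj p α β l hp hα hβ) (hopfGroup p α β l hp hα hβ) := by
  have := hopfGroup_continuousConstSMul (hp := hp) (hα := hα) (hβ := hβ) hcase
  have := hopfGroup_isCancelSMul (hp := hp) (hα := hα) (hβ := hβ) hcase hαβ hβ1
  have := hopfGroup_properlyDiscontinuousSMul (hp := hp) (hα := hα) (hβ := hβ) hcase hαβ hβ1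
  exact isQuotientCoveringMap_quotientMk_of_properlyDiscontinuousSMul

theorem hopfProj_eq_iff {x y : PuncturedH2} :
    hopfProj p α β l hp hα hβ x = hopfProj p α β l hp hα hβ y ↔
      ∃ γ ∈ hopfGroup p α β l hp hα hβ, γ y = x := by
  rw [hopfProj, hopfProj, Quotient.eq]
  change x ∈ MulAction.orbit _ y ↔ _
  rw [MulAction.mem_orbit_iff]
  constructor
  · rintro ⟨γ, h⟩; exact ⟨γ.1, γ.2, h⟩
  · rintro ⟨γ, h, h'⟩; exact ⟨⟨γ, h⟩, h'⟩

/-! ### Charts on circular sets -/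

/-- Each point has a circular open neighbourhood that is disjoint from its iterates. -/
theorem exists_circular_nhd (hcase : HopfCaseA p α β l ∨ HopfCaseB p α β l)
    (hαβ : ‖α‖ ≤ ‖β‖) (hβ1 : ‖β‖ < 1) (x : PuncturedH2) :
    ∃ U : Set H2, IsOpen U ∧ IsCircular U ∧ (x : H2) ∈ U ∧ (0 : H2) ∉ U ∧
      ∀ y : PuncturedH2, (y : H2) ∈ U → ∀ n : ℕ, n ≠ 0 →
        ((hopfPerm p α β l hp hα hβ ^ n) y : H2) ∉ U := by
  set q := ‖β‖ with hq
  -- An annulus `m < ‖·‖ < M` around radius `r` with `M‖β‖ < m`, so that multiplication by `β`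
  -- throws it off itself: `M = 2r / (1 + ‖β‖)`, and `m` is the midpoint of `M‖β‖` and `r`.
  have interval : ∀ r : ℝ, 0 < r → ∃ m M : ℝ, m < r ∧ r < M ∧ M * q < m := by
    intro r hr
    have h1 : 2 * r / (1 + q) * q < r := by
      rw [div_mul_eq_mul_div, div_lt_iff₀ (by linarith)]
      nlinarith
    refine ⟨(2 * r / (1 + q) * q + r) / 2, 2 * r / (1 + q), by linarith, ?_, by linarith⟩
    rw [lt_div_iff₀ (by linarith)]
    nlinarith
  have c₁ : Continuous fun y : H2 => ‖y.1‖ := by fun_prop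
  have c₂ : Continuous fun y : H2 => ‖y.2‖ := by fun_prop
  have pow_le : ∀ n : ℕ, n ≠ 0 → q ^ n ≤ q := fun n hn => pow_le_of_le_one hβ.le hβ1.le hn
  by_cases hw : x.1.2 = 0
  · have hz : 0 < ‖x.1.1‖ := by
      rw [norm_pos_iff]
      intro h
      exact x.2 (Prod.ext h hw)
    obtain ⟨m, M, h1, h2, h3⟩ := interval _ hz
    have hM : 0 < M := hz.trans h2
    have hm : 0 < m := lt_trans (by positivity) h3
    obtain ⟨C, hC⟩ := (tendsto_norm_hopfCoeff (l := l) hp hβ hαβ hβ1).bddAbove_range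
    have hC' : ∀ n, ‖hopfCoeff p α β l n‖ ≤ C := fun n => hC ⟨n, rfl⟩
    have hC0 : 0 ≤ C := (norm_nonneg _).trans (hC' 0)
    -- When `w = 0` the annulus is taken in `z`, and `‖w‖ < ε` keeps the term `w^p c_n` below the
    -- gap `m - M‖β‖`; `ε ≤ 1` ensures `‖w‖^p ≤ ε`.
    set ε := min 1 ((m - M * q) / (C + 1)) with hε
    have hε0 : 0 < ε := lt_min one_pos (div_pos (by linarith) (by linarith))
    refine ⟨{y | (m < ‖y.1‖ ∧ ‖y.1‖ < M) ∧ ‖y.2‖ < ε}, ?_,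
      isCircular_of_norm (fun a b => (m < a ∧ a < M) ∧ b < ε), ⟨⟨h1, h2⟩, by simpa [hw] using hε0⟩,
      fun h => ?_, fun y hy n hn h => ?_⟩
    · exact ((isOpen_lt continuous_const c₁).inter (isOpen_lt c₁ continuous_const)).inter
        (isOpen_lt c₂ continuous_const)
    · have := h.1.1
      simp at this
      linarith
    · have h5 := h.1.1
      rw [hopfPerm_pow_apply hcase] at h5
      dsimp only at h5
      have h6 : ‖y.1.1 * α ^ n + y.1.2 ^ p * hopfCoeff p α β l n‖ ≤ M * q + ε * C := by
        refine (norm_add_le _ _).trans ?_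
        rw [norm_mul, norm_mul, norm_pow, norm_pow]
        have a1 : ‖α‖ ^ n ≤ q := (pow_le_pow_left₀ (norm_nonneg _) hαβ n).trans (pow_le n hn)
        have a2 : ‖y.1.2‖ ^ p ≤ ε :=
          (pow_le_of_le_one (norm_nonneg _) (hy.2.le.trans (min_le_left _ _)) hp).trans hy.2.le
        gcongr
        · exact hy.1.2.le
        · exact hC' n
      have h7 : ε * (C + 1) ≤ m - M * q := by
        rw [← le_div_iff₀ (by linarith)]
        exact min_le_right _ _
      nlinarith
  · have hz : 0 < ‖x.1.2‖ := norm_pos_iff.mpr hw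
    obtain ⟨m, M, h1, h2, h3⟩ := interval _ hz
    have hM : 0 < M := hz.trans h2
    have hm : 0 < m := lt_trans (by positivity) h3
    refine ⟨{y | m < ‖y.2‖ ∧ ‖y.2‖ < M}, ?_, isCircular_of_norm (fun _ b => m < b ∧ b < M),
      ⟨h1, h2⟩, fun h => ?_, fun y hy n hn h => ?_⟩
    · exact (isOpen_lt continuous_const c₂).inter (isOpen_lt c₂ continuous_const)
    · have := h.1
      simp at this
      linarith
    · have h5 := h.1
      rw [hopfPerm_pow_apply hcase] at h5
      dsimp only at h5
      rw [norm_mul, norm_pow] at h5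
      have h6 : ‖y.1.2‖ * q ^ n ≤ M * q := by
        gcongr
        · exact hy.2.le
        · exact pow_le n hn
      linarith

theorem exists_hopfAtlas_chart (hcase : HopfCaseA p α β l ∨ HopfCaseB p α β l)
    (hαβ : ‖α‖ ≤ ‖β‖) (hβ1 : ‖β‖ < 1) (x : PuncturedH2) :
    ∃ e ∈ hopfAtlas p α β l hp hα hβ, (x : H2) ∈ e.target ∧
      hopfProj p α β l hp hα hβ x ∈ e.source := by
  obtain ⟨U, hUo, hUc, hxU, h0, hU⟩ :=
    exists_circular_nhd (hp := hp) (hα := hα) (hβ := hβ) hcase hαβ hβ1 x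
  have hcov := (isQuotientCoveringMap_hopfProj (hp := hp) (hα := hα) (hβ := hβ) hcase hαβ hβ1)
  -- Points of `U` with the same image differ by a power of `f`; a nonzero exponent, read in the
  -- right direction, contradicts the choice of `U`.
  have hinj : Set.InjOn (hopfProj p α β l hp hα hβ) (Subtype.val ⁻¹' U) := by
    intro y hy y' hy' h
    obtain ⟨γ, hγ, e⟩ := hopfProj_eq_iff.mp h
    obtain ⟨k, rfl⟩ := Subgroup.mem_zpowers_iff.mp hγ
    by_cases hk : k = 0
    · subst hk; exact e.symm
    exfalso
    rcases Int.natAbs_eq k with e' | e'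
    · refine hU y' hy' k.natAbs (by simpa using hk) ?_
      rw [← zpow_natCast, ← e', e]; exact hy
    · refine hU y hy k.natAbs (by simpa using hk) ?_
      have e'' : (k.natAbs : ℤ) = -k := by omega
      rw [← zpow_natCast, e'', zpow_neg, ← e, Equiv.Perm.inv_def, Equiv.symm_apply_apply]
      exact hy'
  have : Nonempty PuncturedH2 := ⟨x⟩
  set e₁ : OpenPartialHomeomorph PuncturedH2 (HopfQuotient p α β l hp hα hβ) :=
    .ofContinuousOpen hinj.toPartialEquiv hcov.isCoveringMap.continuous.continuousOn
      hcov.isCoveringMap.isOpenMap (hUo.preimage continuous_subtype_val) with he₁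
  have hemb : Topology.IsOpenEmbedding (Subtype.val : PuncturedH2 → H2) :=
    (isOpen_ne (x := (0 : H2))).isOpenEmbedding_subtypeVal
  set e₀ := hemb.toOpenPartialHomeomorph Subtype.val with he₀
  have hs : ∀ y : PuncturedH2, e₀.symm y = y := fun y => e₀.left_inv (by simp [he₀])
  have ht : (e₁.symm.trans e₀).target = U := by
    ext y
    rw [OpenPartialHomeomorph.trans_target]
    constructor
    · rintro ⟨h1, h2⟩
      have h3 : y ≠ 0 := by simpa [he₀] using h1
      have h4 : e₀.symm y ∈ Subtype.val ⁻¹' U := h2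
      rw [hs ⟨y, h3⟩] at h4
      exact h4
    · intro hy
      have h3 : y ≠ 0 := fun h => h0 (h ▸ hy)
      refine ⟨by simpa [he₀] using h3, ?_⟩
      change e₀.symm y ∈ Subtype.val ⁻¹' U
      rw [hs ⟨y, h3⟩]
      exact hy
  have hsy : ∀ y ∈ U, ∃ hy : y ≠ 0, (e₁.symm.trans e₀).symm y = hopfProj p α β l hp hα hβ ⟨y, hy⟩ := by
    intro y hy
    have h3 : y ≠ 0 := fun h => h0 (h ▸ hy)
    refine ⟨h3, ?_⟩
    change e₁ (e₀.symm y) = _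
    rw [hs ⟨y, h3⟩]
    rfl
  refine ⟨e₁.symm.trans e₀, ⟨by rw [ht]; exact hUc, by rw [ht]; exact hsy⟩, by rw [ht]; exact hxU, ?_⟩
  obtain ⟨h3, h4⟩ := hsy x hxU
  rw [← h4]
  exact (e₁.symm.trans e₀).map_target (by rw [ht]; exact hxU)

/-- The charts of the quotient are, upstairs, locally given by elements of the group. -/
theorem hopfAtlas_eventuallyEq (hcase : HopfCaseA p α β l ∨ HopfCaseB p α β l)
    {e : OpenPartialHomeomorph (HopfQuotient p α β l hp hα hβ) H2}
    (he : e ∈ hopfAtlas p α β l hp hα hβ) {x : PuncturedH2}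
    (hx : hopfProj p α β l hp hα hβ x ∈ e.source) :
    ∃ γ ∈ hopfGroup p α β l hp hα hβ,
      ∀ᶠ y in 𝓝 x, e (hopfProj p α β l hp hα hβ y) = γ y := by
  obtain ⟨hy, h⟩ := he.2 _ (e.map_source hx)
  rw [e.left_inv hx] at h
  obtain ⟨γ, hγ, hγ'⟩ := hopfProj_eq_iff.mp h.symm
  refine ⟨γ, hγ, ?_⟩
  have := hopfGroup_continuousConstSMul (hp := hp) (hα := hα) (hβ := hβ) hcase
  have hc : Continuous fun y : PuncturedH2 => ((γ y : PuncturedH2) : H2) :=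
    continuous_subtype_val.comp (continuous_const_smul (⟨γ, hγ⟩ : hopfGroup p α β l hp hα hβ))
  have h1 : ∀ᶠ y in 𝓝 x, (γ y : H2) ∈ e.target := by
    refine hc.continuousAt.eventually_mem (e.open_target.mem_nhds ?_)
    rw [hγ']
    exact e.map_source hx
  filter_upwards [h1] with y hy
  obtain ⟨hy0, h2⟩ := he.2 _ hy
  have h3 : hopfProj p α β l hp hα hβ y = hopfProj p α β l hp hα hβ (γ y) :=
    (hopfProj_eq_iff.mpr ⟨γ, hγ, rfl⟩).symm
  rw [h3, ← e.right_inv hy, h2]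

theorem eventually_nhds_punctured {P : PuncturedH2 → Prop} {Q : H2 → Prop} {x : PuncturedH2}
    (hP : ∀ᶠ y in 𝓝 x, P y) (h : ∀ y : PuncturedH2, P y → Q y) : ∀ᶠ y in 𝓝 (x : H2), Q y := by
  have h1 : ∀ᶠ y : PuncturedH2 in 𝓝 x, Q y := hP.mono h
  rwa [← (isOpen_ne (x := (0 : H2))).isOpenEmbedding_subtypeVal.map_nhds_eq x, Filter.eventually_map]

/-- The extension `G` of the group element is left free, so that one statement serves for
smoothness, slice regularity and, in case A, affinity. -/
theorem hopfAtlas_trans_eventuallyEq (hcase : HopfCaseA p α β l ∨ HopfCaseB p α β l)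
    {e e' : OpenPartialHomeomorph (HopfQuotient p α β l hp hα hβ) H2}
    (he : e ∈ hopfAtlas p α β l hp hα hβ) (he' : e' ∈ hopfAtlas p α β l hp hα hβ) {y : H2}
    (hy : y ∈ (e.symm.trans e').source) :
    ∃ γ ∈ hopfGroup p α β l hp hα hβ, ∀ G : H2 → H2, (∀ x : PuncturedH2, G x = γ x) →
      ⇑(e.symm.trans e') =ᶠ[𝓝 y] G := by
  rw [OpenPartialHomeomorph.trans_source] at hy
  obtain ⟨hy1, hy2⟩ := hy
  replace hy1 : y ∈ e.target := hy1
  replace hy2 : e.symm y ∈ e'.source := hy2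
  obtain ⟨hy0, h⟩ := he.2 y hy1
  rw [h] at hy2
  obtain ⟨γ, hγ, h1⟩ := hopfAtlas_eventuallyEq hcase he' hy2
  refine ⟨γ, hγ, fun G hG => ?_⟩
  have h2 : ∀ᶠ x in 𝓝 y, x ∈ e.target := e.open_target.mem_nhds hy1
  have h3 : ∀ᶠ x in 𝓝 y, ∀ hx : x ≠ 0, e' (hopfProj p α β l hp hα hβ ⟨x, hx⟩) = γ ⟨x, hx⟩ :=
    eventually_nhds_punctured (x := ⟨y, hy0⟩) h1 fun x hx _ => hx
  filter_upwards [h2, h3] with x hx hx'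
  obtain ⟨hx0, h4⟩ := he.2 x hx
  change e' (e.symm x) = G x
  rw [h4, hx' hx0]
  exact (hG ⟨x, hx0⟩).symm

theorem isSliceQuaternionicAtlas_hopfAtlas (hcase : HopfCaseA p α β l ∨ HopfCaseB p α β l)
    (hαβ : ‖α‖ ≤ ‖β‖) (hβ1 : ‖β‖ < 1) :
    IsSliceQuaternionicAtlas (hopfAtlas p α β l hp hα hβ) where
  covers x := by
    obtain ⟨y, rfl⟩ := Quotient.exists_rep x
    obtain ⟨e, he, -, h⟩ := exists_hopfAtlas_chart (hp := hp) (hα := hα) (hβ := hβ) hcase hαβ hβ1 y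
    exact ⟨e, he, h⟩
  circular e he := he.1
  smooth e he e' he' y hy := by
    obtain ⟨γ, hγ, h⟩ := hopfAtlas_trans_eventuallyEq hcase he he' hy
    obtain ⟨G, h1, -, h2⟩ := hopfGroup_sliceRegular hcase γ hγ
    exact (h1.contDiffAt.congr_of_eventuallyEq (h G h2)).contDiffWithinAt
  sliceRegular e he e' he' y hy := by
    obtain ⟨γ, hγ, h⟩ := hopfAtlas_trans_eventuallyEq hcase he he' hy
    obtain ⟨G, -, h1, h2⟩ := hopfGroup_sliceRegular hcase γ hγ
    exact (h1 y).congr (h G h2)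

theorem hopfAtlas_sliceRegularOnPunctured (hcase : HopfCaseA p α β l ∨ HopfCaseB p α β l)
    {e : OpenPartialHomeomorph (HopfQuotient p α β l hp hα hβ) H2}
    (he : e ∈ hopfAtlas p α β l hp hα hβ) :
    SliceRegularOnPunctured (fun y => e (hopfProj p α β l hp hα hβ y))
      (hopfProj p α β l hp hα hβ ⁻¹' e.source) := by
  classical
  refine ⟨fun y => if h : y ≠ 0 then e (hopfProj p α β l hp hα hβ ⟨y, h⟩) else 0,
    fun y hy => ⟨by simp [y.2], ?_⟩⟩
  obtain ⟨γ, hγ, h⟩ := hopfAtlas_eventuallyEq hcase he hy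
  obtain ⟨G, -, h1, h2⟩ := hopfGroup_sliceRegular hcase γ hγ
  refine (h1 y).congr (eventually_nhds_punctured h fun x hx => ?_)
  simp [x.2, hx, h2]

/-! ### The affine structure in case A and the Hopf surface -/

theorem isAffineAtlas_hopfAtlas (hA : HopfCaseA p α β l) (hαβ : ‖α‖ ≤ ‖β‖) (hβ1 : ‖β‖ < 1) :
    IsAffineAtlas (hopfAtlas p α β l hp hα hβ) where
  covers := (isSliceQuaternionicAtlas_hopfAtlas (.inl hA) hαβ hβ1).covers
  affine e he e' he' y hy := by
    obtain ⟨γ, hγ, h⟩ := hopfAtlas_trans_eventuallyEq (.inl hA) he he' hy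
    obtain ⟨k, rfl⟩ := Subgroup.mem_zpowers_iff.mp hγ
    obtain ⟨A, h1⟩ := exists_affineH2_eq_hopfPerm_zpow (hp := hp) (hα := hα) (hβ := hβ) hA k
    exact ⟨A, 0, h _ fun x => (h1 x).symm⟩

theorem admitsAffineStructure_hopfAtlas (hA : HopfCaseA p α β l) (hαβ : ‖α‖ ≤ ‖β‖)
    (hβ1 : ‖β‖ < 1) : AdmitsAffineStructure (hopfAtlas p α β l hp hα hβ) :=
  ⟨_, isAffineAtlas_hopfAtlas hA hαβ hβ1, by
    rw [Set.union_self]; exact isSliceQuaternionicAtlas_hopfAtlas (.inl hA) hαβ hβ1⟩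

theorem AdmitsAffineStructure.sliceRegularAffineCharts {X : Type*} [TopologicalSpace X]
    {𝒜 : Set (OpenPartialHomeomorph X H2)} (h : AdmitsAffineStructure 𝒜) :
    AdmitsSliceRegularAffineCharts 𝒜 := by
  obtain ⟨ℬ, h1, h2⟩ := h
  exact ⟨ℬ, h1, fun e he e' he' => h2.sliceRegular e (.inl he) e' (.inr he')⟩

theorem isHopfSurface_hopfAtlas [SimplyConnectedSpace PuncturedH2]
    (hcase : HopfCaseA p α β l ∨ HopfCaseB p α β l) (hαβ : ‖α‖ ≤ ‖β‖) (hβ1 : ‖β‖ < 1) :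
    IsHopfSurface (hopfAtlas p α β l hp hα hβ) (hopfProj p α β l hp hα hβ) := by
  have := hopfGroup_continuousConstSMul (hp := hp) (hα := hα) (hβ := hβ) hcase
  have := hopfGroup_properlyDiscontinuousSMul (hp := hp) (hα := hα) (hβ := hβ) hcase hαβ hβ1
  have hcov := (isQuotientCoveringMap_hopfProj (hp := hp) (hα := hα) (hβ := hβ) hcase hαβ hβ1)
  exact
  { t2 := t2Space_of_properlyDiscontinuousSMul_of_t2Space
    secondCountable := ContinuousConstSMul.secondCountableTopology
    atlas := isSliceQuaternionicAtlas_hopfAtlas hcase hαβ hβ1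
    covering := hcov.isCoveringMap
    surjective := hcov.surjective
    simplyConnected := inferInstance
    sliceQuaternionic := fun e he => hopfAtlas_sliceRegularOnPunctured hcase he
    fundamentalGroup := fun x => by
      obtain ⟨y, rfl⟩ := hcov.surjective x
      exact ⟨(hcov.fundamentalGroupEquiv ⟨y, rfl⟩).trans
        ((MulEquiv.inv' _).symm.trans (hopfGroupEquivInt hcase hαβ hβ1).symm)⟩ }


end Action

/-! ### The punctured space is simply connected -/

section PuncturedSpace

open unitInterval

variable {E : Type*} [NormedAddCommGroup E] [NormedSpace ℝ E]

/-- Two paths avoiding the origin that are uniformly closer to each other than the first is to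
the origin are homotopic. -/
theorem Path.homotopic_of_norm_sub_lt {x y : {v : E // v ≠ 0}} (γ γ' : Path x y)
    (h : ∀ t, ‖(γ' t : E) - γ t‖ < ‖(γ t : E)‖) : γ.Homotopic γ' := by
  have hne : ∀ s : I × I, (γ s.2 : E) + (s.1 : ℝ) • ((γ' s.2 : E) - γ s.2) ≠ 0 := by
    intro s h0
    have h1 : ‖(γ s.2 : E)‖ = (s.1 : ℝ) * ‖(γ' s.2 : E) - γ s.2‖ := by
      conv_lhs => rw [eq_neg_of_add_eq_zero_left h0, norm_neg, norm_smul, Real.norm_of_nonneg s.1.2.1]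
    have h2 := h s.2
    have h3 := s.1.2.2
    have h4 := norm_nonneg ((γ' s.2 : E) - γ s.2)
    nlinarith
  refine ⟨⟨⟨⟨fun s => ⟨_, hne s⟩, ?_⟩, ?_, ?_⟩, ?_⟩⟩
  · refine Continuous.subtype_mk ?_ _
    fun_prop
  · intro t; ext; simp
  · intro t; ext; simp
  · intro s t ht
    ext
    rcases ht with rfl | rfl <;> simp

theorem starConvex_compl_ray {v : E} (hv0 : v ≠ 0) :
    StarConvex ℝ (-v) {y : E | ∀ c : ℝ, 0 ≤ c → y ≠ c • v} := by
  intro y hy a b ha hb hab c hc h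
  rcases hb.eq_or_lt with rfl | hb
  · have ha1 : a = 1 := by linarith
    subst ha1
    have hv : (c + 1) • v = 0 := by
      rw [zero_smul, add_zero, one_smul] at h
      rw [add_smul, one_smul, ← h, neg_add_cancel]
    rcases smul_eq_zero.mp hv with h' | h'
    · linarith
    · exact hv0 h'
  · refine hy ((c + a) / b) (by positivity) ?_
    rw [div_eq_inv_mul, mul_smul, eq_inv_smul_iff₀ hb.ne', add_smul, ← h]
    module

/-- A loop is homotopic to a nearby polynomial one. The cone over a `C¹` curve is the image of a
plane, so in dimension above two it misses some `v`; the loop then lies in the complement of the ray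
of `v`, which is star-shaped about `-v`. -/
theorem simplyConnectedSpace_ne_zero [FiniteDimensional ℝ E] (hE : 2 < Module.finrank ℝ E) :
    SimplyConnectedSpace {v : E // v ≠ 0} := by
  rw [simply_connected_iff_loops_nullhomotopic]
  refine ⟨?_, fun x γ => ?_⟩
  · have : IsPathConnected {v : E | v ≠ 0} :=
      isPathConnected_compl_singleton_of_one_lt_rank (by
        rw [← Module.finrank_eq_rank]; exact_mod_cast (by omega : 1 < Module.finrank ℝ E)) 0
    exact isPathConnected_iff_pathConnectedSpace.mp this
  set f : C(I, E) := ⟨fun t => (γ t : E), by fun_prop⟩ with hf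
  obtain ⟨t₀, -, ht₀⟩ := isCompact_univ.exists_isMinOn (Set.univ_nonempty (α := I))
    (f := fun t => ‖f t‖) (by fun_prop)
  have hd : 0 < ‖f t₀‖ := norm_pos_iff.mpr (γ t₀).2
  have hlim := (Metric.tendsto_nhds.mp (bernsteinApproximation_uniform f) _ hd).and
    (Filter.eventually_ne_atTop 0)
  obtain ⟨n, hn, hn0⟩ := hlim.exists
  set g := bernsteinApproximation n f with hg
  have hclose : ∀ t, ‖g t - f t‖ < ‖f t‖ := fun t => by
    rw [← dist_eq_norm]
    exact (ContinuousMap.dist_apply_le_dist t).trans_lt (hn.trans_le (ht₀ (Set.mem_univ t)))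
  have hg0 : ∀ t, g t ≠ 0 := fun t h => by
    have := hclose t
    rw [h, zero_sub, norm_neg] at this
    exact lt_irrefl _ this
  -- Bernstein polynomials keep the endpoint values, so the approximation is again a loop at `x`; at
  -- `1` this needs `n ≠ 0`.
  have hgs : g 0 = x := by rw [hg, bernsteinApproximation.apply_zero]; simp [hf]
  have hgt : g 1 = x := by rw [hg, bernsteinApproximation.apply_one hn0]; simp [hf]
  set γ' : Path x x := ⟨⟨fun t => ⟨g t, hg0 t⟩, by fun_prop⟩, Subtype.ext hgs, Subtype.ext hgt⟩
  refine (Path.homotopic_of_norm_sub_lt γ γ' hclose).trans ?_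
  set G : ℝ → E := fun t => ∑ k : Fin (n + 1),
    ((n.choose k : ℝ) * t ^ (k : ℕ) * (1 - t) ^ (n - k)) • f (bernstein.z k)
  have hG : ∀ t : I, g t = G t := fun t => by
    rw [hg, bernsteinApproximation.apply]
    simp only [bernstein_apply, G]
  have hsm : ContDiff ℝ 1 fun s : ℝ × ℝ => s.1 • G s.2 := by
    simp only [G]
    fun_prop
  obtain ⟨v, hv⟩ := (hsm.dense_compl_range_of_finrank_lt_finrank (by simpa using hE)).nonempty
  have hv' : ∀ (s : ℝ) (t : ℝ), s • G t ≠ v := fun s t h => hv ⟨(s, t), h⟩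
  have hv0 : v ≠ 0 := by simpa using (hv' 0 0).symm
  set S := {y : E | ∀ c : ℝ, 0 ≤ c → y ≠ c • v} with hS
  have hgS : ∀ t, g t ∈ S := by
    intro t c hc h
    rcases hc.eq_or_lt with rfl | hc
    · exact hg0 t (by rw [h, zero_smul])
    · refine hv' c⁻¹ t ?_
      rw [← hG, h, inv_smul_smul₀ hc.ne']
  have : ContractibleSpace S := (starConvex_compl_ray hv0).contractibleSpace ⟨_, hgS 0⟩
  set y : S := ⟨x, hgs ▸ hgS 0⟩
  set γS : Path y y := ⟨⟨fun t => ⟨g t, hgS t⟩, by fun_prop⟩, Subtype.ext hgs, Subtype.ext hgt⟩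
  have h1 := SimplyConnectedSpace.paths_homotopic γS (Path.refl y)
  set ι : C(S, {v : E // v ≠ 0}) := ⟨fun z => ⟨z.1, by simpa using z.2 0 le_rfl⟩, by fun_prop⟩
  exact h1.map ι

instance : SimplyConnectedSpace PuncturedH2 := by
  apply simplyConnectedSpace_ne_zero
  rw [Module.finrank_prod, Quaternion.finrank_eq_four]
  norm_num

end PuncturedSpace

/-! ### Developing maps -/

section Developing

open Filter

variable {M V : Type*} [TopologicalSpace M] [TopologicalSpace V] {G : Subgroup (Equiv.Perm V)}

/-- An open map carries neighbourhoods to neighbourhoods, so agreement after composing with `φ` is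
agreement of germs in `V`, where rigidity applies. -/
theorem eq_of_eventuallyEq_comp
    (hG : ∀ g ∈ G, ∀ g' ∈ G, ∀ v, ⇑g =ᶠ[𝓝 v] ⇑g' → g = g') {φ : M → V} {z : M}
    (hφ : 𝓝 (φ z) ≤ map φ (𝓝 z)) {g g' : Equiv.Perm V} (hg : g ∈ G) (hg' : g' ∈ G)
    (h : ∀ᶠ y in 𝓝 z, g (φ y) = g' (φ y)) : g = g' :=
  hG g hg g' hg' (φ z) (hφ (show _ ∈ _ from h))

/-- Local maps that are open and differ from each other by elements of a group of rigid
transformations patch together to a global map on a simply connected space. -/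
theorem exists_developingMap [SimplyConnectedSpace M] [LocallyPathConnectedSpace M]
    (hG : ∀ g ∈ G, ∀ g' ∈ G, ∀ v, ⇑g =ᶠ[𝓝 v] ⇑g' → g = g')
    (U : M → Set M) (hU : ∀ x, IsOpen (U x)) (hxU : ∀ x, x ∈ U x) (φ : M → M → V)
    (hφ : ∀ x, ∀ z ∈ U x, 𝓝 (φ x z) ≤ map (φ x) (𝓝 z))
    (htrans : ∀ x y z, z ∈ U x → z ∈ U y → ∃ g ∈ G, ∀ᶠ t in 𝓝 z, φ x t = g (φ y t)) :
    ∃ dev : M → V, ∀ x, ∃ g ∈ G, ∀ᶠ t in 𝓝 x, dev t = g (φ x t) := by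
  classical
  -- With discrete fibre, the bundle built from the transition elements is a covering of `M`.
  let _ : TopologicalSpace G := ⊥
  have : DiscreteTopology G := ⟨rfl⟩
  -- Transition elements are made total by the value `1` off the overlaps.
  have htrans' : ∀ x y z, ∃ g : G, z ∈ U x → z ∈ U y →
      ∀ᶠ t in 𝓝 z, φ x t = (g : Equiv.Perm V) (φ y t) := by
    intro x y z
    by_cases h : z ∈ U x ∧ z ∈ U y
    · obtain ⟨g, hg, h'⟩ := htrans x y z h.1 h.2
      exact ⟨⟨g, hg⟩, fun _ _ => h'⟩
    · exact ⟨1, fun h1 h2 => absurd ⟨h1, h2⟩ h⟩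
  choose τ hτ using htrans'
  have huniq : ∀ x z, z ∈ U x → ∀ g g' : G,
      (∀ᶠ t in 𝓝 z, (g : Equiv.Perm V) (φ x t) = (g' : Equiv.Perm V) (φ x t)) → g = g' :=
    fun x z hz g g' h => Subtype.ext (eq_of_eventuallyEq_comp hG (hφ x z hz) g.2 g'.2 h)
  have hloc : ∀ x y z, z ∈ U x → z ∈ U y → ∀ᶠ t in 𝓝 z, τ x y t = τ x y z := by
    intro x y z hx hy
    filter_upwards [(hτ x y z hx hy).eventually_nhds, (hU x).mem_nhds hx, (hU y).mem_nhds hy]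
      with t ht htx hty
    refine huniq y t hty _ _ ?_
    filter_upwards [hτ x y t htx hty, ht] with s h1 h2
    rw [← h1, h2]
  let Z : FiberBundleCore M M G :=
    { baseSet := U
      isOpen_baseSet := hU
      indexAt := id
      mem_baseSet_at := hxU
      -- The coordinate `g` over `U x` stands for the germ `g ∘ φ x`, and `g ∘ φ x = (g * τ x y z) ∘
      -- φ y` near `z`.
      coordChange := fun x y z g => g * τ x y z
      coordChange_self := fun x z hz g => by
        have : τ x x z = 1 := huniq x z hz _ _ (by
          filter_upwards [hτ x x z hz hz] with t ht
          rw [← ht]; rfl)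
        rw [this, mul_one]
      continuousOn_coordChange := fun x y => by
        rintro ⟨z, g⟩ ⟨⟨h1, h2⟩, -⟩
        refine ContinuousAt.continuousWithinAt ?_
        have : (fun q : M × G => q.2 * τ x y q.1) =ᶠ[𝓝 (z, g)] fun q => q.2 * τ x y z := by
          filter_upwards [(continuous_fst.tendsto (z, g)).eventually (hloc x y z h1 h2)] with q hq
          rw [hq]
        refine ContinuousAt.congr ?_ this.symm
        exact ((continuous_of_discreteTopology (f := fun g : G => g * τ x y z)).comp
          continuous_snd).continuousAt
      coordChange_comp := fun x y w z hz g => by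
        obtain ⟨⟨h1, h2⟩, h3⟩ := hz
        rw [mul_assoc]
        congr 1
        refine huniq w z h3 _ _ ?_
        filter_upwards [hτ x y z h1 h2, hτ y w z h2 h3, hτ x w z h1 h3] with t e1 e2 e3
        rw [← e3, e1, e2]
        rfl }
  have hcov : IsCoveringMap (Bundle.TotalSpace.proj : Bundle.TotalSpace G Z.Fiber → M) :=
    FiberBundle.isCoveringMap
  obtain ⟨x₀⟩ : Nonempty M := inferInstance
  -- Simple connectedness: the identity of `M` lifts to a section of the covering, that is, to a
  -- coherent choice of germs.
  obtain ⟨s, ⟨-, hs⟩, -⟩ := hcov.existsUnique_continuousMap_lifts (ContinuousMap.id M) x₀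
    ⟨x₀, (1 : G)⟩ rfl
  have hs' : ∀ x, (s x).proj = x := fun x => congrFun hs x
  let γ : M → G := fun x => (s x).2
  -- Read in the trivialization over `U x`, the section is continuous with discrete values, hence
  -- locally constant.
  have key : ∀ x, ∀ᶠ t in 𝓝 x, γ t * τ t x t = γ x * τ x x x := by
    intro x
    have h1 : ContinuousAt (fun t => (Z.localTriv x (s t)).2) x := by
      refine continuous_snd.continuousAt.comp (ContinuousAt.comp ?_ s.continuous.continuousAt)
      refine (Z.localTriv x).continuousAt ?_
      rw [Z.mem_localTriv_source]
      change (s x).proj ∈ U x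
      rw [hs']; exact hxU x
    have h2 : ∀ t, (Z.localTriv x (s t)).2 = γ t * τ t x t := by
      intro t
      change γ t * τ (s t).proj x (s t).proj = _
      rw [hs']
    simp only [h2] at h1
    have := h1.eventually_mem (isOpen_discrete {γ x * τ x x x} |>.mem_nhds rfl)
    simpa using this
  refine ⟨fun x => (γ x : Equiv.Perm V) (φ x x), fun x => ⟨_, (γ x * τ x x x).2, ?_⟩⟩
  filter_upwards [key x, (hU x).mem_nhds (hxU x)] with t ht htU
  rw [← ht]
  have := (hτ t x t (hxU t) htU).self_of_nhds
  rw [this]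
  rfl

/-- Two maps that locally differ by elements of a group of rigid transformations do so globally
on a connected space. -/
theorem exists_forall_eq_of_eventuallyEq [PreconnectedSpace M] [Nonempty M]
    (hG : ∀ g ∈ G, ∀ g' ∈ G, ∀ v, ⇑g =ᶠ[𝓝 v] ⇑g' → g = g') {d d' : M → V}
    (hd : ∀ z, 𝓝 (d z) ≤ map d (𝓝 z))
    (h : ∀ z, ∃ g ∈ G, ∀ᶠ t in 𝓝 z, d' t = g (d t)) : ∃ g ∈ G, ∀ z, d' z = g (d z) := by
  choose g hg h using h
  have hloc : IsLocallyConstant g := by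
    rw [IsLocallyConstant.iff_eventually_eq]
    intro z
    filter_upwards [(h z).eventually_nhds] with t ht
    refine eq_of_eventuallyEq_comp hG (hd t) (hg t) (hg z) ?_
    filter_upwards [h t, ht] with s h1 h2
    rw [← h1, h2]
  obtain ⟨z₀⟩ : Nonempty M := inferInstance
  refine ⟨g z₀, hg z₀, fun z => ?_⟩
  rw [(h z).self_of_nhds, hloc.apply_eq_of_preconnectedSpace z z₀]

end Developing

/-! ### The group of quaternionic affine transformations -/

/-- The linear map `x ↦ x A`. -/
def rowMulCLM (A : Matrix (Fin 2) (Fin 2) ℍ[ℝ]) : H2 →L[ℝ] H2 :=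
  let m := fun c : ℍ[ℝ] => (ContinuousLinearMap.mul ℝ ℍ[ℝ]).flip c
  let f := ContinuousLinearMap.fst ℝ ℍ[ℝ] ℍ[ℝ]
  let s := ContinuousLinearMap.snd ℝ ℍ[ℝ] ℍ[ℝ]
  ((m (A 0 0)).comp f + (m (A 1 0)).comp s).prod ((m (A 0 1)).comp f + (m (A 1 1)).comp s)

theorem rowMulCLM_apply (A : Matrix (Fin 2) (Fin 2) ℍ[ℝ]) (x : H2) :
    rowMulCLM A x = (x.1 * A 0 0 + x.2 * A 1 0, x.1 * A 0 1 + x.2 * A 1 1) := rfl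

theorem affineH2_eq (A : Matrix (Fin 2) (Fin 2) ℍ[ℝ]) (b x : H2) :
    affineH2 A b x = rowMulCLM A x + b := rfl

theorem rowMulCLM_mul (A B : Matrix (Fin 2) (Fin 2) ℍ[ℝ]) (x : H2) :
    rowMulCLM (A * B) x = rowMulCLM B (rowMulCLM A x) := by
  simp only [rowMulCLM_apply, Matrix.mul_apply, Fin.sum_univ_two, mul_add, add_mul, mul_assoc]
  ext1 <;> dsimp only <;> abel

theorem rowMulCLM_one (x : H2) : rowMulCLM 1 x = x := by
  simp [rowMulCLM_apply]

theorem rowMulCLM_smul (A : Matrix (Fin 2) (Fin 2) ℍ[ℝ]) (c : ℍ[ℝ]) (x : H2) :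
    rowMulCLM A (c • x) = c • rowMulCLM A x := by
  simp [rowMulCLM_apply, mul_add, mul_assoc]

/-- The invertible affine transformations of `ℍ²`. -/
def affineGroup : Subgroup (Equiv.Perm H2) where
  carrier := {σ | ∃ (A : (Matrix (Fin 2) (Fin 2) ℍ[ℝ])ˣ) (b : H2), ∀ x, σ x = affineH2 A b x}
  one_mem' := ⟨1, 0, fun x => by simp [affineH2_eq, rowMulCLM_one]⟩
  mul_mem' := by
    rintro σ σ' ⟨A, b, h⟩ ⟨A', b', h'⟩
    refine ⟨A' * A, rowMulCLM A b' + b, fun x => ?_⟩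
    rw [Equiv.Perm.mul_apply, h, h', affineH2_eq, affineH2_eq, affineH2_eq, Units.val_mul,
      rowMulCLM_mul, map_add, add_assoc]
  inv_mem' := by
    rintro σ ⟨A, b, h⟩
    refine ⟨A⁻¹, -rowMulCLM (A⁻¹ : (Matrix (Fin 2) (Fin 2) ℍ[ℝ])ˣ) b, fun x => ?_⟩
    rw [Equiv.Perm.inv_eq_iff_eq, h, affineH2_eq, affineH2_eq, map_add, map_neg, ← rowMulCLM_mul,
      ← rowMulCLM_mul, Units.inv_mul, rowMulCLM_one, rowMulCLM_one, neg_add_cancel_right]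

/-- The affine transformation `x ↦ x A + b` as a bijection. -/
def affinePerm (A : (Matrix (Fin 2) (Fin 2) ℍ[ℝ])ˣ) (b : H2) : Equiv.Perm H2 where
  toFun := affineH2 A b
  invFun x := rowMulCLM (A⁻¹ : (Matrix (Fin 2) (Fin 2) ℍ[ℝ])ˣ) (x - b)
  left_inv x := by
    dsimp only
    rw [affineH2_eq, add_sub_cancel_right, ← rowMulCLM_mul, Units.mul_inv, rowMulCLM_one]
  right_inv x := by
    rw [affineH2_eq, ← rowMulCLM_mul, Units.inv_mul, rowMulCLM_one, sub_add_cancel]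

theorem affinePerm_mem (A : (Matrix (Fin 2) (Fin 2) ℍ[ℝ])ˣ) (b : H2) :
    affinePerm A b ∈ affineGroup := ⟨A, b, fun _ => rfl⟩

theorem affineGroup_rigid (g : Equiv.Perm H2) (hg : g ∈ affineGroup) (g' : Equiv.Perm H2)
    (hg' : g' ∈ affineGroup) (v : H2) (h : ⇑g =ᶠ[𝓝 v] ⇑g') : g = g' := by
  obtain ⟨A, b, h1⟩ := hg
  obtain ⟨A', b', h2⟩ := hg'
  ext1 x
  -- A point `v + t (x - v)` with small `t ≠ 0` lies where the two maps agree; dividing by `t`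
  -- carries the agreement to `x`.
  have hlim : Filter.Tendsto (fun t : ℝ => v + t • (x - v)) (𝓝[≠] 0) (𝓝 v) := by
    have : Continuous fun t : ℝ => v + t • (x - v) := by fun_prop
    have h3 := this.tendsto 0
    rw [zero_smul, add_zero] at h3
    exact h3.mono_left nhdsWithin_le_nhds
  obtain ⟨t, ht, ht0⟩ := ((hlim.eventually h).and self_mem_nhdsWithin).exists
  have h0 := h.self_of_nhds
  rw [h1, h2, affineH2_eq, affineH2_eq] at ht h0
  rw [h1, h2, affineH2_eq, affineH2_eq]
  simp only [map_add, map_smul, map_sub] at ht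
  have e : t • (rowMulCLM (A : Matrix (Fin 2) (Fin 2) ℍ[ℝ]) x -
      rowMulCLM (A : Matrix (Fin 2) (Fin 2) ℍ[ℝ]) v) =
      t • (rowMulCLM (A' : Matrix (Fin 2) (Fin 2) ℍ[ℝ]) x -
        rowMulCLM (A' : Matrix (Fin 2) (Fin 2) ℍ[ℝ]) v) := by
    linear_combination (norm := module) ht - h0
  have e' := smul_right_injective H2 ht0 e
  linear_combination (norm := module) e' + h0

theorem continuous_affineH2 (A : Matrix (Fin 2) (Fin 2) ℍ[ℝ]) (b : H2) :
    Continuous (affineH2 A b) :=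
  (rowMulCLM A).continuous.add continuous_const

theorem affineGroup_map_nhds {g : Equiv.Perm H2} (hg : g ∈ affineGroup) (v : H2) :
    Filter.map g (𝓝 v) = 𝓝 (g v) := by
  have hc : ∀ g ∈ affineGroup, Continuous g := by
    rintro g ⟨A, b, h⟩
    rw [show ⇑g = affineH2 A b from funext h]
    exact continuous_affineH2 A b
  exact (Homeomorph.mk g (hc g hg) (hc g⁻¹ (affineGroup.inv_mem hg))).map_nhds_eq v

instance : LocallyPathConnectedSpace PuncturedH2 :=
  (isOpen_ne (x := (0 : H2))).locallyPathConnectedSpace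

/-! ### The developing map of a slice regular affine structure -/

section HopfDeveloping

variable {p : ℕ} {α β l : ℍ[ℝ]} {hp : p ≠ 0} {hα : 0 < ‖α‖} {hβ : 0 < ‖β‖}

/-- A slice regular affine structure on the quotient has a developing map that is slice regular,
locally injective, and equivariant. -/
theorem exists_hopf_developingMap (hcase : HopfCaseA p α β l ∨ HopfCaseB p α β l)
    (hαβ : ‖α‖ ≤ ‖β‖) (hβ1 : ‖β‖ < 1)
    (h : AdmitsSliceRegularAffineCharts (hopfAtlas p α β l hp hα hβ)) :
    ∃ dev : H2 → H2, (∀ x ≠ 0, SliceRegularAt dev x) ∧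
      (∀ x ≠ 0, ∃ U ∈ 𝓝 x, Set.InjOn dev U) ∧
      ∃ (A : (Matrix (Fin 2) (Fin 2) ℍ[ℝ])ˣ) (b : H2), ∀ x ≠ 0,
        dev (hopfMap p α β l x) = affineH2 A b (dev x) := by
  classical
  obtain ⟨ℬ, hℬ, hreg⟩ := h
  have hcov := isQuotientCoveringMap_hopfProj (hp := hp) (hα := hα) (hβ := hβ) hcase hαβ hβ1
  set π := hopfProj p α β l hp hα hβ with hπ
  have hπc : Continuous π := hcov.isCoveringMap.continuous
  have hπn : ∀ z, Filter.map π (𝓝 z) = 𝓝 (π z) :=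
    hcov.isCoveringMap.isLocalHomeomorph.map_nhds_eq
  choose e he hes using fun x => hℬ.covers (π x)
  have hφ : ∀ x z, π z ∈ (e x).source →
      Filter.map (fun t => e x (π t)) (𝓝 z) = 𝓝 (e x (π z)) := by
    intro x z hz
    rw [← (e x).map_nhds_eq hz, ← hπn, Filter.map_map]
    rfl
  have htrans : ∀ x y z, π z ∈ (e x).source → π z ∈ (e y).source →
      ∃ g ∈ affineGroup, ∀ᶠ t in 𝓝 z, e x (π t) = g (e y (π t)) := by
    intro x y z hx hy
    have hsrc : e y (π z) ∈ ((e y).symm.trans (e x)).source := by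
      rw [OpenPartialHomeomorph.trans_source]
      refine ⟨(e y).map_source hy, ?_⟩
      change (e y).symm (e y (π z)) ∈ (e x).source
      rwa [(e y).left_inv hy]
    obtain ⟨A, b, hAb⟩ := hℬ.affine (e y) (he y) (e x) (he x) _ hsrc
    refine ⟨affinePerm A b, affinePerm_mem A b, ?_⟩
    have h1 : ∀ᶠ t in 𝓝 z, ((e y).symm.trans (e x)) (e y (π t)) = affineH2 A b (e y (π t)) :=
      (le_of_eq (hφ y z hy)) hAb
    have h2 : ∀ᶠ t in 𝓝 z, π t ∈ (e y).source :=
      hπc.continuousAt.eventually_mem ((e y).open_source.mem_nhds hy)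
    filter_upwards [h1, h2] with t ht ht'
    rw [OpenPartialHomeomorph.coe_trans, Function.comp_apply, (e y).left_inv ht'] at ht
    exact ht
  obtain ⟨d, hd⟩ := exists_developingMap affineGroup_rigid (fun x => π ⁻¹' (e x).source)
    (fun x => (e x).open_source.preimage hπc) hes (fun x z => e x (π z))
    (fun x z hz => (hφ x z hz).ge) htrans
  have hdn : ∀ z, Filter.map d (𝓝 z) = 𝓝 (d z) := by
    intro z
    obtain ⟨g, hg, h1⟩ := hd z
    rw [Filter.map_congr h1, h1.self_of_nhds, ← affineGroup_map_nhds hg, ← hφ z z (hes z),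
      Filter.map_map]
    rfl
  set f := hopfPerm p α β l hp hα hβ with hf
  have hfc : Continuous f := by
    have := hopfGroup_continuousConstSMul (hp := hp) (hα := hα) (hβ := hβ) hcase
    exact continuous_const_smul (⟨f, Subgroup.mem_zpowers f⟩ : hopfGroup p α β l hp hα hβ)
  have hfπ : ∀ x, π (f x) = π x := fun x =>
    hopfProj_eq_iff.mpr ⟨f, Subgroup.mem_zpowers f, rfl⟩
  -- `d` and `d ∘ f` develop the same structure because `π ∘ f = π`; they differ locally by affine
  -- maps, hence by a single one. This is the holonomy of `f`.
  obtain ⟨σ, ⟨A, b, hσ⟩, hσd⟩ := exists_forall_eq_of_eventuallyEq affineGroup_rigid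
    (d := d) (d' := fun x => d (f x)) (fun z => (hdn z).ge) (by
      intro z
      obtain ⟨g, hg, h1⟩ := hd z
      obtain ⟨g', hg', h2⟩ := hd (f z)
      obtain ⟨g'', hg'', h3⟩ := htrans (f z) z z (by rw [← hfπ]; exact hes (f z)) (hes z)
      refine ⟨g' * g'' * g⁻¹, mul_mem (mul_mem hg' hg'') (inv_mem hg), ?_⟩
      filter_upwards [h1, hfc.continuousAt.eventually h2, h3] with t e1 e2 e3
      rw [e2, hfπ, e3, e1]
      simp)
  -- The value `0` at the origin is arbitrary: every assertion concerns nonzero points only.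
  refine ⟨fun y => if h : y ≠ 0 then d ⟨y, h⟩ else 0, fun x hx => ?_, fun x hx => ?_,
    A, b, fun x hx => ?_⟩
  · obtain ⟨g, ⟨A', b', hg⟩, h1⟩ := hd ⟨x, hx⟩
    obtain ⟨c, hc, hxc, hxc'⟩ :=
      exists_hopfAtlas_chart (hp := hp) (hα := hα) (hβ := hβ) hcase hαβ hβ1 ⟨x, hx⟩
    have hsy : ∀ y ∈ c.target, ∃ hy : y ≠ 0, c.symm y = π ⟨y, hy⟩ := hc.2
    have hsrc : x ∈ (c.symm.trans (e ⟨x, hx⟩)).source := by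
      rw [OpenPartialHomeomorph.trans_source]
      refine ⟨hxc, ?_⟩
      change c.symm x ∈ (e ⟨x, hx⟩).source
      obtain ⟨_, h2⟩ := hsy x hxc
      rw [h2]
      exact hes ⟨x, hx⟩
    refine ((hreg c hc _ (he ⟨x, hx⟩) x hsrc).affine A' b').congr ?_
    have h2 : ∀ᶠ y in 𝓝 x, y ∈ c.target := c.open_target.mem_nhds hxc
    have h3 : ∀ᶠ y in 𝓝 x, ∀ hy : y ≠ 0, d ⟨y, hy⟩ = g (e ⟨x, hx⟩ (π ⟨y, hy⟩)) :=
      eventually_nhds_punctured (x := ⟨x, hx⟩) h1 fun y hy _ => hy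
    filter_upwards [h2, h3] with y hy hy'
    obtain ⟨hy0, h4⟩ := hsy y hy
    rw [dif_pos hy0, hy' hy0, hg, OpenPartialHomeomorph.coe_trans, Function.comp_apply, h4]
  · obtain ⟨g, hg, h1⟩ := hd ⟨x, hx⟩
    obtain ⟨c, hc, hc'⟩ := hcov.isCoveringMap.isLocalHomeomorph ⟨x, hx⟩
    have h2 : ∀ᶠ y in 𝓝 (⟨x, hx⟩ : PuncturedH2), y ∈ c.source := c.open_source.mem_nhds hc
    have h3 : ∀ᶠ y in 𝓝 (⟨x, hx⟩ : PuncturedH2), π y ∈ (e ⟨x, hx⟩).source :=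
      hπc.continuousAt.eventually_mem ((e _).open_source.mem_nhds (hes _))
    refine ⟨_, eventually_nhds_punctured (Q := fun y => ∃ hy : y ≠ 0,
      d ⟨y, hy⟩ = g (e ⟨x, hx⟩ (π ⟨y, hy⟩)) ∧ (⟨y, hy⟩ : PuncturedH2) ∈ c.source ∧
        π ⟨y, hy⟩ ∈ (e ⟨x, hx⟩).source) ((h1.and h2).and h3)
      fun y hy => ⟨y.2, hy.1.1, hy.1.2, hy.2⟩, ?_⟩
    rintro y ⟨hy, a1, a2, a3⟩ z ⟨hz, b1, b2, b3⟩ hyz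
    dsimp only at hyz
    rw [dif_pos hy, dif_pos hz, a1, b1] at hyz
    have h4 := (e ⟨x, hx⟩).injOn a3 b3 (g.injective hyz)
    rw [hc'] at h4
    exact congrArg Subtype.val (c.injOn a2 b2 h4)
  · have := hσd ⟨x, hx⟩
    rw [hσ] at this
    dsimp only
    rw [dif_pos hx, ← this]
    exact dif_pos (f ⟨x, hx⟩).2

end HopfDeveloping

/-! ### Restriction to complex slices -/

theorem exists_conj_unitI {J : ℍ[ℝ]} (hJ : J ∈ imagUnits) : ∃ s : ℍ[ℝ], s ≠ 0 ∧ s * J = unitI * s := by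
  have hJ' : J * J = -1 := hJ
  have hI : unitI * unitI = -1 := unitI_mem
  by_cases h : unitI * J = 1
  · refine ⟨unitJ, ?_, ?_⟩
    · intro h0
      have := congrArg QuaternionAlgebra.imJ h0
      simp [unitJ] at this
    · have e : J = -unitI := by
        have := congrArg (unitI * ·) h
        simp only [← mul_assoc, hI] at this
        simpa [neg_eq_iff_eq_neg] using this
      rw [e]
      ext <;>
        simp only [Quaternion.re_mul, Quaternion.imI_mul, Quaternion.imJ_mul, Quaternion.imK_mul,
          Quaternion.re_neg, Quaternion.imI_neg, Quaternion.imJ_neg, Quaternion.imK_neg] <;>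
        simp [unitI, unitJ]
  -- Both `(1 - iJ) J` and `i (1 - iJ)` equal `i + J`. This conjugator vanishes only when `J = -i`,
  -- where `j` was used instead.
  · refine ⟨1 - unitI * J, sub_ne_zero.mpr (Ne.symm h), ?_⟩
    rw [sub_mul, mul_sub, mul_assoc, hJ', ← mul_assoc, hI]
    simp [add_comm]

/-- The coordinates `q = u + v j`, `u, v ∈ ℂ`, of a quaternion. -/
def quaternionEquivComplex : ℍ[ℝ] ≃ₗ[ℝ] ℂ × ℂ where
  toFun q := (⟨q.re, q.imI⟩, ⟨q.imJ, q.imK⟩)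
  invFun v := ⟨v.1.re, v.1.im, v.2.re, v.2.im⟩
  map_add' q r := by apply Prod.ext <;> apply Complex.ext <;> simp
  map_smul' c q := by apply Prod.ext <;> apply Complex.ext <;> simp
  left_inv q := rfl
  right_inv v := rfl

theorem quaternionEquivComplex_unitI_mul (q : ℍ[ℝ]) :
    quaternionEquivComplex (unitI * q) = Complex.I • quaternionEquivComplex q := by
  change ((⟨_, _⟩, ⟨_, _⟩) : ℂ × ℂ) = Complex.I • ((⟨_, _⟩, ⟨_, _⟩) : ℂ × ℂ)
  apply Prod.ext <;> apply Complex.ext <;>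
    simp only [Quaternion.re_mul, Quaternion.imI_mul, Quaternion.imJ_mul, Quaternion.imK_mul] <;>
    simp [unitI]

/-- `ℍ` is a complex plane for the complex structure given by left multiplication by `J`. -/
theorem exists_equiv_complex {J : ℍ[ℝ]} (hJ : J ∈ imagUnits) :
    ∃ T : ℍ[ℝ] ≃L[ℝ] ℂ × ℂ, ∀ q, T (J * q) = Complex.I • T q := by
  obtain ⟨s, hs, h⟩ := exists_conj_unitI hJ
  let L : ℍ[ℝ] ≃ₗ[ℝ] ℍ[ℝ] :=
    { toFun := fun q => s * q
      invFun := fun q => s⁻¹ * q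
      map_add' := fun q r => mul_add _ _ _
      map_smul' := fun c q => by simp
      left_inv := fun q => by simp [hs]
      right_inv := fun q => by simp [hs] }
  refine ⟨(L.trans quaternionEquivComplex).toContinuousLinearEquiv, fun q => ?_⟩
  change quaternionEquivComplex (s * (J * q)) = Complex.I • quaternionEquivComplex (s * q)
  rw [← quaternionEquivComplex_unitI_mul, ← mul_assoc, h, mul_assoc]

theorem map_sliceEmb_mul {J : ℍ[ℝ]} {T : ℍ[ℝ] ≃L[ℝ] ℂ × ℂ}
    (hT : ∀ q, T (J * q) = Complex.I • T q) (z : ℂ) (q : ℍ[ℝ]) :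
    T (sliceEmb J z * q) = z • T q := by
  rw [sliceEmb, add_mul, map_add, smul_mul_assoc, map_smul, hT, Quaternion.coe_mul_eq_smul, map_smul]
  conv_rhs => rw [← Complex.re_add_im z]
  rw [add_smul, mul_smul, Complex.coe_smul, Complex.coe_smul]

/-- The value `F₀ + J F₁ + J F₂ + J J F₁₂` of a stem on the slice of `J`. -/
def stemEval (J : ℍ[ℝ]) : StemSpace →L[ℝ] ℍ[ℝ] :=
  let m := ContinuousLinearMap.mul ℝ ℍ[ℝ]
  (ContinuousLinearMap.id ℝ ℍ[ℝ]).coprod ((m J).coprod ((m J).coprod (m (J * J))))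

theorem stemEval_apply (J : ℍ[ℝ]) (v : StemSpace) :
    stemEval J v = v.1 + J * v.2.1 + J * v.2.2.1 + J * J * v.2.2.2 := by
  simp [stemEval, add_assoc]

theorem stemEval_e1Left {J : ℍ[ℝ]} (hJ : J ∈ imagUnits) (v : StemSpace) :
    stemEval J (e1Left v) = J * stemEval J v := by
  have hJ' : J * J = -1 := hJ
  simp only [stemEval_apply, e1Left, mul_add, ← mul_assoc, hJ']
  simp
  abel

/-- Although `e₂` acts on the right, it also becomes left multiplication by `J` once both variables
carry the same unit. Hence stems are jointly holomorphic on the slice of `J`. -/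
theorem stemEval_e2Right {J : ℍ[ℝ]} (hJ : J ∈ imagUnits) (v : StemSpace) :
    stemEval J (e2Right v) = J * stemEval J v := by
  have hJ' : J * J = -1 := hJ
  simp only [stemEval_apply, e2Right, mul_add, ← mul_assoc, hJ']
  simp
  abel

theorem IsHolomorphicStem.differentiableAt_stemEval {D : Set (ℂ × ℂ)} {F : ℂ × ℂ → StemSpace}
    (hF : IsHolomorphicStem D F) {J : ℍ[ℝ]} (hJ : J ∈ imagUnits) {T : ℍ[ℝ] ≃L[ℝ] ℂ × ℂ}
    (hT : ∀ q, T (J * q) = Complex.I • T q) {z : ℂ × ℂ} (hz : z ∈ D) :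
    DifferentiableAt ℂ (fun z => T (stemEval J (F z))) z := by
  set M : ℂ × ℂ →L[ℝ] ℂ × ℂ :=
    (T : ℍ[ℝ] →L[ℝ] ℂ × ℂ).comp ((stemEval J).comp (fderiv ℝ F z)) with hM
  have hd : HasFDerivAt (fun z => T (stemEval J (F z))) M z :=
    (T : ℍ[ℝ] →L[ℝ] ℂ × ℂ).hasFDerivAt.comp z
      ((stemEval J).hasFDerivAt.comp z (hF.differentiableAt hz).hasFDerivAt)
  have h1 : M (Complex.I, 0) = Complex.I • M (1, 0) := by
    have := congrArg (fun v => T (stemEval J v)) (hF.dbar₁ z hz)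
    simp only [map_add, stemEval_e1Left hJ, hT, map_zero] at this
    rw [add_eq_zero_iff_eq_neg] at this
    change T (stemEval J (fderiv ℝ F z (Complex.I, 0))) =
      Complex.I • T (stemEval J (fderiv ℝ F z (1, 0)))
    rw [this, smul_neg, smul_smul, Complex.I_mul_I, neg_one_smul, neg_neg]
  have h2 : M (0, Complex.I) = Complex.I • M (0, 1) := by
    have := congrArg (fun v => T (stemEval J v)) (hF.dbar₂ z hz)
    simp only [map_add, stemEval_e2Right hJ, hT, map_zero] at this
    rw [add_eq_zero_iff_eq_neg] at this
    change T (stemEval J (fderiv ℝ F z (0, Complex.I))) =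
      Complex.I • T (stemEval J (fderiv ℝ F z (0, 1)))
    rw [this, smul_neg, smul_smul, Complex.I_mul_I, neg_one_smul, neg_neg]
  set N : ℂ × ℂ →L[ℂ] ℂ × ℂ := (ContinuousLinearMap.fst ℂ ℂ ℂ).smulRight (M (1, 0)) +
    (ContinuousLinearMap.snd ℂ ℂ ℂ).smulRight (M (0, 1)) with hN
  -- The two relations say that the real derivative commutes with `i` in each variable, so it equals
  -- the complex linear map `N`.
  refine (hasFDerivAt_of_restrictScalars ℝ hd (f' := N) ?_).differentiableAt
  refine ContinuousLinearMap.ext fun v => ?_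
  have hv : v = v.1.re • ((1, 0) : ℂ × ℂ) + v.1.im • ((Complex.I, 0) : ℂ × ℂ) +
      v.2.re • ((0, 1) : ℂ × ℂ) + v.2.im • ((0, Complex.I) : ℂ × ℂ) := by
    ext <;> simp
  have hMv : M v = v.1.re • M (1, 0) + v.1.im • M (Complex.I, 0) + v.2.re • M (0, 1) +
      v.2.im • M (0, Complex.I) := by
    conv_lhs => rw [hv]
    simp only [map_add, map_smul]
  rw [hMv, h1, h2]
  have e1 : v.1 • M (1, 0) = v.1.re • M (1, 0) + v.1.im • Complex.I • M (1, 0) := by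
    conv_lhs => rw [← Complex.re_add_im v.1]
    rw [add_smul, mul_smul, Complex.coe_smul, Complex.coe_smul]
  have e2 : v.2 • M (0, 1) = v.2.re • M (0, 1) + v.2.im • Complex.I • M (0, 1) := by
    conv_lhs => rw [← Complex.re_add_im v.2]
    rw [add_smul, mul_smul, Complex.coe_smul, Complex.coe_smul]
  change v.1 • M (1, 0) + v.2 • M (0, 1) = _
  rw [e1, e2]
  abel

/-- The point of `ℍ²` with coordinates `z` in the slice of `J`. -/
def slicePt (J : ℍ[ℝ]) (z : ℂ × ℂ) : H2 := (sliceEmb J z.1, sliceEmb J z.2)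

theorem continuous_slicePt (J : ℍ[ℝ]) : Continuous (slicePt J) := by
  have := continuous_sliceEmb
  unfold slicePt
  fun_prop

theorem slicePt_ne_zero {J : ℍ[ℝ]} (hJ : J ∈ imagUnits) {z : ℂ × ℂ} (hz : z ≠ 0) :
    slicePt J z ≠ 0 := by
  intro h
  refine hz (Prod.ext ?_ ?_)
  · exact sliceEmb_injective hJ (by simpa [slicePt] using congrArg Prod.fst h)
  · exact sliceEmb_injective hJ (by simpa [slicePt] using congrArg Prod.snd h)

theorem SliceRegularOnCircular.differentiableAt_slice {g : H2 → ℍ[ℝ]} {Ω : Set H2}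
    (hg : SliceRegularOnCircular g Ω) {J : ℍ[ℝ]} (hJ : J ∈ imagUnits) {T : ℍ[ℝ] ≃L[ℝ] ℂ × ℂ}
    (hT : ∀ q, T (J * q) = Complex.I • T q) {z : ℂ × ℂ} (hz : slicePt J z ∈ Ω) :
    DifferentiableAt ℂ (fun z => T (g (slicePt J z))) z := by
  obtain ⟨D, F, hF, rfl, h⟩ := hg
  have hzD : z ∈ D := (sliceEmb_mem_circularization hF.conjInvariant hJ hJ z).mp hz
  refine (hF.differentiableAt_stemEval hJ hT hzD).congr_of_eventuallyEq ?_
  filter_upwards [hF.isOpen.mem_nhds hzD] with w hw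
  rw [slicePt, h w hw J hJ J hJ, stemEval_apply]

theorem SliceRegularAt.differentiableAt_slice {g : H2 → H2} {J : ℍ[ℝ]} (hJ : J ∈ imagUnits)
    {T : ℍ[ℝ] ≃L[ℝ] ℂ × ℂ} (hT : ∀ q, T (J * q) = Complex.I • T q) {z : ℂ × ℂ}
    (hg : SliceRegularAt g (slicePt J z)) :
    DifferentiableAt ℂ (fun z => (T (g (slicePt J z)).1, T (g (slicePt J z)).2)) z := by
  obtain ⟨Ω, G, hx, h1, h2, h⟩ := hg
  refine ((h1.differentiableAt_slice hJ hT hx).prodMk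
    (h2.differentiableAt_slice hJ hT hx)).congr_of_eventuallyEq ?_
  filter_upwards [(continuous_slicePt J).continuousAt.eventually h] with w hw
  rw [hw]

/-! ### The identity theorem for slice regular maps -/

/-- Subtracting the values at two distinct units leaves a product with their nonzero difference,
which cancels in the division ring; doing so in each slot isolates the four components. -/
theorem stem_eq_zero_of_forall_mem {v : StemSpace} {I₁ J₁ I₂ J₂ : ℍ[ℝ]} (h₁ : I₁ ≠ J₁)
    (h₂ : I₂ ≠ J₂)
    (h : ∀ K₁ ∈ ({I₁, J₁} : Set ℍ[ℝ]), ∀ K₂ ∈ ({I₂, J₂} : Set ℍ[ℝ]),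
      v.1 + K₁ * v.2.1 + K₂ * v.2.2.1 + K₁ * K₂ * v.2.2.2 = 0) : v = 0 := by
  have a := h I₁ (by simp) I₂ (by simp)
  have b := h J₁ (by simp) I₂ (by simp)
  have c := h I₁ (by simp) J₂ (by simp)
  have d := h J₁ (by simp) J₂ (by simp)
  have e1 : v.2.1 + I₂ * v.2.2.2 = 0 := by
    have : (I₁ - J₁) * (v.2.1 + I₂ * v.2.2.2) = 0 := by
      linear_combination (norm := noncomm_ring) a - b
    exact (mul_eq_zero.mp this).resolve_left (sub_ne_zero.mpr h₁)
  have e2 : v.2.1 + J₂ * v.2.2.2 = 0 := by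
    have : (I₁ - J₁) * (v.2.1 + J₂ * v.2.2.2) = 0 := by
      linear_combination (norm := noncomm_ring) c - d
    exact (mul_eq_zero.mp this).resolve_left (sub_ne_zero.mpr h₁)
  have e3 : v.2.2.2 = 0 := by
    have : (I₂ - J₂) * v.2.2.2 = 0 := by
      linear_combination (norm := noncomm_ring) e1 - e2
    exact (mul_eq_zero.mp this).resolve_left (sub_ne_zero.mpr h₂)
  have e4 : v.2.1 = 0 := by simpa [e3] using e1
  rw [e3, e4] at a c
  have e5 : v.2.2.1 = 0 := by
    have : (I₂ - J₂) * v.2.2.1 = 0 := by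
      linear_combination (norm := noncomm_ring) a - c
    exact (mul_eq_zero.mp this).resolve_left (sub_ne_zero.mpr h₂)
  have e6 : v.1 = 0 := by simpa [e5] using a
  exact Prod.ext e6 (Prod.ext e4 (Prod.ext e5 e3))

theorem exists_not_commute_of_mem_imagUnits {J : ℍ[ℝ]} (hJ : J ∈ imagUnits) :
    ∃ u : ℍ[ℝ], u * J ≠ J * u := by
  by_contra! h
  have h1 := congrArg QuaternionAlgebra.imK (h unitI)
  have h2 := congrArg QuaternionAlgebra.imJ (h unitI)
  have h3 := congrArg QuaternionAlgebra.imK (h unitJ)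
  simp only [Quaternion.imJ_mul, Quaternion.imK_mul] at h1 h2 h3
  simp [unitI, unitJ] at h1 h2 h3
  have e0 := imagUnits_re hJ
  have : J = 0 := by
    apply Quaternion.ext
    · exact e0
    · simp; linarith
    · simp; linarith
    · simp; linarith
  have hn := imagUnits_norm hJ
  simp [this] at hn

theorem exists_imagUnit_ne_of_mem_nhds {J : ℍ[ℝ]} (hJ : J ∈ imagUnits) {s : Set ℍ[ℝ]}
    (hs : s ∈ 𝓝 J) : ∃ K ∈ imagUnits, K ∈ s ∧ K ≠ J := by
  have hJ' : J * J = -1 := hJ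
  obtain ⟨u, hu⟩ := exists_not_commute_of_mem_imagUnits hJ
  -- Conjugating `J` by `1 + t u`, with `u` not commuting with `J`, moves it slightly within the
  -- sphere of units.
  set q : ℝ → ℍ[ℝ] := fun t => 1 + t • u with hq
  have hqc : Continuous q := by fun_prop
  have hq0 : q 0 = 1 := by simp [hq]
  have h1 : ∀ᶠ t in 𝓝 (0 : ℝ), q t ≠ 0 :=
    hqc.continuousAt.eventually_ne (by rw [hq0]; exact one_ne_zero)
  have hc : ContinuousAt (fun t => q t * J * (q t)⁻¹) 0 :=
    (hqc.continuousAt.mul continuousAt_const).mul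
      (hqc.continuousAt.inv₀ (by rw [hq0]; exact one_ne_zero))
  have h2 : ∀ᶠ t in 𝓝 (0 : ℝ), q t * J * (q t)⁻¹ ∈ s :=
    hc.eventually_mem (by rw [hq0]; simpa using hs)
  have h3 : ∀ᶠ t in 𝓝[≠] (0 : ℝ), (q t ≠ 0 ∧ q t * J * (q t)⁻¹ ∈ s) :=
    (h1.and h2).filter_mono nhdsWithin_le_nhds
  obtain ⟨t, ⟨ht1, ht2⟩, ht0⟩ := (h3.and self_mem_nhdsWithin).exists
  refine ⟨_, ?_, ht2, ?_⟩
  · change q t * J * (q t)⁻¹ * (q t * J * (q t)⁻¹) = -1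
    calc _ = q t * J * ((q t)⁻¹ * q t) * J * (q t)⁻¹ := by simp only [mul_assoc]
      _ = q t * (J * J) * (q t)⁻¹ := by rw [inv_mul_cancel₀ ht1, mul_one, mul_assoc (q t)]
      _ = -1 := by rw [hJ']; simp [ht1]
  · intro h
    rw [mul_inv_eq_iff_eq_mul₀ ht1] at h
    simp only [hq, add_mul, mul_add, one_mul, mul_one, add_right_inj, smul_mul_assoc,
      mul_smul_comm] at h
    exact hu (smul_right_injective _ ht0 h)

/-- One-variable identity theorem on the complex line through `u` and `z`; its trace on the ball is
convex, hence connected. -/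
theorem IsHolomorphicStem.stemEval_eq_zero {D : Set (ℂ × ℂ)} {F : ℂ × ℂ → StemSpace}
    (hF : IsHolomorphicStem D F) {J : ℍ[ℝ]} (hJ : J ∈ imagUnits) {z₀ u z : ℂ × ℂ} {ε : ℝ}
    (hball : Metric.ball z₀ ε ⊆ D) (hu : u ∈ Metric.ball z₀ ε) (hz : z ∈ Metric.ball z₀ ε)
    (h : ∀ᶠ w in 𝓝 u, F w = 0) : stemEval J (F z) = 0 := by
  obtain ⟨T, hT⟩ := exists_equiv_complex hJ
  set ℓ : ℂ → ℂ × ℂ := fun t => u + t • (z - u) with hℓ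
  have hℓc : Continuous ℓ := by fun_prop
  have hℓd : Differentiable ℂ ℓ := by fun_prop
  have hS : Convex ℝ (ℓ ⁻¹' Metric.ball z₀ ε) := by
    intro a ha b hb s t hs ht hst
    have e : ℓ (s • a + t • b) = s • ℓ a + t • ℓ b := by
      have : u = s • u + t • u := by rw [← add_smul, hst, one_smul]
      simp only [hℓ, smul_add, add_smul, smul_assoc]
      rw [add_add_add_comm, ← this]
    rw [Set.mem_preimage, e]
    exact convex_ball z₀ ε ha hb hs ht hst
  have hd : DifferentiableOn ℂ (fun t => T (stemEval J (F (ℓ t)))) (ℓ ⁻¹' Metric.ball z₀ ε) :=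
    fun w hw => ((hF.differentiableAt_stemEval hJ hT (hball hw)).comp w
      (hℓd w)).differentiableWithinAt
  have h0 : ℓ 0 = u := by simp [hℓ]
  have h1 : ℓ 1 = z := by simp [hℓ]
  have han := hd.analyticOnNhd (Metric.isOpen_ball.preimage hℓc)
  have := han.eqOn_zero_of_preconnected_of_eventuallyEq_zero hS.isPreconnected
    (z₀ := 0) (by rw [Set.mem_preimage, h0]; exact hu) (by
      rw [← h0] at h
      filter_upwards [hℓc.continuousAt.eventually h] with w hw
      simp [hw]) (show (1 : ℂ) ∈ _ by rw [Set.mem_preimage, h1]; exact hz)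
  simpa [h1] using this

/-- Values of a stem on the four slices `(± J, ± J)`, in terms of the conjugate points. -/
theorem IsHolomorphicStem.eq_zero_of_stemEval {D : Set (ℂ × ℂ)} {F : ℂ × ℂ → StemSpace}
    (hF : IsHolomorphicStem D F) {J : ℍ[ℝ]} (hJ : J ∈ imagUnits) {z : ℂ × ℂ} (hz : z ∈ D)
    (h1 : stemEval J (F z) = 0) (h2 : stemEval J (F (star z.1, z.2)) = 0)
    (h3 : stemEval J (F (z.1, star z.2)) = 0)
    (h4 : stemEval J (F (star z.1, star z.2)) = 0) : F z = 0 := by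
  have hne : J ≠ -J := by
    intro h
    have h0 : J = 0 := by
      have h2 : (2 : ℝ) • J = 0 := by
        rw [two_smul]
        nth_rewrite 1 [h]
        exact neg_add_cancel J
      simpa using h2
    have := imagUnits_norm hJ
    simp [h0] at this
  have p4 := hF.parity₂ _ (hF.conjInvariant z hz).1
  dsimp only at p4
  rw [p4, hF.parity₁ z hz] at h4
  rw [hF.parity₁ z hz] at h2
  rw [hF.parity₂ z hz] at h3
  rw [stemEval_apply] at h1 h2 h3 h4
  refine stem_eq_zero_of_forall_mem hne hne fun K₁ hK₁ K₂ hK₂ => ?_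
  rcases hK₁ with rfl | rfl <;> rcases hK₂ with rfl | rfl
  · exact h1
  · linear_combination (norm := (dsimp only; noncomm_ring)) h3
  · linear_combination (norm := (dsimp only; noncomm_ring)) h2
  · linear_combination (norm := (dsimp only; noncomm_ring)) h4

theorem dist_star_left (z w : ℂ × ℂ) : dist (star z.1, z.2) (star w.1, w.2) = dist z w := by
  simp [Prod.dist_eq, Complex.dist_conj_conj]

theorem dist_star_right (z w : ℂ × ℂ) : dist (z.1, star z.2) (w.1, star w.2) = dist z w := by
  simp [Prod.dist_eq, Complex.dist_conj_conj]

theorem IsHolomorphicStem.eq_zero_of_eventually {D : Set (ℂ × ℂ)} {F : ℂ × ℂ → StemSpace}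
    (hF : IsHolomorphicStem D F) {z₀ u z : ℂ × ℂ} {ε : ℝ}
    (hball : Metric.ball z₀ ε ⊆ D) (hu : u ∈ Metric.ball z₀ ε) (hz : z ∈ Metric.ball z₀ ε)
    (h : ∀ᶠ w in 𝓝 u, F w = 0) : F z = 0 := by
  set c₁ : ℂ × ℂ → ℂ × ℂ := fun z => (star z.1, z.2) with hc₁
  set c₂ : ℂ × ℂ → ℂ × ℂ := fun z => (z.1, star z.2) with hc₂
  have hcc₁ : Continuous c₁ := by fun_prop
  have hcc₂ : Continuous c₂ := by fun_prop
  have i₁ : ∀ z, c₁ (c₁ z) = z := fun z => by simp [hc₁]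
  have i₂ : ∀ z, c₂ (c₂ z) = z := fun z => by simp [hc₂]
  have b₁ : ∀ z w : ℂ × ℂ, z ∈ Metric.ball w ε → c₁ z ∈ Metric.ball (c₁ w) ε := fun z w hz => by
    rw [Metric.mem_ball, hc₁, dist_star_left]; exact hz
  have b₂ : ∀ z w : ℂ × ℂ, z ∈ Metric.ball w ε → c₂ z ∈ Metric.ball (c₂ w) ε := fun z w hz => by
    rw [Metric.mem_ball, hc₂, dist_star_right]; exact hz
  have d₁ : ∀ w, Metric.ball w ε ⊆ D → Metric.ball (c₁ w) ε ⊆ D := fun w hw z hz => by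
    have := hw (by simpa [i₁] using b₁ z _ hz)
    rw [← i₁ z]
    exact (hF.conjInvariant _ this).1
  have d₂ : ∀ w, Metric.ball w ε ⊆ D → Metric.ball (c₂ w) ε ⊆ D := fun w hw z hz => by
    have := hw (by simpa [i₂] using b₂ z _ hz)
    rw [← i₂ z]
    exact (hF.conjInvariant _ this).2
  have e₁ : ∀ w, w ∈ D → (∀ᶠ w in 𝓝 w, F w = 0) → ∀ᶠ w in 𝓝 (c₁ w), F w = 0 := fun w hw h => by
    rw [← i₁ w] at h hw
    filter_upwards [hcc₁.continuousAt.eventually h, hcc₁.continuousAt.eventually_mem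
      (hF.isOpen.mem_nhds hw)] with t ht htD
    rw [← i₁ t, hF.parity₁ _ htD, ht]
    simp
  have e₂ : ∀ w, w ∈ D → (∀ᶠ w in 𝓝 w, F w = 0) → ∀ᶠ w in 𝓝 (c₂ w), F w = 0 := fun w hw h => by
    rw [← i₂ w] at h hw
    filter_upwards [hcc₂.continuousAt.eventually h, hcc₂.continuousAt.eventually_mem
      (hF.isOpen.mem_nhds hw)] with t ht htD
    rw [← i₂ t, hF.parity₂ _ htD, ht]
    simp
  -- The four sign choices of units correspond to the four conjugate balls, and parity carries the
  -- vanishing near `u` into each of them.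
  refine hF.eq_zero_of_stemEval unitI_mem (hball hz) ?_ ?_ ?_ ?_
  · exact hF.stemEval_eq_zero unitI_mem hball hu hz h
  · exact hF.stemEval_eq_zero unitI_mem (d₁ _ hball) (b₁ _ _ hu) (b₁ _ _ hz) (e₁ _ (hball hu) h)
  · exact hF.stemEval_eq_zero unitI_mem (d₂ _ hball) (b₂ _ _ hu) (b₂ _ _ hz) (e₂ _ (hball hu) h)
  · exact hF.stemEval_eq_zero unitI_mem (d₂ _ (d₁ _ hball)) (b₂ _ _ (b₁ _ _ hu))
      (b₂ _ _ (b₁ _ _ hz)) (e₂ _ (hF.conjInvariant _ (hball hu)).1 (e₁ _ (hball hu) h))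

theorem SliceRegularOnCircular.eventually_eq_zero_of_stem {D : Set (ℂ × ℂ)}
    {F : ℂ × ℂ → StemSpace} {g : H2 → ℍ[ℝ]}
    (h : ∀ z ∈ D, ∀ J₁ ∈ imagUnits, ∀ J₂ ∈ imagUnits,
      g (sliceEmb J₁ z.1, sliceEmb J₂ z.2) =
        (F z).1 + J₁ * (F z).2.1 + J₂ * (F z).2.2.1 + J₁ * J₂ * (F z).2.2.2) {x : H2}
    (hF : ∀ᶠ z in 𝓝 (sliceCoord x.1, sliceCoord x.2), z ∈ D ∧ F z = 0) :
    ∀ᶠ y in 𝓝 x, g y = 0 := by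
  have hc : Continuous fun y : H2 => (sliceCoord y.1, sliceCoord y.2) := by
    have := continuous_sliceCoord
    fun_prop
  filter_upwards [hc.continuousAt.eventually hF] with y hy
  obtain ⟨J₁, h₁, e₁⟩ := exists_sliceEmb_sliceCoord y.1
  obtain ⟨J₂, h₂, e₂⟩ := exists_sliceEmb_sliceCoord y.2
  have := h _ hy.1 J₁ h₁ J₂ h₂
  dsimp only at this
  rw [← e₁, ← e₂, hy.2] at this
  simpa using this

/-- The local identity theorem for slice regular functions. -/
theorem SliceRegularOnCircular.eventually_eq_zero {g : H2 → ℍ[ℝ]} {Ω : Set H2}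
    (hg : SliceRegularOnCircular g Ω) {x : H2} (hx : x ∈ Ω)
    (hcl : x ∈ closure {y | ∀ᶠ t in 𝓝 y, g t = 0}) : ∀ᶠ y in 𝓝 x, g y = 0 := by
  obtain ⟨D, F, hF, rfl, h⟩ := hg
  have hc : Continuous fun y : H2 => (sliceCoord y.1, sliceCoord y.2) := by
    have := continuous_sliceCoord
    fun_prop
  set z₀ : ℂ × ℂ := (sliceCoord x.1, sliceCoord x.2) with hz₀
  have hz₀D : z₀ ∈ D := (mem_circularization_iff hF.conjInvariant x).mp hx
  obtain ⟨ε, hε, hball⟩ := Metric.isOpen_iff.mp hF.isOpen z₀ hz₀D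
  obtain ⟨y, hyb, hy⟩ := mem_closure_iff_nhds.mp hcl _
    (hc.continuousAt.preimage_mem_nhds (Metric.ball_mem_nhds z₀ hε))
  set u : ℂ × ℂ := (sliceCoord y.1, sliceCoord y.2) with hu
  obtain ⟨J₁, h₁, e₁⟩ := exists_sliceEmb_sliceCoord y.1
  obtain ⟨J₂, h₂, e₂⟩ := exists_sliceEmb_sliceCoord y.2
  -- Since `g` vanishes near `y`, it vanishes at points with coordinates near `u` and units near
  -- `J₁`, `J₂`. Two distinct units in each slot suffice to kill the stem.
  have hu0 : ∀ᶠ w in 𝓝 u, F w = 0 := by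
    have hcont : Continuous fun q : (ℍ[ℝ] × ℍ[ℝ]) × (ℂ × ℂ) =>
        ((sliceEmb q.1.1 q.2.1, sliceEmb q.1.2 q.2.2) : H2) := by
      have := continuous_sliceEmb
      exact (this.comp (by fun_prop : Continuous fun q : (ℍ[ℝ] × ℍ[ℝ]) × (ℂ × ℂ) =>
        (q.1.1, q.2.1))).prodMk (this.comp (by fun_prop : Continuous
        fun q : (ℍ[ℝ] × ℍ[ℝ]) × (ℂ × ℂ) => (q.1.2, q.2.2)))
    have hev : ∀ᶠ q in 𝓝 (((J₁, J₂), u) : (ℍ[ℝ] × ℍ[ℝ]) × (ℂ × ℂ)),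
        g (sliceEmb q.1.1 q.2.1, sliceEmb q.1.2 q.2.2) = 0 := by
      refine (hcont.continuousAt (x := ((J₁, J₂), u))).eventually (p := fun t => g t = 0) ?_
      change ∀ᶠ t in 𝓝 ((sliceEmb J₁ (sliceCoord y.1), sliceEmb J₂ (sliceCoord y.2)) : H2), g t = 0
      rw [← e₁, ← e₂]
      exact hy
    rw [nhds_prod_eq, nhds_prod_eq] at hev
    obtain ⟨P, hP, Q, hQ, hPQ⟩ := Filter.eventually_prod_iff.mp hev
    obtain ⟨P₁, hP₁, P₂, hP₂, hPP⟩ := Filter.eventually_prod_iff.mp hP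
    obtain ⟨K₁, k₁, kP₁, kne₁⟩ := exists_imagUnit_ne_of_mem_nhds h₁ hP₁
    obtain ⟨K₂, k₂, kP₂, kne₂⟩ := exists_imagUnit_ne_of_mem_nhds h₂ hP₂
    filter_upwards [hQ, hF.isOpen.mem_nhds (hball hyb)] with w hw hwD
    refine stem_eq_zero_of_forall_mem kne₁ kne₂ fun L₁ hL₁ L₂ hL₂ => ?_
    have l₁ : L₁ ∈ imagUnits ∧ P₁ L₁ := by
      rcases hL₁ with rfl | rfl
      · exact ⟨k₁, kP₁⟩
      · exact ⟨h₁, hP₁.self_of_nhds⟩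
    have l₂ : L₂ ∈ imagUnits ∧ P₂ L₂ := by
      rcases hL₂ with rfl | rfl
      · exact ⟨k₂, kP₂⟩
      · exact ⟨h₂, hP₂.self_of_nhds⟩
    rw [← h w hwD L₁ l₁.1 L₂ l₂.1]
    exact hPQ (hPP l₁.2 l₂.2) hw
  refine eventually_eq_zero_of_stem h ?_
  filter_upwards [Metric.ball_mem_nhds z₀ hε] with w hw
  exact ⟨hball hw, hF.eq_zero_of_eventually hball hyb hw hu0⟩

theorem SliceRegularOnCircular.of_univ {g h : H2 → ℍ[ℝ]} {Ω : Set H2}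
    (hg : SliceRegularOnCircular g Ω) (hh : SliceRegularOnCircular h Set.univ) :
    SliceRegularOnCircular h Ω := by
  obtain ⟨D, F, hF, rfl, -⟩ := hg
  obtain ⟨D', F', hF', hD, e'⟩ := hh
  have : D' = Set.univ := circularization_injective hF'.conjInvariant conjInvariant_univ
    (by rw [← hD, circularization_univ])
  subst this
  exact ⟨D, F', ⟨hF.isOpen, hF.conjInvariant, fun z _ => hF'.parity₁ z trivial,
    fun z _ => hF'.parity₂ z trivial, hF'.contDiffOn.mono (Set.subset_univ _),
    fun z _ => hF'.dbar₁ z trivial, fun z _ => hF'.dbar₂ z trivial⟩, rfl,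
    fun z _ => e' z trivial⟩

theorem SliceRegularOnCircular.sub {g h : H2 → ℍ[ℝ]} {Ω : Set H2}
    (hg : SliceRegularOnCircular g Ω) (hh : SliceRegularOnCircular h Ω) :
    SliceRegularOnCircular (fun x => g x - h x) Ω := by
  simpa [sub_eq_add_neg] using hg.add (hh.mul_right (-1))

/-- A slice regular map that agrees with an entire one on an open set accumulating at a point
agrees with it near that point. -/
theorem SliceRegularAt.eventuallyEq_of_mem_closure {g P : H2 → H2} {x : H2}
    (hg : SliceRegularAt g x) (h1 : SliceRegularOnCircular (fun y => (P y).1) Set.univ)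
    (h2 : SliceRegularOnCircular (fun y => (P y).2) Set.univ)
    (hcl : x ∈ closure {y | ∀ᶠ t in 𝓝 y, g t = P t}) : ∀ᶠ y in 𝓝 x, g y = P y := by
  obtain ⟨Ω, G, hx, hG1, hG2, hgG⟩ := hg
  have hcl' : x ∈ closure {y | ∀ᶠ t in 𝓝 y, G t = P t} := by
    obtain ⟨U, hU, hUo, hxU⟩ := eventually_nhds_iff.mp hgG
    refine mem_closure_iff_nhds.mpr fun V hV => ?_
    obtain ⟨y, ⟨hyV, hyU⟩, hy⟩ := mem_closure_iff_nhds.mp hcl _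
      (Filter.inter_mem hV (hUo.mem_nhds hxU))
    refine ⟨y, hyV, ?_⟩
    have hy' : ∀ᶠ t in 𝓝 y, g t = P t := hy
    change ∀ᶠ t in 𝓝 y, G t = P t
    filter_upwards [hy', hUo.mem_nhds hyU] with t a b
    rw [← hU t b, a]
  have e1 := (hG1.sub (hG1.of_univ h1)).eventually_eq_zero hx (closure_mono (fun y hy => by
    have hy' : ∀ᶠ t in 𝓝 y, G t = P t := hy
    change ∀ᶠ t in 𝓝 y, _ = _
    filter_upwards [hy'] with t ht
    rw [ht, sub_self]) hcl')
  have e2 := (hG2.sub (hG2.of_univ h2)).eventually_eq_zero hx (closure_mono (fun y hy => by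
    have hy' : ∀ᶠ t in 𝓝 y, G t = P t := hy
    change ∀ᶠ t in 𝓝 y, _ = _
    filter_upwards [hy'] with t ht
    rw [ht, sub_self]) hcl')
  filter_upwards [e1, e2, hgG] with y a b c
  rw [c]
  exact Prod.ext (sub_eq_zero.mp a) (sub_eq_zero.mp b)

/-- A slice regular function that vanishes on a slice near a real point vanishes near that
point. -/
theorem SliceRegularOnCircular.eventually_eq_zero_of_slice {g : H2 → ℍ[ℝ]} {Ω : Set H2}
    (hg : SliceRegularOnCircular g Ω) {J : ℍ[ℝ]} (hJ : J ∈ imagUnits) {a b : ℝ}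
    (hx : slicePt J ((a : ℂ), (b : ℂ)) ∈ Ω)
    (h0 : ∀ᶠ z in 𝓝 (((a : ℂ), (b : ℂ)) : ℂ × ℂ), g (slicePt J z) = 0) :
    ∀ᶠ y in 𝓝 (slicePt J ((a : ℂ), (b : ℂ))), g y = 0 := by
  obtain ⟨D, F, hF, rfl, h⟩ := hg
  set z₀ : ℂ × ℂ := ((a : ℂ), (b : ℂ)) with hz₀
  have hz₀D : z₀ ∈ D := (sliceEmb_mem_circularization hF.conjInvariant hJ hJ z₀).mp hx
  refine eventually_eq_zero_of_stem h ?_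
  have ea : sliceCoord (slicePt J z₀).1 = z₀.1 := by
    change sliceCoord (sliceEmb J _) = _
    rw [sliceCoord_sliceEmb hJ]; apply Complex.ext <;> simp [hz₀]
  have eb : sliceCoord (slicePt J z₀).2 = z₀.2 := by
    change sliceCoord (sliceEmb J _) = _
    rw [sliceCoord_sliceEmb hJ]; apply Complex.ext <;> simp [hz₀]
  rw [ea, eb]
  have hs : ∀ᶠ z in 𝓝 z₀, z ∈ D ∧ stemEval J (F z) = 0 := by
    filter_upwards [h0, hF.isOpen.mem_nhds hz₀D] with z hz hzD
    refine ⟨hzD, ?_⟩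
    rw [stemEval_apply, ← h z hzD J hJ J hJ]
    exact hz
  -- A real point is fixed by the conjugations, so the conjugates of nearby points stay near it and
  -- one slice controls all four components of the stem.
  have t : ∀ c : ℂ × ℂ → ℂ × ℂ, Continuous c → c z₀ = z₀ →
      ∀ᶠ z in 𝓝 z₀, c z ∈ D ∧ stemEval J (F (c z)) = 0 := fun c hc hcz =>
    hc.continuousAt.eventually (by rw [hcz]; exact hs)
  filter_upwards [hs, t (fun z => (star z.1, z.2)) (by fun_prop) (by simp [hz₀]),
    t (fun z => (z.1, star z.2)) (by fun_prop) (by simp [hz₀]),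
    t (fun z => (star z.1, star z.2)) (by fun_prop) (by simp [hz₀])] with z a1 a2 a3 a4
  exact ⟨a1.1, hF.eq_zero_of_stemEval hJ a1.1 a1.2 a2.2 a3.2 a4.2⟩

/-- A slice regular map that agrees with an entire one on a slice near a real point agrees with
it near that point. -/
theorem SliceRegularAt.eventuallyEq_of_slice {g P : H2 → H2} {J : ℍ[ℝ]} (hJ : J ∈ imagUnits)
    {a b : ℝ} (hg : SliceRegularAt g (slicePt J ((a : ℂ), (b : ℂ))))
    (h1 : SliceRegularOnCircular (fun y => (P y).1) Set.univ)
    (h2 : SliceRegularOnCircular (fun y => (P y).2) Set.univ)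
    (h0 : ∀ᶠ z in 𝓝 (((a : ℂ), (b : ℂ)) : ℂ × ℂ), g (slicePt J z) = P (slicePt J z)) :
    ∀ᶠ y in 𝓝 (slicePt J ((a : ℂ), (b : ℂ))), g y = P y := by
  obtain ⟨Ω, G, hx, hG1, hG2, hgG⟩ := hg
  have h3 := (continuous_slicePt J).continuousAt.eventually hgG
  have e1 := (hG1.sub (hG1.of_univ h1)).eventually_eq_zero_of_slice hJ hx (by
    filter_upwards [h0, h3] with z hz hz'
    rw [← hz', hz, sub_self])
  have e2 := (hG2.sub (hG2.of_univ h2)).eventually_eq_zero_of_slice hJ hx (by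
    filter_upwards [h0, h3] with z hz hz'
    rw [← hz', hz, sub_self])
  filter_upwards [e1, e2, hgG] with y a b c
  rw [c]
  exact Prod.ext (sub_eq_zero.mp a) (sub_eq_zero.mp b)

/-! ### Laurent coefficients on the punctured plane -/

section Laurent

open Complex MeasureTheory intervalIntegral

variable {V : Type*} [NormedAddCommGroup V] [NormedSpace ℂ V]

/-- The `d`-th Laurent coefficient, as an integral over the unit circle. -/
def laurentCoeff (k : ℂ → V) (d : ℤ) : V :=
  ((2 * Real.pi : ℝ) : ℂ)⁻¹ • ∫ θ in 0..2 * Real.pi, (circleMap 0 1 θ) ^ (-d) • k (circleMap 0 1 θ)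

theorem circleMap_zero_one_ne (θ : ℝ) : circleMap 0 1 θ ≠ 0 :=
  circleMap_ne_center one_ne_zero

theorem integral_circle_eq_of_differentiableAt [CompleteSpace V] {f : ℂ → V}
    (hf : ∀ z ≠ 0, DifferentiableAt ℂ f z) {r R : ℝ} (hr : 0 < r) (hR : 0 < R) :
    (∫ θ in 0..2 * Real.pi, f (circleMap 0 R θ)) = ∫ θ in 0..2 * Real.pi, f (circleMap 0 r θ) := by
  wlog hle : r ≤ R generalizing r R
  · exact (this hR hr (le_of_not_ge hle)).symm
  have h := Complex.circleIntegral_sub_center_inv_smul_eq_of_differentiable_on_annulus_off_countable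
    (c := 0) hr hle (f := f) (s := ∅) Set.countable_empty
    (fun z hz => (hf z (by
      rintro rfl
      exact hz.2 (by simpa using hr))).continuousAt.continuousWithinAt)
    (fun z hz => hf z (by
      rintro rfl
      exact hz.1.2 (by simpa using hr.le)))
  simp only [circleIntegral, sub_zero, smul_smul, deriv_circleMap] at h
  have e : ∀ ρ : ℝ, 0 < ρ → ∀ θ : ℝ, circleMap 0 ρ θ * I * (circleMap 0 ρ θ)⁻¹ = I := by
    intro ρ hρ θ
    have := circleMap_ne_center (c := 0) hρ.ne' (θ := θ)
    field_simp
  simp only [e r hr, e R hR, intervalIntegral.integral_smul] at h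
  exact smul_right_injective V I_ne_zero h

/-- The argument of `τ` only shifts the angle, by periodicity; its modulus changes the radius, which
does not affect the integral of a function holomorphic off `0`. -/
theorem laurentCoeff_comp_mul [CompleteSpace V] {k : ℂ → V}
    (hk : ∀ z ≠ 0, DifferentiableAt ℂ k z) (d : ℤ) {τ : ℂ} (hτ : τ ≠ 0) :
    laurentCoeff (fun t => k (t * τ)) d = τ ^ d • laurentCoeff k d := by
  have hρ : 0 < ‖τ‖ := norm_pos_iff.mpr hτ
  set G : ℝ → V := fun θ => (circleMap 0 ‖τ‖ θ) ^ (-d) • k (circleMap 0 ‖τ‖ θ) with hG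
  have e1 : ∀ θ : ℝ, circleMap 0 1 θ * τ = circleMap 0 ‖τ‖ (θ + arg τ) := by
    intro θ
    conv_lhs => rw [← norm_mul_exp_arg_mul_I τ]
    simp only [circleMap_zero, ofReal_add, add_mul, Complex.exp_add, ofReal_one]
    ring
  have e2 : ∀ θ : ℝ, (circleMap 0 1 θ) ^ (-d) • k (circleMap 0 1 θ * τ) =
      τ ^ d • G (θ + arg τ) := by
    intro θ
    simp only [hG, ← e1, mul_zpow, smul_smul]
    congr 1
    rw [mul_comm (_ ^ _ : ℂ) (_ * _), mul_assoc, ← zpow_add₀ hτ, neg_add_cancel, zpow_zero, mul_one]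
  have hper : Function.Periodic G (2 * Real.pi) := by
    intro θ
    simp only [hG, periodic_circleMap 0 ‖τ‖ θ]
  have e3 : (∫ θ in 0..2 * Real.pi, G (θ + arg τ)) = ∫ θ in 0..2 * Real.pi, G θ := by
    rw [intervalIntegral.integral_comp_add_right, zero_add, add_comm (2 * Real.pi)]
    have := hper.intervalIntegral_add_eq (arg τ) 0
    rwa [zero_add] at this
  have e4 := integral_circle_eq_of_differentiableAt (f := fun z => z ^ (-d) • k z)
    (fun z hz => (differentiableAt_zpow.mpr (.inl hz)).smul (hk z hz)) one_pos hρ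
  unfold laurentCoeff
  simp only [e2, intervalIntegral.integral_smul]
  rw [e3, hG, e4, smul_comm]

/-- A constant contributes only to the coefficient of index zero, so the translation part `b`
disappears. -/
theorem laurentCoeff_clm [CompleteSpace V] {k : ℂ → V}
    (hk : Continuous fun θ : ℝ => k (circleMap 0 1 θ)) {d : ℤ}
    (hd : d ≠ 0) (L : V →L[ℂ] V) (b : V) :
    laurentCoeff (fun t => L (k t) + b) d = L (laurentCoeff k d) := by
  have hz : Continuous fun θ : ℝ => (circleMap 0 1 θ) ^ (-d) :=
    (continuous_circleMap 0 1).zpow₀ _ fun θ => .inl (circleMap_zero_one_ne θ)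
  have h0 : (∫ θ in 0..2 * Real.pi, (circleMap 0 1 θ) ^ (-d)) = 0 := by
    have h := circleIntegral.integral_sub_zpow_of_ne (n := -d - 1) (by omega) 0 0 1
    simp only [circleIntegral, sub_zero, deriv_circleMap, smul_eq_mul] at h
    have e : ∀ θ : ℝ, circleMap 0 1 θ * I * (circleMap 0 1 θ) ^ (-d - 1) =
        I * (circleMap 0 1 θ) ^ (-d) := by
      intro θ
      rw [zpow_sub_one₀ (circleMap_zero_one_ne θ)]
      have := circleMap_zero_one_ne θ
      field_simp
    simp only [e, intervalIntegral.integral_const_mul] at h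
    exact (mul_eq_zero.mp h).resolve_left I_ne_zero
  unfold laurentCoeff
  simp only [smul_add]
  rw [intervalIntegral.integral_add, intervalIntegral.integral_smul_const, h0, zero_smul, add_zero,
    map_smul, ← ContinuousLinearMap.intervalIntegral_comp_comm]
  · simp only [map_smul]
  · exact (hz.smul hk).intervalIntegrable _ _
  · exact (hz.smul (L.continuous.comp hk)).intervalIntegrable _ _
  · exact (hz.smul continuous_const).intervalIntegrable _ _

theorem continuous_laurentCoeff {X : Type*} [TopologicalSpace X] [FirstCountableTopology X]
    [LocallyCompactSpace X] {F : X → ℂ → V}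
    (hF : Continuous fun q : X × ℝ => F q.1 (circleMap 0 1 q.2)) (d : ℤ) :
    Continuous fun x => laurentCoeff (F x) d := by
  have hz : Continuous fun q : X × ℝ => (circleMap 0 1 q.2) ^ (-d) :=
    ((continuous_circleMap 0 1).comp continuous_snd).zpow₀ _ fun q =>
      .inl (circleMap_zero_one_ne q.2)
  unfold laurentCoeff
  refine Continuous.const_smul ?_ _
  exact intervalIntegral.continuous_parametric_intervalIntegral_of_continuous'
    (f := fun x θ => (circleMap 0 1 θ) ^ (-d) • F x (circleMap 0 1 θ)) (hz.smul hF) _ _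

theorem differentiable_intervalIntegral_of_continuous [CompleteSpace V] {G : ℂ → ℝ → V}
    (hG : Continuous G.uncurry) (hd : ∀ θ, Differentiable ℂ fun s => G s θ) (a b : ℝ) :
    Differentiable ℂ fun s => ∫ θ in a..b, G s θ := by
  intro s₀
  obtain ⟨C, hC⟩ := ((isCompact_closedBall s₀ 2).prod (isCompact_uIcc (a := a) (b := b))).exists_bound_of_continuousOn
    hG.continuousOn
  refine (intervalIntegral.hasDerivAt_integral_of_dominated_loc_of_deriv_le (μ := volume)
    (F' := fun s θ => deriv (fun s => G s θ) s) (bound := fun _ => C)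
    (Metric.ball_mem_nhds s₀ one_pos) (.of_forall fun s => ?_) ?_ ?_ ?_ ?_ ?_).2.differentiableAt
  · exact (hG.comp (Continuous.prodMk_right s)).aestronglyMeasurable
  · exact (hG.comp (Continuous.prodMk_right s₀)).intervalIntegrable _ _
  · have := stronglyMeasurable_deriv_with_param (𝕜 := ℂ) (f := fun θ s => G s θ)
      (hG.comp continuous_swap)
    exact (this.comp_measurable (measurable_id.prodMk measurable_const)).aestronglyMeasurable
  · refine .of_forall fun θ hθ s hs => ?_
    -- Cauchy's estimate on unit circles: a bound for `G` on the ball of radius two dominates the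
    -- derivative on the unit ball.
    have := norm_deriv_le_of_forall_mem_sphere_norm_le one_pos
      ((hd θ).diffContOnCl (s := Metric.ball s 1)) (C := C) (fun z hz => by
        refine hC (z, θ) ⟨?_, Set.uIoc_subset_uIcc hθ⟩
        rw [Metric.mem_closedBall]
        have h1 : dist z s = 1 := hz
        have h2 : dist s s₀ < 1 := hs
        linarith [dist_triangle z s s₀])
    simpa using this
  · exact intervalIntegrable_const
  · exact .of_forall fun θ _ s _ => (hd θ s).hasDerivAt

theorem differentiable_laurentCoeff [CompleteSpace V] {F : ℂ → ℂ → V}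
    (hF : Continuous fun q : ℂ × ℝ => F q.1 (circleMap 0 1 q.2))
    (hd : ∀ θ : ℝ, Differentiable ℂ fun s => F s (circleMap 0 1 θ)) (d : ℤ) :
    Differentiable ℂ fun s => laurentCoeff (F s) d := by
  have hz : Continuous fun q : ℂ × ℝ => (circleMap 0 1 q.2) ^ (-d) :=
    ((continuous_circleMap 0 1).comp continuous_snd).zpow₀ _ fun q =>
      .inl (circleMap_zero_one_ne q.2)
  unfold laurentCoeff
  refine Differentiable.const_smul ?_ _
  exact differentiable_intervalIntegral_of_continuous
    (G := fun x θ => (circleMap 0 1 θ) ^ (-d) • F x (circleMap 0 1 θ)) (hz.smul hF)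
    (fun θ => (hd θ).const_smul _) _ _

theorem eq_sum_laurentCoeff_complex {k : ℂ → ℂ}
    (hk : Continuous fun θ : ℝ => k (circleMap 0 1 θ)) (S : Finset ℤ)
    (hS : ∀ d ∉ S, laurentCoeff k d = 0) : k 1 = ∑ d ∈ S, laurentCoeff k d := by
  have hT : Fact (0 < 2 * Real.pi) := ⟨Real.two_pi_pos⟩
  have hper : Function.Periodic (fun θ : ℝ => k (circleMap 0 1 θ)) (2 * Real.pi) := fun θ => by
    simp only [periodic_circleMap 0 1 θ]
  let f : C(AddCircle (2 * Real.pi), ℂ) := ⟨hper.lift, by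
    refine continuous_coinduced_dom.mpr ?_
    exact hk⟩
  have hf : ∀ θ : ℝ, f θ = k (circleMap 0 1 θ) := fun θ => rfl
  have hc : ∀ d, fourierCoeff f d = laurentCoeff k d := by
    intro d
    rw [fourierCoeff_eq_intervalIntegral f d 0, zero_add, laurentCoeff]
    rw [one_div, ← ofReal_inv, Complex.coe_smul]
    congr 1
    refine intervalIntegral.integral_congr fun θ _ => ?_
    simp only [hf, fourier_coe_apply]
    congr 1
    rw [circleMap_zero, ofReal_one, one_mul, ← Complex.exp_int_mul]
    congr 1
    have : (Real.pi : ℂ) ≠ 0 := by exact_mod_cast Real.pi_ne_zero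
    push_cast
    field_simp
  have hsum : Summable (fourierCoeff f) := by
    refine summable_of_ne_finset_zero (s := S) fun d hd => ?_
    rw [hc, hS d hd]
  have h := has_pointwise_sum_fourier_series_of_summable hsum ((0 : ℝ) : AddCircle (2 * Real.pi))
  have h' : HasSum (fun i => fourierCoeff f i • fourier i ((0 : ℝ) : AddCircle (2 * Real.pi)))
      (∑ d ∈ S, fourierCoeff f d • fourier d ((0 : ℝ) : AddCircle (2 * Real.pi))) :=
    hasSum_sum_of_ne_finset_zero fun d hd => by rw [hc, hS d hd, zero_smul]
  have := h.unique h'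
  rw [hf] at this
  simp only [hc, circleMap_zero] at this
  simpa using this

/-- Reduced to scalar functions by continuous functionals; there it is a finite Fourier series
evaluated at angle zero. -/
theorem eq_sum_laurentCoeff [CompleteSpace V] {k : ℂ → V}
    (hk : Continuous fun θ : ℝ => k (circleMap 0 1 θ)) (S : Finset ℤ)
    (hS : ∀ d ∉ S, laurentCoeff k d = 0) : k 1 = ∑ d ∈ S, laurentCoeff k d := by
  rw [SeparatingDual.eq_iff_forall_dual_eq (R := ℂ)]
  intro g
  have hc : ∀ d, laurentCoeff (fun z => g (k z)) d = g (laurentCoeff k d) := by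
    intro d
    have hz : Continuous fun θ : ℝ => (circleMap 0 1 θ) ^ (-d) :=
      (continuous_circleMap 0 1).zpow₀ _ fun θ => .inl (circleMap_zero_one_ne θ)
    unfold laurentCoeff
    rw [map_smul, ← ContinuousLinearMap.intervalIntegral_comp_comm]
    · simp only [map_smul]
    · exact (hz.smul hk).intervalIntegrable _ _
  rw [map_sum]
  simp only [← hc]
  exact eq_sum_laurentCoeff_complex (g.continuous.comp hk) S fun d hd => by
    rw [hc, hS d hd, map_zero]

end Laurent

/-! ### Polynomial entire functions equivariant under a translation -/

section Entire

variable {V : Type*} [NormedAddCommGroup V] [NormedSpace ℂ V]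

theorem iteratedDeriv_eq_zero_of_growth [CompleteSpace V] {q : ℂ → V} (hq : Differentiable ℂ q)
    {C : ℝ} {m : ℕ} (hC : ∀ s : ℂ, 1 ≤ ‖s‖ → ‖q s‖ ≤ C * ‖s‖ ^ m) :
    iteratedDeriv (m + 1) q = 0 := by
  have hC0 : 0 ≤ C := by simpa using (norm_nonneg _).trans (hC 1 (by simp))
  funext c
  set K : ℝ := (m + 1).factorial * C * 2 ^ m with hK
  -- Cauchy's estimate on the circle of radius `R` about `c`; the lower bound on `R` gives `1 ≤ ‖z‖
  -- ≤ 2R` there, where the growth hypothesis applies.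
  have hbound : ∀ R : ℝ, ‖c‖ + 1 ≤ R → ‖iteratedDeriv (m + 1) q c‖ ≤ K / R := by
    intro R hR
    have hR0 : 0 < R := by linarith [norm_nonneg c]
    have := Complex.norm_iteratedDeriv_le_of_forall_mem_sphere_norm_le (m + 1) hR0
      (hq.diffContOnCl (s := Metric.ball c R)) (C := C * (2 * R) ^ m) fun z hz => by
        have hz' : ‖z - c‖ = R := by simpa [dist_eq_norm] using hz
        have h1 : 1 ≤ ‖z‖ := by
          have := norm_sub_le z c
          linarith
        have h2 : ‖z‖ ≤ 2 * R := by
          have := norm_sub_norm_le z c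
          linarith
        refine (hC z h1).trans ?_
        gcongr
    refine this.trans_eq ?_
    rw [hK]
    field_simp
    ring
  have hlim : Filter.Tendsto (fun R : ℝ => K / R) Filter.atTop (𝓝 0) :=
    Filter.Tendsto.const_div_atTop Filter.tendsto_id K
  have := ge_of_tendsto hlim ((Filter.eventually_ge_atTop (‖c‖ + 1)).mono hbound)
  exact norm_le_zero_iff.mp this

theorem Differentiable.iteratedDeriv_complex [CompleteSpace V] {q : ℂ → V}
    (hq : Differentiable ℂ q) (n : ℕ) : Differentiable ℂ (iteratedDeriv n q) :=
  (hq.contDiff (n := ⊤)).differentiable_iteratedDeriv n (WithTop.coe_lt_top _)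

theorem iteratedDeriv_equivariant [CompleteSpace V] {q : ℂ → V} (hq : Differentiable ℂ q) {μ : ℂ}
    {B : V →L[ℂ] V} (h : ∀ s, q (s + μ) = B (q s)) (n : ℕ) (s : ℂ) :
    iteratedDeriv n q (s + μ) = B (iteratedDeriv n q s) := by
  induction n generalizing s with
  | zero => simpa using h s
  | succ n ih =>
    rw [iteratedDeriv_succ]
    have h1 : (fun s => iteratedDeriv n q (s + μ)) = fun s => B (iteratedDeriv n q s) := funext ih
    have h2 := congrArg (fun f => deriv f s) h1
    simp only [deriv_comp_add_const] at h2
    rw [h2]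
    exact (B.hasFDerivAt.comp_hasDerivAt s
      ((hq.iteratedDeriv_complex n) s).hasDerivAt).deriv


/-- A nonzero polynomial function has a last nonvanishing derivative, which is constant. -/
theorem exists_iteratedDeriv_eq_const [CompleteSpace V] {q : ℂ → V} (hq : Differentiable ℂ q)
    (hq0 : q ≠ 0) {m : ℕ} (hm : iteratedDeriv m q = 0) :
    ∃ (n : ℕ) (e : V), e ≠ 0 ∧ ∀ s, iteratedDeriv n q s = e := by
  induction m with
  | zero => exact absurd (by simpa using hm) hq0
  | succ m ih =>
    by_cases h : iteratedDeriv m q = 0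
    · exact ih h
    · have hc : ∀ s, iteratedDeriv m q s = iteratedDeriv m q 0 := fun s =>
        is_const_of_deriv_eq_zero (hq.iteratedDeriv_complex m) (fun t => by
          rw [← iteratedDeriv_succ, hm]; rfl) s 0
      refine ⟨m, iteratedDeriv m q 0, fun h0 => h ?_, hc⟩
      funext s
      rw [hc s, h0]
      rfl

theorem eq_of_deriv_eq_const {g : ℂ → V} (hg : Differentiable ℂ g) {e : V}
    (h : ∀ s, deriv g s = e) (s : ℂ) : g s = g 0 + s • e := by
  have hd : ∀ t, HasDerivAt (fun s => g s - s • e) 0 t := fun t => by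
    have := (hg t).hasDerivAt.sub ((hasDerivAt_id t).smul_const e)
    rwa [h, one_smul, sub_self] at this
  have := is_const_of_deriv_eq_zero (fun t => (hd t).differentiableAt) (fun t => (hd t).deriv) s 0
  simp only [zero_smul, sub_zero] at this
  rw [← this, sub_add_cancel]

theorem eq_of_deriv_eq_affine {g : ℂ → V} (hg : Differentiable ℂ g) {a e : V}
    (h : ∀ s, deriv g s = a + s • e) (s : ℂ) : g s = g 0 + s • a + (s ^ 2 / 2) • e := by
  have hd : ∀ t, HasDerivAt (fun s => g s - (s ^ 2 / 2) • e) a t := fun t => by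
    have h1 : HasDerivAt (fun s : ℂ => s ^ 2 / 2) t t := by
      simpa using ((hasDerivAt_id t).pow 2).div_const 2
    have := (hg t).hasDerivAt.sub (h1.smul_const e)
    rwa [h, add_sub_cancel_right] at this
  have := eq_of_deriv_eq_const (fun t => (hd t).differentiableAt) (fun t => (hd t).deriv) s
  simp only [ne_eq, OfNat.ofNat_ne_zero, not_false_eq_true, zero_pow, zero_div, zero_smul,
    sub_zero] at this
  rw [← this, sub_add_cancel]

/-- If `B` is equal to the identity up to a square-zero operator as soon as it has a nontrivial
Jordan block for the eigenvalue `1`, then every polynomial function intertwining a translation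
with `B` has degree at most one; `B` is a Jordan block when the degree is one. -/
theorem eq_affine_of_equivariant [CompleteSpace V] {q : ℂ → V} (hq : Differentiable ℂ q)
    {m : ℕ} (hm : iteratedDeriv m q = 0) {μ : ℂ} (hμ : μ ≠ 0) {B : V →L[ℂ] V}
    (hB : ∀ v w, w ≠ 0 → B w = w → B v = v + w → ∀ x, B (B x - x) = B x - x)
    (h : ∀ s, q (s + μ) = B (q s)) :
    ∃ a c : V, (∀ s, q s = a + s • c) ∧ (c ≠ 0 → ∀ x, B (B x - x) = B x - x) := by
  by_cases hq0 : q = 0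
  · exact ⟨0, 0, fun s => by simp [hq0], fun h => absurd rfl h⟩
  obtain ⟨n, e, he, hn⟩ := exists_iteratedDeriv_eq_const hq hq0 hm
  obtain _ | n := n
  · exact ⟨e, 0, fun s => by simpa using hn s, fun h => absurd rfl h⟩
  have hg := eq_of_deriv_eq_const (hq.iteratedDeriv_complex n) (e := e) fun s => by
    rw [← iteratedDeriv_succ, hn]
  have hBe : B e = e := by
    have := iteratedDeriv_equivariant hq h (n + 1) 0
    rwa [hn, hn, eq_comm] at this
  have hBg : B (iteratedDeriv n q 0) = iteratedDeriv n q 0 + μ • e := by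
    rw [← iteratedDeriv_equivariant hq h n 0, hg, zero_add]
  have hN := hB _ (μ • e) (smul_ne_zero hμ he) (by rw [map_smul, hBe]) hBg
  obtain _ | n := n
  · exact ⟨q 0, e, by simpa using hg, fun _ => hN⟩
  -- In degree at least two, some derivative `g` of `q` is quadratic. The unipotency relation says
  -- that its second difference with step `μ` is zero, but that difference is `μ² e`.
  · exfalso
    have hg2 := eq_of_deriv_eq_affine (hq.iteratedDeriv_complex n)
      (a := iteratedDeriv (n + 1) q 0) (e := e) fun s => by rw [← iteratedDeriv_succ, hg]
    set g := iteratedDeriv n q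
    have h1 : B (g 0) = g μ := by
      rw [← iteratedDeriv_equivariant hq h n 0, zero_add]
    have h2 : B (g μ) = g (μ + μ) := (iteratedDeriv_equivariant hq h n μ).symm
    have h3 := hN (g 0)
    rw [map_sub, h1, h2, hg2 (μ + μ), hg2 μ] at h3
    have h4 : (μ ^ 2) • e = 0 := by
      rw [← sub_eq_zero] at h3
      rw [← h3]
      module
    exact smul_ne_zero (pow_ne_zero 2 hμ) he h4

theorem continuous_eq_at_zero {W : Type*} [TopologicalSpace W] [T2Space W] {f g : ℂ → W}
    (hf : Continuous f) (hg : Continuous g)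
    (h : ∀ v ≠ 0, f v = g v) : f 0 = g 0 :=
  congrFun (hf.ext_on (dense_compl_singleton 0) hg fun v hv => h v hv) 0

/-- Negative exponents force their coefficients to vanish, and positive powers vanish at `0`. A
nonzero value at `0` thus needs a zero exponent, and since `d ≠ 0` it must be `d - p`. -/
theorem weight_eq_of_continuous {φ : ℂ → V} (hφ : Continuous φ) (h0 : φ 0 ≠ 0) {p : ℕ}
    (hp : p ≠ 0) {d : ℤ} (hd : d ≠ 0) {a c : V}
    (h : ∀ v ≠ 0, φ v = v ^ d • a + v ^ (d - p) • c) : d = p ∧ c ≠ 0 := by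
  have key : ∀ (i j : ℕ), i ≠ 0 → d = i → d - p = j → φ 0 = (0 : ℂ) ^ j • c := by
    intro i j hi hdi hdj
    have := continuous_eq_at_zero (g := fun v => v ^ i • a + v ^ j • c) hφ (by fun_prop)
      fun v hv => by rw [h v hv, hdj, hdi, zpow_natCast, zpow_natCast]
    simpa [hi] using this
  rcases lt_trichotomy d p with hlt | heq | hgt
  · exfalso
    obtain ⟨n, hn⟩ := Int.eq_ofNat_of_zero_le (a := p - d) (by omega)
    have hc : c = 0 := by
      have := continuous_eq_at_zero (f := fun v => v ^ n • φ v) (g := fun v => v ^ p • a + c)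
        (by fun_prop) (by fun_prop) fun v hv => by
          simp only [h v hv, smul_add, smul_smul]
          rw [← zpow_natCast, ← zpow_natCast, ← zpow_add₀ hv, ← zpow_add₀ hv, ← hn]
          simp
      have hn0 : n ≠ 0 := by omega
      simpa [hn0, hp, eq_comm] using this
    subst hc
    simp only [smul_zero, add_zero] at h
    rcases lt_or_gt_of_ne hd with hneg | hpos
    · obtain ⟨i, hi⟩ := Int.eq_ofNat_of_zero_le (a := -d) (by omega)
      have ha : a = 0 := by
        have := continuous_eq_at_zero (f := fun v => v ^ i • φ v) (g := fun v => a)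
          (by fun_prop) (by fun_prop) fun v hv => by
            simp only [h v hv, smul_smul]
            rw [← zpow_natCast, ← zpow_add₀ hv, ← hi]
            simp
        have hi0 : i ≠ 0 := by omega
        simpa [hi0, eq_comm] using this
      exact h0 (continuous_eq_at_zero hφ continuous_const fun v hv => by rw [h v hv, ha, smul_zero])
    · obtain ⟨i, hi⟩ := Int.eq_ofNat_of_zero_le (a := d) (by omega)
      have := continuous_eq_at_zero (g := fun v => v ^ i • a) hφ (by fun_prop)
        fun v hv => by rw [h v hv, hi]; simp
      have hi0 : i ≠ 0 := by omega
      exact h0 (by simpa [hi0] using this)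
  · refine ⟨heq, fun hc => h0 ?_⟩
    have := key p 0 hp heq (by simp [heq])
    rw [this, hc, smul_zero]
  · exfalso
    obtain ⟨i, hi⟩ := Int.eq_ofNat_of_zero_le (a := d) (by omega)
    obtain ⟨j, hj⟩ := Int.eq_ofNat_of_zero_le (a := d - p) (by omega)
    have := key i j (by omega) hi hj
    have hj0 : j ≠ 0 := by omega
    exact h0 (by simpa [hj0] using this)

end Entire

/-! ### Weighted homogeneous components of a holomorphic map on `ℂ² ∖ {0}` -/

section Weighted

variable {V : Type*} [NormedAddCommGroup V] [NormedSpace ℂ V]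

/-- The component of weight `d` of `h` for the action `t ↦ (t ^ p u, t v)` of `ℂ*`. -/
def weightComp (p : ℕ) (h : ℂ × ℂ → V) (d : ℤ) (x : ℂ × ℂ) : V :=
  laurentCoeff (fun t => h (t ^ p * x.1, t * x.2)) d

theorem weight_ne_zero (p : ℕ) {t : ℂ} (ht : t ≠ 0) {x : ℂ × ℂ} (hx : x ≠ 0) :
    ((t ^ p * x.1, t * x.2) : ℂ × ℂ) ≠ 0 := by
  intro h
  simp only [Prod.mk_eq_zero, mul_eq_zero, pow_eq_zero_iff', ht, false_and, false_or] at h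
  exact hx (Prod.ext h.1 h.2)

variable {p : ℕ} {h : ℂ × ℂ → V}

theorem continuous_weight_circle (hh : ∀ x ≠ 0, DifferentiableAt ℂ h x) {X : Type*}
    [TopologicalSpace X] {x : X → ℂ × ℂ} (hx : Continuous x) (hx0 : ∀ y, x y ≠ 0) :
    Continuous fun q : X × ℝ =>
      h ((circleMap 0 1 q.2) ^ p * (x q.1).1, circleMap 0 1 q.2 * (x q.1).2) := by
  have hc : Continuous fun q : X × ℝ => circleMap 0 1 q.2 :=
    (continuous_circleMap 0 1).comp continuous_snd
  have hx' : Continuous fun q : X × ℝ => x q.1 := hx.comp continuous_fst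
  refine continuous_iff_continuousAt.mpr fun q => ContinuousAt.comp
    (f := fun q : X × ℝ => (((circleMap 0 1 q.2) ^ p * (x q.1).1, circleMap 0 1 q.2 * (x q.1).2) :
      ℂ × ℂ))
    (hh _ (weight_ne_zero p (circleMap_zero_one_ne q.2) (hx0 q.1))).continuousAt
    (Continuous.continuousAt (by fun_prop))

theorem continuous_weight_circle_const (hh : ∀ x ≠ 0, DifferentiableAt ℂ h x) {x : ℂ × ℂ}
    (hx : x ≠ 0) :
    Continuous fun θ : ℝ => h ((circleMap 0 1 θ) ^ p * x.1, circleMap 0 1 θ * x.2) :=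
  continuous_iff_continuousAt.mpr fun θ => ContinuousAt.comp
    (f := fun θ : ℝ => (((circleMap 0 1 θ) ^ p * x.1, circleMap 0 1 θ * x.2) : ℂ × ℂ))
    (hh _ (weight_ne_zero p (circleMap_zero_one_ne θ) hx)).continuousAt
    (Continuous.continuousAt (by have := continuous_circleMap 0 1; fun_prop))

theorem weightComp_weight [CompleteSpace V] (hh : ∀ x ≠ 0, DifferentiableAt ℂ h x) (d : ℤ)
    {τ : ℂ} (hτ : τ ≠ 0) {x : ℂ × ℂ} (hx : x ≠ 0) :
    weightComp p h d (τ ^ p * x.1, τ * x.2) = τ ^ d • weightComp p h d x := by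
  unfold weightComp
  rw [← laurentCoeff_comp_mul (k := fun t => h (t ^ p * x.1, t * x.2)) _ d hτ]
  · simp only [mul_pow, mul_assoc]
  · intro z hz
    exact (hh _ (weight_ne_zero p hz hx)).comp (f := fun t : ℂ => (t ^ p * x.1, t * x.2)) z
      (by fun_prop)

theorem weightComp_eq_zpow_smul [CompleteSpace V] (hh : ∀ x ≠ 0, DifferentiableAt ℂ h x) (d : ℤ)
    (u : ℂ) {v : ℂ} (hv : v ≠ 0) :
    weightComp p h d (u, v) = v ^ d • weightComp p h d (u / v ^ p, 1) := by
  rw [← weightComp_weight hh d hv (by simp), mul_one, mul_div_cancel₀ _ (pow_ne_zero p hv)]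

theorem differentiable_weightComp [CompleteSpace V] (hh : ∀ x ≠ 0, DifferentiableAt ℂ h x)
    (d : ℤ) : Differentiable ℂ fun s => weightComp p h d (s, 1) := by
  refine differentiable_laurentCoeff
    (continuous_weight_circle hh (x := fun s : ℂ => (s, 1)) (by fun_prop) (by simp)) ?_ d
  intro θ s
  exact (hh _ (weight_ne_zero p (circleMap_zero_one_ne θ) (x := (s, 1)) (by simp))).comp
    (f := fun s : ℂ => ((circleMap 0 1 θ) ^ p * s, circleMap 0 1 θ * 1)) s (by fun_prop)

theorem continuous_weightComp (hh : ∀ x ≠ 0, DifferentiableAt ℂ h x) (d : ℤ) :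
    Continuous fun v => weightComp p h d (1, v) :=
  continuous_laurentCoeff
    (continuous_weight_circle hh (x := fun v : ℂ => (1, v)) (by fun_prop) (by simp)) d

/-- Homogeneity moves `(s, 1)` to `(1, v)` with `v^p = 1/s`. For `‖s‖ ≥ 1` this stays in a compact
set, so the component grows at most like `‖s‖^|d|` and is polynomial in `s`. -/
theorem iteratedDeriv_weightComp [CompleteSpace V] (hp : p ≠ 0)
    (hh : ∀ x ≠ 0, DifferentiableAt ℂ h x) (d : ℤ) :
    iteratedDeriv (d.natAbs + 1) (fun s => weightComp p h d (s, 1)) = 0 := by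
  obtain ⟨C, hC⟩ := (isCompact_closedBall (0 : ℂ) 1).exists_bound_of_continuousOn
    (continuous_weightComp (p := p) hh d).continuousOn
  refine iteratedDeriv_eq_zero_of_growth (differentiable_weightComp hh d) (C := C) fun s hs => ?_
  have hs0 : s ≠ 0 := norm_pos_iff.mp (by linarith)
  obtain ⟨v, hv⟩ := IsAlgClosed.exists_pow_nat_eq s⁻¹ (Nat.pos_of_ne_zero hp)
  have hv0 : v ≠ 0 := by
    rintro rfl
    rw [zero_pow hp, eq_comm, inv_eq_zero] at hv
    exact hs0 hv
  have hvs : ‖v‖⁻¹ ^ p = ‖s‖ := by rw [inv_pow, ← norm_pow, hv, norm_inv, inv_inv]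
  have hv1 : 1 ≤ ‖v‖⁻¹ := by
    by_contra! hlt
    have := pow_lt_one₀ (by positivity) hlt hp
    linarith
  have hpos : 0 < ‖v‖ := norm_pos_iff.mpr hv0
  have h1 := weightComp_eq_zpow_smul (p := p) hh d 1 hv0
  rw [hv, one_div, inv_inv] at h1
  have h2 : weightComp p h d (s, 1) = v ^ (-d) • weightComp p h d (1, v) := by
    rw [h1, smul_smul, ← zpow_add₀ hv0, neg_add_cancel, zpow_zero, one_smul]
  have h3 := hC v (by
    rw [mem_closedBall_zero_iff]
    exact (one_le_inv₀ hpos).mp hv1)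
  have h4 : ‖v ^ (-d)‖ ≤ ‖s‖ ^ d.natAbs := by
    calc ‖v ^ (-d)‖ = ‖v‖⁻¹ ^ d := by rw [norm_zpow, inv_zpow, zpow_neg]
      _ ≤ ‖v‖⁻¹ ^ (d.natAbs : ℤ) := zpow_le_zpow_right₀ hv1 (by omega)
      _ = ‖v‖⁻¹ ^ d.natAbs := zpow_natCast _ _
      _ ≤ (‖v‖⁻¹ ^ p) ^ d.natAbs := by
        gcongr
        exact le_self_pow₀ hv1 hp
      _ = ‖s‖ ^ d.natAbs := by rw [hvs]
  rw [h2, norm_smul, mul_comm]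
  exact mul_le_mul h3 h4 (norm_nonneg _) ((norm_nonneg _).trans h3)

/-- The transformation commutes with the weighted action of `ℂ*`, so taking weight components
preserves equivariance. In the coordinate `s = u / v^p` it is a translation. -/
theorem weightComp_equivariant [CompleteSpace V] (hh : ∀ x ≠ 0, DifferentiableAt ℂ h x)
    {ρ : ℂ} (hρ : ρ ≠ 0) {ℓ : ℂ} {L : V →L[ℂ] V} {b : V}
    (heq : ∀ u v, (u, v) ≠ (0 : ℂ × ℂ) → h (ρ ^ p * u + v ^ p * ℓ, ρ * v) = L (h (u, v)) + b)
    {d : ℤ} (hd : d ≠ 0) (s : ℂ) :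
    weightComp p h d (s + ℓ / ρ ^ p, 1) = (ρ ^ (-d) • L) (weightComp p h d (s, 1)) := by
  have h1 : weightComp p h d (ρ ^ p * s + ℓ, ρ) = L (weightComp p h d (s, 1)) := by
    unfold weightComp
    rw [← laurentCoeff_clm (continuous_weight_circle_const hh (x := (s, 1)) (by simp)) hd L b]
    unfold laurentCoeff
    congr 1
    refine intervalIntegral.integral_congr fun θ _ => ?_
    have := heq ((circleMap 0 1 θ) ^ p * s) (circleMap 0 1 θ * 1)
      (weight_ne_zero p (circleMap_zero_one_ne θ) (x := (s, 1)) (by simp))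
    simp only [← this]
    congr 3 <;> ring
  have h2 := weightComp_eq_zpow_smul (p := p) hh d (ρ ^ p * s + ℓ) hρ
  rw [add_div, mul_div_cancel_left₀ _ (pow_ne_zero p hρ), h1] at h2
  rw [smul_apply, h2, smul_smul, ← zpow_add₀ hρ, neg_add_cancel, zpow_zero,
    one_smul]

theorem exists_weightComp_ne_zero [CompleteSpace V] (hp : p ≠ 0)
    (hh : ∀ x ≠ 0, DifferentiableAt ℂ h x) {u : ℂ} (hu : u ≠ 0) (hne : h (u, 0) ≠ h (1, 0)) :
    ∃ d ≠ 0, weightComp p h d (1, 0) ≠ 0 := by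
  by_contra! hcon
  -- The points `(u, 0)` with `u ≠ 0` form one orbit, so if all nonzero weights vanish at `(1, 0)`
  -- only the constant weight-zero part remains there.
  have key : ∀ u : ℂ, u ≠ 0 → h (u, 0) = weightComp p h 0 (1, 0) := by
    intro u hu
    obtain ⟨t, ht⟩ := IsAlgClosed.exists_pow_nat_eq u (Nat.pos_of_ne_zero hp)
    have ht0 : t ≠ 0 := by
      rintro rfl
      rw [zero_pow hp] at ht
      exact hu ht.symm
    have hw : ∀ d, weightComp p h d (u, 0) = t ^ d • weightComp p h d (1, 0) := fun d => by
      rw [← weightComp_weight hh d ht0 (by simp), ht, mul_one, mul_zero]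
    have := eq_sum_laurentCoeff
      (continuous_weight_circle_const (p := p) hh (x := (u, 0)) (by simpa using hu)) {0}
      fun d hd => by
        have := hw d
        rw [hcon d (by simpa using hd), smul_zero] at this
        exact this
    rw [Finset.sum_singleton] at this
    have h0 := hw 0
    rw [zpow_zero, one_smul] at h0
    rw [← h0]
    simpa [weightComp] using this
  exact hne ((key u hu).trans (key 1 one_ne_zero).symm)

/-- A holomorphic map on `ℂ² ∖ {0}`, not constant on the line `v = 0`, that intertwines
`(u, v) ↦ (ρ ^ p u + ℓ v ^ p, ρ v)` with an affine map is a linear combination of `1`, `u`, `v ^ p`,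
provided that a multiple of the linear part with a Jordan block for the eigenvalue `1` is equal to
the identity up to a square-zero operator. -/
theorem eq_affine_pow_of_equivariant [CompleteSpace V] (hp : p ≠ 0)
    (hh : ∀ x ≠ 0, DifferentiableAt ℂ h x) {ρ : ℝ} (hρ : ρ ≠ 0) (hρ1 : |ρ| < 1) {ℓ : ℂ}
    (hℓ : ℓ ≠ 0) {L : V →L[ℂ] V} {b : V}
    (heq : ∀ u v, (u, v) ≠ (0 : ℂ × ℂ) →
      h ((ρ : ℂ) ^ p * u + v ^ p * ℓ, (ρ : ℂ) * v) = L (h (u, v)) + b)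
    (hL : ∀ r : ℝ, ∀ v w : V, w ≠ 0 → (r : ℂ) • L w = w → (r : ℂ) • L v = v + w →
      ∀ x, (r : ℂ) • L ((r : ℂ) • L x - x) = (r : ℂ) • L x - x)
    {u₀ : ℂ} (hu₀ : u₀ ≠ 0) (hne : h (u₀, 0) ≠ h (1, 0)) :
    ∃ c₀ c a : V, ∀ u v : ℂ, v ≠ 0 → h (u, v) = u • c + v ^ p • a + c₀ := by
  have hρ' : (ρ : ℂ) ≠ 0 := by exact_mod_cast hρ
  obtain ⟨d, hd, hd0⟩ := exists_weightComp_ne_zero hp hh hu₀ hne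
  have hμ : ℓ / (ρ : ℂ) ^ p ≠ 0 := div_ne_zero hℓ (pow_ne_zero p hρ')
  have hrw : ∀ d : ℤ, ((ρ ^ (-d) : ℝ) : ℂ) = (ρ : ℂ) ^ (-d) := fun d => by push_cast; rfl
  obtain ⟨a, c, hac, hN⟩ := eq_affine_of_equivariant (differentiable_weightComp (p := p) hh d)
    (iteratedDeriv_weightComp hp hh d) hμ
    (fun v w hw h1 h2 => by
      have := hL (ρ ^ (-d)) v w hw (by rw [hrw]; exact h1) (by rw [hrw]; exact h2)
      rw [hrw] at this
      exact this)
    (weightComp_equivariant hh hρ' heq hd)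
  obtain ⟨hdp, hc⟩ := weight_eq_of_continuous (continuous_weightComp (p := p) hh d) hd0 hp hd
    (a := a) (c := c) fun v hv => by
      rw [weightComp_eq_zpow_smul hh d 1 hv, hac, smul_add, smul_smul, zpow_sub₀ hv, zpow_natCast,
        mul_one_div]
  have hN := hN hc
  -- The last nonzero derivative of another component is an eigenvector of `L` for `ρ^d'`.
  -- Unipotency of `ρ^(-d) L` allows only `ρ^d`, and `|ρ| < 1` separates the powers.
  have hzero : ∀ d' : ℤ, d' ≠ 0 → d' ≠ d → ∀ s, weightComp p h d' (s, 1) = 0 := by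
    intro d' hd'0 hd' s
    by_contra hs
    obtain ⟨n, e, he, hn⟩ := exists_iteratedDeriv_eq_const
      (differentiable_weightComp (p := p) hh d') (fun h0 => hs (congrFun h0 s))
      (iteratedDeriv_weightComp hp hh d')
    have h1 := iteratedDeriv_equivariant (differentiable_weightComp (p := p) hh d')
      (weightComp_equivariant hh hρ' heq hd'0) n 0
    rw [hn, hn, smul_apply] at h1
    have hLe : L e = (ρ : ℂ) ^ d' • e := by
      conv_rhs => rw [h1, smul_smul, ← zpow_add₀ hρ', add_neg_cancel, zpow_zero, one_smul]
    set κ : ℂ := (ρ : ℂ) ^ (-d) * (ρ : ℂ) ^ d' with hκ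
    have hBe : ((ρ : ℂ) ^ (-d) • L) e = κ • e := by
      rw [smul_apply, hLe, smul_smul]
    have h2 := hN e
    rw [map_sub, hBe, map_smul, hBe, ← sub_eq_zero] at h2
    have h3 : (κ - 1) ^ 2 • e = 0 := by
      rw [← h2]
      module
    have h4 : κ = 1 := by
      have := (smul_eq_zero.mp h3).resolve_right he
      exact sub_eq_zero.mp (pow_eq_zero_iff two_ne_zero |>.mp this)
    rw [hκ, ← zpow_add₀ hρ'] at h4
    have h5 : |ρ| ^ (-d + d') = 1 := by
      have := congrArg norm h4
      simpa [norm_zpow] using this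
    rw [zpow_eq_one_iff_right₀ (abs_nonneg ρ) hρ1.ne] at h5
    omega
  -- For weight zero the growth bound already kills the first derivative.
  have hconst : ∀ s, weightComp p h 0 (s, 1) = weightComp p h 0 (0, 1) := fun s =>
    is_const_of_deriv_eq_zero (differentiable_weightComp (p := p) hh 0) (fun t => by
      have := congrFun (iteratedDeriv_weightComp (p := p) hp hh 0) t
      simpa using this) s 0
  refine ⟨weightComp p h 0 (0, 1), c, a, fun u v hv => ?_⟩
  have hsum := eq_sum_laurentCoeff
    (continuous_weight_circle_const (p := p) hh (x := (u, v)) (by simp [hv])) {d, 0}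
    fun d' hd' => by
      have hd' : d' ≠ d ∧ d' ≠ 0 := by simpa using hd'
      have := weightComp_eq_zpow_smul (p := p) hh d' u hv
      rw [hzero d' hd'.2 hd'.1, smul_zero] at this
      exact this
  rw [Finset.sum_pair hd] at hsum
  have e1 : weightComp p h d (u, v) = u • c + v ^ p • a := by
    rw [weightComp_eq_zpow_smul hh d u hv, hac, hdp, zpow_natCast, smul_add, smul_smul,
      mul_div_cancel₀ _ (pow_ne_zero p hv), add_comm]
  have e2 : weightComp p h 0 (u, v) = weightComp p h 0 (0, 1) := by
    rw [weightComp_eq_zpow_smul hh 0 u hv, hconst, zpow_zero, one_smul]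
  rw [← e1, ← e2]
  simpa [weightComp] using hsum

end Weighted

/-! ### Nonexistence of affine structures in case B -/

/-- A left linear endomorphism of `ℍ²` with a Jordan block for the eigenvalue `1` differs from the
identity by a square-zero operator. -/
theorem unipotent_of_jordanBlock (B : H2 →ₗ[ℍ[ℝ]] H2) {v w : H2} (hw : w ≠ 0) (hBw : B w = w)
    (hBv : B v = v + w) (x : H2) : B (B x - x) = B x - x := by
  have hli : LinearIndependent ℍ[ℝ] ![w, v] := by
    refine LinearIndependent.pair_iff.mpr fun s t hst => ?_
    have h1 := congrArg B hst
    rw [map_add, map_smul, map_smul, hBw, hBv, smul_add, ← add_assoc, hst, zero_add,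
      map_zero] at h1
    have ht : t = 0 := (smul_eq_zero.mp h1).resolve_right hw
    rw [ht, zero_smul, add_zero] at hst
    exact ⟨(smul_eq_zero.mp hst).resolve_right hw, ht⟩
  -- The vectors `w` and `v` form a left basis of `ℍ²`, so the Jordan block determines `B`
  -- completely.
  have hspan := hli.span_eq_top_of_card_eq_finrank (by
    rw [Module.finrank_prod, Module.finrank_self, Fintype.card_fin])
  have hx : x ∈ Submodule.span ℍ[ℝ] (Set.range ![w, v]) := hspan ▸ Submodule.mem_top
  rw [Matrix.range_cons, Matrix.range_cons, Matrix.range_empty, Set.union_empty,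
    Set.singleton_union, Submodule.mem_span_pair] at hx
  obtain ⟨s, t, rfl⟩ := hx
  have : B (s • w + t • v) - (s • w + t • v) = t • w := by
    rw [map_add, map_smul, map_smul, hBw, hBv, smul_add]
    abel
  rw [this, map_smul, hBw]

theorem exists_ne_near_one {J : ℍ[ℝ]} (hJ : J ∈ imagUnits) {U : Set H2}
    (hU : U ∈ 𝓝 (slicePt J (1, 0))) : ∃ u : ℂ, u ≠ 0 ∧ slicePt J (u, 0) ∈ U ∧
      slicePt J (u, 0) ≠ slicePt J (1, 0) := by
  have hc : Continuous fun u : ℂ => slicePt J (u, 0) :=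
    (continuous_slicePt J).comp (by fun_prop)
  have h1 : ∀ᶠ u in 𝓝[≠] (1 : ℂ), slicePt J (u, 0) ∈ U :=
    (hc.continuousAt.eventually hU).filter_mono nhdsWithin_le_nhds
  have h2 : ∀ᶠ u in 𝓝[≠] (1 : ℂ), u ≠ 0 :=
    (eventually_ne_nhds one_ne_zero).filter_mono nhdsWithin_le_nhds
  obtain ⟨u, hu1, hu2, hu3⟩ := (h1.and (h2.and self_mem_nhdsWithin)).exists
  refine ⟨u, hu2, hu1, fun h => hu3 (sliceEmb_injective hJ ?_)⟩
  exact congrArg Prod.fst h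

/-- On the slice of `λ`, an equivariant slice regular map is affine in `z` and `w ^ p`. -/
theorem exists_eq_affine_pow_on_slice {p : ℕ} (hp : p ≠ 0) {r : ℝ} (hr : r ≠ 0) (hr1 : |r| < 1)
    {J : ℍ[ℝ]} (hJ : J ∈ imagUnits) {ℓ : ℂ} (hℓ : ℓ ≠ 0) {dev : H2 → H2}
    (hreg : ∀ x ≠ 0, SliceRegularAt dev x) (hinj : ∀ x ≠ 0, ∃ U ∈ 𝓝 x, Set.InjOn dev U)
    {A : Matrix (Fin 2) (Fin 2) ℍ[ℝ]} {b : H2}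
    (heq : ∀ x ≠ 0, dev (hopfMap p ((r : ℍ[ℝ]) ^ p) r (sliceEmb J ℓ) x) = affineH2 A b (dev x)) :
    ∃ c₀ c a : H2, ∀ u v : ℂ, v ≠ 0 →
      dev (slicePt J (u, v)) = sliceEmb J u • c + sliceEmb J v ^ p • a + c₀ := by
  obtain ⟨T, hT⟩ := exists_equiv_complex hJ
  let S : H2 ≃L[ℝ] (ℂ × ℂ) × (ℂ × ℂ) := T.prodCongr T
  have hS : ∀ (z : ℂ) (x : H2), S (sliceEmb J z • x) = z • S x := fun z x =>
    Prod.ext (map_sliceEmb_mul hT z x.1) (map_sliceEmb_mul hT z x.2)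
  have hS' : ∀ (z : ℂ) (y), S.symm (z • y) = sliceEmb J z • S.symm y := fun z y => by
    rw [ContinuousLinearEquiv.symm_apply_eq, hS, ContinuousLinearEquiv.apply_symm_apply]
  let L : (ℂ × ℂ) × (ℂ × ℂ) →L[ℂ] (ℂ × ℂ) × (ℂ × ℂ) :=
    { toFun := fun y => S (rowMulCLM A (S.symm y))
      map_add' := fun y z => by simp only [map_add]
      map_smul' := fun z y => by
        rw [hS', rowMulCLM_smul, hS]
        rfl
      cont := by fun_prop }
  have hLS : ∀ x, L (S x) = S (rowMulCLM A x) := fun x =>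
    congrArg (fun y => S (rowMulCLM A y)) (S.symm_apply_apply x)
  -- Real multiples of `x ↦ x A` stay left `ℍ`-linear, whereas general complex multiples do not;
  -- this is why the Jordan condition is required only for real scalars.
  let B : ℝ → (H2 →ₗ[ℍ[ℝ]] H2) := fun t =>
    { toFun := fun x => t • rowMulCLM A x
      map_add' := fun x y => by rw [map_add, smul_add]
      map_smul' := fun c x => by
        rw [rowMulCLM_smul, smul_comm]
        rfl }
  have hLB : ∀ (t : ℝ) x, (t : ℂ) • L (S x) = S (B t x) := fun t x => by
    rw [hLS, Complex.coe_smul, ← map_smul]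
    rfl
  let h : ℂ × ℂ → (ℂ × ℂ) × (ℂ × ℂ) := fun z => S (dev (slicePt J z))
  have hh : ∀ z ≠ 0, DifferentiableAt ℂ h z := fun z hz =>
    (hreg _ (slicePt_ne_zero hJ hz)).differentiableAt_slice hJ hT
  obtain ⟨U, hU, hUi⟩ := hinj (slicePt J (1, 0)) (slicePt_ne_zero hJ (by simp))
  obtain ⟨u₀, hu0, huU, hne⟩ := exists_ne_near_one hJ hU
  obtain ⟨c₀, c, a, hfin⟩ := eq_affine_pow_of_equivariant (p := p) (h := h) (L := L) (b := S b)
    (ℓ := ℓ) hp hh hr hr1 hℓ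
    (fun u v huv => by
      have h1 : slicePt J ((r : ℂ) ^ p * u + v ^ p * ℓ, (r : ℂ) * v) =
          hopfMap p ((r : ℍ[ℝ]) ^ p) r (sliceEmb J ℓ) (slicePt J (u, v)) := by
        simp only [slicePt, hopfMap, sliceEmb_add, sliceEmb_mul hJ, sliceEmb_pow hJ,
          sliceEmb_ofReal]
        rw [← Quaternion.coe_pow, Quaternion.coe_commutes, Quaternion.coe_commutes]
      simp only [h]
      rw [h1, heq _ (slicePt_ne_zero hJ huv), affineH2_eq, map_add, hLS])
    (fun t v w hw h1 h2 x => by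
      obtain ⟨v, rfl⟩ := S.surjective v
      obtain ⟨w, rfl⟩ := S.surjective w
      obtain ⟨x, rfl⟩ := S.surjective x
      rw [hLB] at h1 h2
      rw [← map_add] at h2
      have := unipotent_of_jordanBlock (B t) (fun h0 => hw (by rw [h0, map_zero])) (S.injective h1)
        (S.injective h2) x
      rw [hLB, ← map_sub, hLB, this])
    hu0 (fun hcon => hne (hUi huU (mem_of_mem_nhds hU) (S.injective hcon)))
  refine ⟨S.symm c₀, S.symm c, S.symm a, fun u v hv => S.injective ?_⟩
  rw [map_add, map_add, hS, ← sliceEmb_pow hJ, hS]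
  simpa using hfin u v hv

/-- By the local identity theorem the set of agreement of germs is closed as well as open in the
connected space `ℍ² ∖ {0}`. -/
theorem eventuallyEq_of_eventuallyEq_at {dev P : H2 → H2} (hreg : ∀ x ≠ 0, SliceRegularAt dev x)
    (h1 : SliceRegularOnCircular (fun y => (P y).1) Set.univ)
    (h2 : SliceRegularOnCircular (fun y => (P y).2) Set.univ) {x₀ : H2} (hx₀ : x₀ ≠ 0)
    (h0 : ∀ᶠ y in 𝓝 x₀, dev y = P y) {x : H2} (hx : x ≠ 0) : ∀ᶠ y in 𝓝 x, dev y = P y := by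
  let Z : Set PuncturedH2 := {x | ∀ᶠ y in 𝓝 (x : H2), dev y = P y}
  have hopen : IsOpen Z := isOpen_iff_mem_nhds.mpr fun y hy =>
    continuous_subtype_val.continuousAt.eventually (Filter.Eventually.eventually_nhds hy)
  have hclosed : IsClosed Z := by
    refine isClosed_of_closure_subset fun y hy => ?_
    refine (hreg y y.2).eventuallyEq_of_mem_closure h1 h2 ?_
    exact closure_mono (by rintro _ ⟨z, hz, rfl⟩; exact hz)
      (image_closure_subset_closure_image continuous_subtype_val ⟨y, hy, rfl⟩)
  have := IsClopen.eq_univ ⟨hclosed, hopen⟩ ⟨⟨x₀, hx₀⟩, h0⟩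
  have hmem : (⟨x, hx⟩ : PuncturedH2) ∈ Z := this ▸ Set.mem_univ _
  exact hmem

/-- The map `w ↦ w ^ p`, `p > 1`, is not locally injective on `ℍ ∖ {0}`: it is constant on the sphere
of a nonreal `p`-th root of `-1`. -/
theorem exists_pow_eq_of_mem_nhds {p : ℕ} (hp : 1 < p) :
    ∃ q : ℍ[ℝ], q ≠ 0 ∧ ∀ U ∈ 𝓝 q, ∃ q' ∈ U, q' ≠ q ∧ q' ^ p = q ^ p := by
  have hp0 : (p : ℂ) ≠ 0 := by exact_mod_cast (by omega : p ≠ 0)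
  -- For `p > 1` this root of `-1` is not real, so it spreads to a genuine sphere; its `p`-th power
  -- is real, hence independent of the imaginary unit.
  set ζ : ℂ := Complex.exp ((Real.pi / p : ℝ) * Complex.I) with hζ
  have hζp : ζ ^ p = -1 := by
    rw [hζ, ← Complex.exp_nat_mul, ← Complex.exp_pi_mul_I]
    congr 1
    push_cast
    field_simp
  have him : ζ.im ≠ 0 := by
    rw [hζ, Complex.exp_ofReal_mul_I_im]
    have hp1 : (1 : ℝ) < p := by exact_mod_cast hp
    exact (Real.sin_pos_of_pos_of_lt_pi (by positivity) (div_lt_self Real.pi_pos hp1)).ne'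
  have hpow : ∀ K ∈ imagUnits, sliceEmb K ζ ^ p = sliceEmb unitI (-1) := fun K hK => by
    rw [← sliceEmb_pow hK, hζp]
    simp [sliceEmb]
  refine ⟨sliceEmb unitI ζ, fun h => ?_, fun U hU => ?_⟩
  · have := sliceEmb_injective unitI_mem (h.trans (sliceEmb_zero unitI).symm)
    rw [this] at him
    exact him rfl
  · have hc : Continuous fun K => sliceEmb K ζ := by
      unfold sliceEmb
      fun_prop
    obtain ⟨K, hK, hKU, hne⟩ := exists_imagUnit_ne_of_mem_nhds unitI_mem
      (hc.continuousAt.preimage_mem_nhds hU)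
    refine ⟨_, hKU, fun h => hne ?_, by rw [hpow K hK, hpow _ unitI_mem]⟩
    exact smul_right_injective _ him (add_left_cancel h)

theorem not_admitsSliceRegularAffineCharts {p : ℕ} {α β l : ℍ[ℝ]} {hp : p ≠ 0} {hα : 0 < ‖α‖}
    {hβ : 0 < ‖β‖} (hB : HopfCaseB p α β l) (hαβ : ‖α‖ ≤ ‖β‖) (hβ1 : ‖β‖ < 1) :
    ¬ AdmitsSliceRegularAffineCharts (hopfAtlas p α β l hp hα hβ) := by
  intro h
  obtain ⟨dev, hreg, hinj, A, b, heq⟩ := exists_hopf_developingMap (.inr hB) hαβ hβ1 h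
  obtain ⟨hl, hp1, ⟨r, rfl⟩, rfl⟩ := hB
  -- The slice is chosen to contain `λ`, so that `f` preserves it and acts there as a complex map.
  obtain ⟨J, hJ, ℓ, rfl⟩ := exists_sliceEmb l
  have hr : r ≠ 0 := by
    rintro rfl
    simp at hβ
  have hr1 : |r| < 1 := by simpa using hβ1
  have hℓ : ℓ ≠ 0 := by
    rintro rfl
    simp at hl
  obtain ⟨c₀, c, a, hslice⟩ := exists_eq_affine_pow_on_slice hp hr hr1 hJ hℓ hreg hinj heq
  let P : H2 → H2 := fun x =>
    (x.1 * c.1 + x.2 ^ p * a.1 + c₀.1, x.1 * c.2 + x.2 ^ p * a.2 + c₀.2)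
  have h1 := sliceRegularOnCircular_affine_pow p c.1 a.1 c₀.1
  have h2 := sliceRegularOnCircular_affine_pow p c.2 a.2 c₀.2
  -- The base point `(0, 1)` is real, so one slice determines `dev` around it, and has `v ≠ 0`,
  -- where the formula for `h` holds.
  have hx₀ : slicePt J (((0 : ℝ) : ℂ), ((1 : ℝ) : ℂ)) ≠ 0 := slicePt_ne_zero hJ (by simp)
  have h0 := (hreg _ hx₀).eventuallyEq_of_slice (P := P) hJ h1 h2 (by
    have : ∀ᶠ z : ℂ × ℂ in 𝓝 (((0 : ℝ) : ℂ), ((1 : ℝ) : ℂ)), z.2 ≠ 0 :=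
      continuous_snd.continuousAt.eventually_ne (by simp)
    filter_upwards [this] with z hz
    exact hslice z.1 z.2 hz)
  obtain ⟨q, hq, hq'⟩ := exists_pow_eq_of_mem_nhds hp1
  have hx : ((0, q) : H2) ≠ 0 := by simpa using hq
  have hdev := eventuallyEq_of_eventuallyEq_at hreg h1 h2 hx₀ h0 hx
  obtain ⟨U, hU, hUi⟩ := hinj _ hx
  have hUP : U ∩ {y | dev y = P y} ∈ 𝓝 ((0, q) : H2) := Filter.inter_mem hU hdev
  obtain ⟨q', hmem, hne, hpow⟩ := hq' _
    ((Continuous.prodMk_right (0 : ℍ[ℝ])).continuousAt.preimage_mem_nhds hUP)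
  have hmem0 := mem_of_mem_nhds hUP
  refine hne (congrArg Prod.snd (hUi hmem.1 hmem0.1 ?_))
  rw [hmem.2, hmem0.2]
  simp only [P, hpow]

end

/-! ### The theorem -/

theorem theorem2p1 (p : ℕ) (hp : p ≠ 0) (α β l : ℍ[ℝ])
    (hα : 0 < ‖α‖) (hαβ : ‖α‖ ≤ ‖β‖) (hβ : ‖β‖ < 1) (hres : (α - β ^ p) * l = 0)
    (hcase : HopfCaseA p α β l ∨ HopfCaseB p α β l) :
    (∀ γ ∈ hopfGroup p α β l hp hα (hα.trans_le hαβ),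
      SliceRegularOnPunctured (fun y => (γ y : H2)) Set.univ) ∧
    IsHopfSurface (hopfAtlas p α β l hp hα (hα.trans_le hαβ))
      (hopfProj p α β l hp hα (hα.trans_le hαβ)) ∧
    (AdmitsAffineStructure (hopfAtlas p α β l hp hα (hα.trans_le hαβ)) ↔ HopfCaseA p α β l) ∧
    (AdmitsSliceRegularAffineCharts (hopfAtlas p α β l hp hα (hα.trans_le hαβ)) ↔
      HopfCaseA p α β l) := by
  have hβ0 := hα.trans_le hαβ
  refine ⟨fun γ hγ => ?_, isHopfSurface_hopfAtlas hcase hαβ hβ, ⟨fun h => ?_, fun h => ?_⟩,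
    ⟨fun h => ?_, fun h => ?_⟩⟩
  · obtain ⟨G, -, h1, h2⟩ := hopfGroup_sliceRegular hcase γ hγ
    exact ⟨G, fun y _ => ⟨h2 y, h1 y⟩⟩
  · exact hcase.resolve_right fun hB =>
      not_admitsSliceRegularAffineCharts hB hαβ hβ h.sliceRegularAffineCharts
  · exact admitsAffineStructure_hopfAtlas h hαβ hβ
  · exact hcase.resolve_right fun hB => not_admitsSliceRegularAffineCharts hB hαβ hβ h
  · exact (admitsAffineStructure_hopfAtlas h hαβ hβ).sliceRegularAffineCharts
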